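/- Let $K$ be a finite connected simplicial complex whose vertices are ordered so that every simplex is totally ordered (this gives the face operators $\varepsilon_i$), let $v_0$ be a vertex, $\pi_1=\pi_1(K,v_0)$, $\pi:\widetilde K\to K$ the universal covering with the induced simplicial structure, on which $\pi_1$ acts by covering transformations. Let $\mathbf k=\mathbb R$ or $\mathbb C$ and let $\rho:\pi_1\to GL(E)$ be a representation on a finite dimensional $\mathbf k$-vector space $E$. Let $A^j(\Delta^q)$ be the space of smooth real $j$-forms on the standard $q$-simplex, and let $A^k(K)$ be the space of families $(\varphi_\sigma)$, $\varphi_\sigma\in A^k(\Delta^q)$ for each $q$-simplex $\sigma$ of $K$, $q\ge 0$, with $\varphi_{\varepsilon_i\sigma}=(\varepsilon^i)^*\varphi_\sigma$ for all faces $\varepsilon_i\sigma$ of $\sigma$. Let $C_\bullet(\widetilde K)$ be the complex of real simplicial chains and let $Du_n(\widetilde K)=\bigoplus_{j\ge 0}A^j(\Delta^{n+j})\otimes C_{n+j}(\widetilde K)$, with differential $$\partial(\omega\otimes\sigma)=(-1)^n d\omega\otimes\sigma+\sum_i(-1)^i(\varepsilon^i)^*\omega\otimes\varepsilon_i\sigma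 .$$ Let $C^\bullet(K,E)=\mathrm{Hom}_{\mathbb R[\pi_1]}(C_\bullet(\widetilde K),E)$ and $\mathfrak m^\bullet(K,E)=\mathrm{Hom}_{\mathbb R[\pi_1]}(Du_\bullet(\widetilde K),E)$, both with the differential $f\mapsto f\circ\partial$, and let $H^\bullet(K,E)$ be the cohomology of $C^\bullet(K,E)$. For $\varphi\in A^k(K)$ and $f\in\mathfrak m^n(K,E)$ put $(\varphi\cdot f)(\omega\otimes\sigma)=(-1)^{kn}f((\varphi_{\pi(\sigma)}\wedge\omega)\otimes\sigma)$. (i) The chain map $\psi^*:\mathfrak m^\bullet(K,E)\to C^\bullet(K,E)$ induced by $\psi:C_\bullet(\widetilde K)\to Du_\bullet(\widetilde K)$, $\psi(\sigma)=1\otimes\sigma$, is a quasi-isomorphism. (ii) Let $t\in\bigoplus_{i\ge 1}A^{2i+1}(K)$ be closed, let $\partial_t=\partial+t\,\cdot$ on $\mathfrak m^\bullet(K,E)$, and let $H^{ev}(K,E,t)$, $H^{od}(K,E,t)$ be the even and odd cohomology of the $\mathbb Z/2$-graded complex $(\mathfrak m^\bullet(K,E),\partial_t)$. Then all $H^i(K,E)$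 and $H^{ev}(K,E,t)$, $H^{od}(K,E,t)$ are finite dimensional, and there is a canonical isomorphism of graded lines $$\det H^\bullet(K,E)=\bigotimes_i(\det H^i(K,E))^{(-1)^i}\;\cong\;\det H^\bullet(K,E,t)=\det H^{ev}(K,E,t)\otimes(\det H^{od}(K,E,t))^{-1};$$ in particular $\sum_i(-1)^i\dim H^i(K,E)=\dim H^{ev}(K,E,t)-\dim H^{od}(K,E,t)$. Canonical means the following. Let $(E_r,d_r)_{r\ge2}$ be the spectral sequence of $(\mathfrak m^\bullet(K,E),\partial_t)$ filtered by $F_p=\bigoplus_{n\ge p}\mathfrak m^n(K,E)$, with $E_2=H^\bullet(\mathfrak m^\bullet(K,E),\partial)$, identified with $H^\bullet(K,E)$ by $\psi^*$. Consider the bases of $E_2$ consisting of pairs of classes with representatives $x_a$, $\partial_t x_a$ (so $d_r[x_a]=[\partial_t x_a]$ in some page $E_r$) and of classes with $\partial_t$-closed representatives $h_c$ whose classes form a basis of $H^\bullet(K,E,t)$; here an element of $F_p$ represents the class of its component in $\mathfrak m^p(K,E)$, the $x_a$ and $h_c$ are homogeneous for the $\mathbb Z/2$-grading, the pairs are listed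 in lexicographic order of their degrees, the $h_c$ in increasing order of degree, and in each degree the classes of the $\partial_t x_a$ come first, then those of the $h_c$, then those of the $x_a$. Such bases exist, and there is exactly one isomorphism which, for each of them, sends the generator of $\det H^\bullet(K,E)$ given by the basis of $H^\bullet(K,E)$ to the generator of $\det H^\bullet(K,E,t)$ given by the classes of the $h_c$. -/

import Mathlib

namespace TwistedTorsion

noncomputable section

open scoped ContDiff TensorProduct
open CategoryTheory

/-! ### Smooth forms on the standard simplex -/

/-- The standard `q`-simplex in affine coordinates: the point with barycentric coordinates
`(b₀, b₁, …, b_q)` is written `(b₁, …, b_q) ∈ ℝ^q`. -/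
def simplex (q : ℕ) : Set (Fin q → ℝ) := {x | (∀ i, 0 ≤ x i) ∧ ∑ i, x i ≤ 1}

theorem convex_simplex (q : ℕ) : Convex ℝ (simplex q) := by
  have h : simplex q = (⋂ i, {x : Fin q → ℝ | 0 ≤ x i}) ∩ {x | ∑ i, x i ≤ 1} := by
    ext x; simp [simplex]
  rw [h]
  refine (convex_iInter fun i => convex_halfSpace_ge ?_ _).inter (convex_halfSpace_le ?_ _)
  · exact ⟨fun _ _ => rfl, fun _ _ => rfl⟩
  · exact ⟨fun x y => by simp [Finset.sum_add_distrib], fun c x => by simp [Finset.mul_sum]⟩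

theorem nonempty_interior_simplex (q : ℕ) : (interior (simplex q)).Nonempty := by
  have hopen : IsOpen {x : Fin q → ℝ | (∀ i, 0 < x i) ∧ ∑ i, x i < 1} := by
    simp only [Set.ofPred_and, Set.ofPred_forall]
    refine (isOpen_iInter_of_finite fun i => isOpen_lt (by fun_prop) (by fun_prop)).inter
      (isOpen_lt (by fun_prop) (by fun_prop))
  refine ⟨fun _ => 1 / (q + 1 : ℝ), mem_interior.2 ⟨_, ?_, hopen, ?_⟩⟩
  · exact fun x hx => ⟨fun i => (hx.1 i).le, hx.2.le⟩
  · refine ⟨fun i => by positivity, ?_⟩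
    simp only [Finset.sum_const, Finset.card_univ, Fintype.card_fin, nsmul_eq_mul]
    rw [mul_one_div, div_lt_one (by positivity)]
    linarith

theorem uniqueDiffOn_simplex (q : ℕ) : UniqueDiffOn ℝ (simplex q) :=
  uniqueDiffOn_convex (convex_simplex q) (nonempty_interior_simplex q)

/-- Alternating `k`-linear forms on `ℝ^q`. -/
abbrev Alt (q k : ℕ) : Type := (Fin q → ℝ) [⋀^Fin k]→L[ℝ] ℝ

instance (q k : ℕ) : FiniteDimensional ℝ (Alt q k) := by
  let f : Alt q k →ₗ[ℝ] MultilinearMap ℝ (fun _ : Fin k => (Fin q → ℝ)) ℝ :=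
    { toFun := fun a => a.toMultilinearMap
      map_add' := fun _ _ => rfl
      map_smul' := fun _ _ => rfl }
  refine FiniteDimensional.of_injective f fun a b h => ?_
  ext v
  exact congrArg (fun g => g v) h

/-- `A^k(Δ^q)`: smooth real differential forms of degree `k` on the standard simplex `Δ^q`. A form
is a function on `Δ^q`; it is extended by zero to a function on `ℝ^q`. -/
def Form (q k : ℕ) : Submodule ℝ ((Fin q → ℝ) → Alt q k) where
  carrier := {φ | ContDiffOn ℝ ∞ φ (simplex q) ∧ ∀ x ∉ simplex q, φ x = 0}
  add_mem' h h' := ⟨h.1.add h'.1, fun x hx => by simp [h.2 x hx, h'.2 x hx]⟩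
  zero_mem' := ⟨contDiffOn_const, fun _ _ => rfl⟩
  smul_mem' c _ h := ⟨h.1.const_smul c, fun x hx => by simp [h.2 x hx]⟩

open scoped Classical in
/-- The form on `Δ^q` given by a function which is smooth on `Δ^q` (the values outside `Δ^q` are
discarded). -/
def Form.mk {q k : ℕ} (φ : (Fin q → ℝ) → Alt q k) (h : ContDiffOn ℝ ∞ φ (simplex q)) :
    Form q k :=
  ⟨(simplex q).indicator φ,
    h.congr fun _ hx => Set.indicator_of_mem hx _, fun _ hx => Set.indicator_of_notMem hx _⟩

theorem Form.ext' {q k : ℕ} {φ η : Form q k} (h : ∀ x ∈ simplex q, φ.1 x = η.1 x) : φ = η := by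
  ext1
  funext x
  by_cases hx : x ∈ simplex q
  · exact h x hx
  · rw [φ.2.2 x hx, η.2.2 x hx]

theorem Form.mk_apply {q k : ℕ} (φ : (Fin q → ℝ) → Alt q k) (h : ContDiffOn ℝ ∞ φ (simplex q))
    {x : Fin q → ℝ} (hx : x ∈ simplex q) : (Form.mk φ h).1 x = φ x :=
  Set.indicator_of_mem hx _

theorem Form.contDiffOn {q k : ℕ} (φ : Form q k) : ContDiffOn ℝ ∞ φ.1 (simplex q) := φ.2.1

theorem Form.contDiffOn_extDeriv {q k : ℕ} (φ : Form q k) :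
    ContDiffOn ℝ ∞ (extDerivWithin φ.1 (simplex q)) (simplex q) := by
  have h := (Form.contDiffOn φ).fderivWithin (m := ∞) (uniqueDiffOn_simplex q) (by simp)
  exact (ContinuousAlternatingMap.alternatizeUncurryFinCLM ℝ (Fin q → ℝ) ℝ
    (n := k)).contDiff.comp_contDiffOn h

/-- The exterior derivative `d : A^k(Δ^q) → A^{k+1}(Δ^q)`. -/
def Form.d (q k : ℕ) : Form q k →ₗ[ℝ] Form q (k + 1) where
  toFun φ := Form.mk (extDerivWithin φ.1 (simplex q)) (Form.contDiffOn_extDeriv φ)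
  map_add' φ η := Form.ext' fun x hx => by
    have h1 := (Form.contDiffOn φ).differentiableOn (by simp) x hx
    have h2 := (Form.contDiffOn η).differentiableOn (by simp) x hx
    refine (Form.mk_apply _ (Form.contDiffOn_extDeriv (φ + η)) hx).trans ?_
    refine (extDerivWithin_add (uniqueDiffOn_simplex q x hx) h1 h2).trans ?_
    exact (congrArg₂ (· + ·) (Form.mk_apply _ (Form.contDiffOn_extDeriv φ) hx)
      (Form.mk_apply _ (Form.contDiffOn_extDeriv η) hx)).symm
  map_smul' c φ := Form.ext' fun x hx => by
    refine (Form.mk_apply _ (Form.contDiffOn_extDeriv (c • φ)) hx).trans ?_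
    refine (extDerivWithin_smul c _ (uniqueDiffOn_simplex q x hx)).trans ?_
    exact (congrArg (c • ·) (Form.mk_apply _ (Form.contDiffOn_extDeriv φ) hx)).symm

theorem Form.d_apply {q k : ℕ} (φ : Form q k) {x : Fin q → ℝ} (hx : x ∈ simplex q) :
    (Form.d q k φ).1 x = extDerivWithin φ.1 (simplex q) x :=
  Form.mk_apply _ (Form.contDiffOn_extDeriv φ) hx

/-- The inclusion `ε^i : Δ^q → Δ^{q+1}` of the `i`-th face: in barycentric coordinates it inserts
a zero in the `i`-th place. -/
def faceMap (q : ℕ) (i : Fin (q + 2)) (x : Fin q → ℝ) : Fin (q + 1) → ℝ :=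
  Fin.tail (i.insertNth (α := fun _ => ℝ) 0 (Fin.cons (1 - ∑ j, x j) x : Fin (q + 1) → ℝ))

theorem faceMap_mem {q : ℕ} (i : Fin (q + 2)) {x : Fin q → ℝ} (hx : x ∈ simplex q) :
    faceMap q i x ∈ simplex (q + 1) := by
  set b : Fin (q + 2) → ℝ :=
    i.insertNth (α := fun _ => ℝ) 0 (Fin.cons (1 - ∑ j, x j) x : Fin (q + 1) → ℝ) with hb
  have hb0 : ∀ j, 0 ≤ b j := by
    intro j
    refine Fin.succAboveCases i ?_ (fun k => ?_) j
    · simp [hb]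
    · rw [hb, Fin.insertNth_apply_succAbove]
      refine Fin.cases ?_ (fun l => ?_) k
      · simpa using hx.2
      · simpa using hx.1 l
  have hb1 : ∑ j, b j = 1 := by
    rw [hb, Fin.sum_insertNth, Fin.sum_univ_succ]
    simp
  refine ⟨fun j => hb0 j.succ, ?_⟩
  rw [Fin.sum_univ_succ] at hb1
  change ∑ j : Fin (q + 1), b j.succ ≤ 1
  linarith [hb0 0]

theorem contDiff_faceMap (q : ℕ) (i : Fin (q + 2)) : ContDiff ℝ ∞ (faceMap q i) := by
  rw [contDiff_pi]
  intro j
  change ContDiff ℝ ∞ fun x : Fin q → ℝ =>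
    i.insertNth (α := fun _ => ℝ) 0 (Fin.cons (1 - ∑ j, x j) x : Fin (q + 1) → ℝ) j.succ
  refine Fin.succAboveCases i ?_ (fun k => ?_) j.succ
  · simp only [Fin.insertNth_apply_same]; exact contDiff_const
  · simp only [Fin.insertNth_apply_succAbove]
    refine Fin.cases ?_ (fun l => ?_) k
    · simp only [Fin.cons_zero]; fun_prop
    · simp only [Fin.cons_succ]; fun_prop

/-- The linear part of the affine map `ε^i`. -/
def faceLin (q : ℕ) (i : Fin (q + 2)) : (Fin q → ℝ) →L[ℝ] (Fin (q + 1) → ℝ) :=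
  LinearMap.toContinuousLinearMap
    { toFun := fun x =>
        Fin.tail (i.insertNth (α := fun _ => ℝ) 0 (Fin.cons (-∑ j, x j) x : Fin (q + 1) → ℝ))
      map_add' := fun x y => by
        funext j
        simp only [Fin.tail, Pi.add_apply]
        refine Fin.succAboveCases i ?_ (fun k => ?_) j.succ
        · simp
        · simp only [Fin.insertNth_apply_succAbove]
          refine Fin.cases ?_ (fun l => ?_) k
          · simp [Finset.sum_add_distrib]; ring
          · simp
      map_smul' := fun c x => by
        funext j
        simp only [Fin.tail, Pi.smul_apply]
        refine Fin.succAboveCases i ?_ (fun k => ?_) j.succ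
        · simp
        · simp only [Fin.insertNth_apply_succAbove]
          refine Fin.cases ?_ (fun l => ?_) k
          · simp [Finset.mul_sum]
          · simp }

theorem hasFDerivAt_faceMap (q : ℕ) (i : Fin (q + 2)) (x : Fin q → ℝ) :
    HasFDerivAt (faceMap q i) (faceLin q i) x := by
  have h : faceMap q i = fun x => faceLin q i x + faceMap q i 0 := by
    funext x j
    change i.insertNth (α := fun _ => ℝ) 0 (Fin.cons (1 - ∑ j, x j) x : Fin (q + 1) → ℝ) j.succ
      = i.insertNth (α := fun _ => ℝ) 0 (Fin.cons (-∑ j, x j) x : Fin (q + 1) → ℝ) j.succ +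
        i.insertNth (α := fun _ => ℝ) 0
          (Fin.cons (1 - ∑ j : Fin q, (0 : Fin q → ℝ) j) 0 : Fin (q + 1) → ℝ) j.succ
    refine Fin.succAboveCases i ?_ (fun k => ?_) j.succ
    · simp
    · simp only [Fin.insertNth_apply_succAbove]
      refine Fin.cases ?_ (fun l => ?_) k
      · simp; ring
      · simp
  rw [h]
  exact (faceLin q i).hasFDerivAt.add_const _

theorem Form.contDiffOn_pull {q k : ℕ} (i : Fin (q + 2)) (φ : Form (q + 1) k) :
    ContDiffOn ℝ ∞ (fun x => (φ.1 (faceMap q i x)).compContinuousLinearMap (faceLin q i))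
      (simplex q) := by
  have h := (Form.contDiffOn φ).comp (contDiff_faceMap q i).contDiffOn fun _ hx => faceMap_mem i hx
  exact (ContinuousAlternatingMap.compContinuousLinearMapCLM (𝕜 := ℝ) (F := ℝ) (ι := Fin k)
    (faceLin q i)).contDiff.comp_contDiffOn h

/-- The restriction `(ε^i)^* : A^k(Δ^{q+1}) → A^k(Δ^q)` of forms to the `i`-th face. -/
def Form.pull (q k : ℕ) (i : Fin (q + 2)) : Form (q + 1) k →ₗ[ℝ] Form q k where
  toFun φ := Form.mk (fun x => (φ.1 (faceMap q i x)).compContinuousLinearMap (faceLin q i))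
    (Form.contDiffOn_pull i φ)
  map_add' φ η := Form.ext' fun _ hx =>
    (Form.mk_apply _ (Form.contDiffOn_pull i (φ + η)) hx).trans
      (congrArg₂ (· + ·) (Form.mk_apply _ (Form.contDiffOn_pull i φ) hx)
        (Form.mk_apply _ (Form.contDiffOn_pull i η) hx)).symm
  map_smul' c φ := Form.ext' fun _ hx =>
    (Form.mk_apply _ (Form.contDiffOn_pull i (c • φ)) hx).trans
      (congrArg (c • ·) (Form.mk_apply _ (Form.contDiffOn_pull i φ) hx)).symm

theorem Form.pull_apply {q k : ℕ} (i : Fin (q + 2)) (φ : Form (q + 1) k) {x : Fin q → ℝ}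
    (hx : x ∈ simplex q) : (Form.pull q k i φ).1 x =
      (φ.1 (faceMap q i x)).compContinuousLinearMap (faceLin q i) :=
  Form.mk_apply _ (Form.contDiffOn_pull i φ) hx

/-- The constant function `1`, as an element of `A^0(Δ^q)`. -/
def Form.one (q : ℕ) : Form q 0 :=
  Form.mk (fun _ => ContinuousAlternatingMap.constOfIsEmpty ℝ (Fin q → ℝ) (Fin 0) 1)
    contDiffOn_const

theorem Form.one_apply {q : ℕ} {x : Fin q → ℝ} (hx : x ∈ simplex q) :
    (Form.one q).1 x = ContinuousAlternatingMap.constOfIsEmpty ℝ (Fin q → ℝ) (Fin 0) 1 :=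
  Form.mk_apply _ _ hx

theorem Form.d_one (q : ℕ) : Form.d q 0 (Form.one q) = 0 := Form.ext' fun x hx => by
  rw [Form.d_apply _ hx, extDerivWithin_congr' (fun y hy => Form.one_apply hy) hx]
  ext v
  simp [extDerivWithin, ContinuousAlternatingMap.alternatizeUncurryFin_apply]

theorem Form.pull_one (q : ℕ) (i : Fin (q + 2)) :
    Form.pull q 0 i (Form.one (q + 1)) = Form.one q := Form.ext' fun x hx => by
  rw [Form.pull_apply _ _ hx, Form.one_apply hx, Form.one_apply (faceMap_mem i hx)]
  rfl

/-- The exterior product of alternating forms on `ℝ^q`: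
`(a ∧ b)(v₁, …, v_{k+l}) = ∑ sign(s) a(v_{s(1)}, …, v_{s(k)}) b(v_{s(k+1)}, …, v_{s(k+l)})`, the sum
being over the `(k, l)`-shuffles `s`. -/
def wedgeAlg (q k l : ℕ) (a : Alt q k) (b : Alt q l) :
    (Fin q → ℝ) [⋀^Fin (k + l)]→ₗ[ℝ] ℝ :=
  ((LinearMap.mul' ℝ ℝ).compAlternatingMap
    (a.toAlternatingMap.domCoprod b.toAlternatingMap)).domDomCongr finSumFinEquiv

theorem continuous_alternating {q n : ℕ} (f : (Fin q → ℝ) [⋀^Fin n]→ₗ[ℝ] ℝ) : Continuous f := by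
  have h : ∀ v, f v = ∑ r : Fin n → Fin q,
      (∏ i, v i (r i)) * f (fun i => Pi.single (r i) (1 : ℝ)) := by
    intro v
    have hv : v = fun i => ∑ j, v i j • (Pi.single j (1 : ℝ) : Fin q → ℝ) := by
      funext i
      exact pi_eq_sum_univ' (v i)
    conv_lhs => rw [hv]
    change f.toMultilinearMap _ = _
    rw [MultilinearMap.map_sum]
    refine Finset.sum_congr rfl fun r _ => ?_
    rw [MultilinearMap.map_smul_univ]
    rfl
  rw [show (f : (Fin n → Fin q → ℝ) → ℝ) = _ from funext h]
  fun_prop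

/-- The exterior product `Λ^k × Λ^l → Λ^{k+l}` as a bilinear map. -/
def wedge (q k l : ℕ) : Alt q k →ₗ[ℝ] Alt q l →ₗ[ℝ] Alt q (k + l) :=
  LinearMap.mk₂ ℝ
    (fun a b => { wedgeAlg q k l a b with cont := continuous_alternating (wedgeAlg q k l a b) })
    (fun a a' b => by
      ext v
      have h : wedgeAlg q k l (a + a') b = wedgeAlg q k l a b + wedgeAlg q k l a' b := by
        simp only [wedgeAlg, ← AlternatingMap.domCoprod'_apply,
          ContinuousAlternatingMap.toAlternatingMap_add, TensorProduct.add_tmul, map_add]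
        ext v; simp
      exact congrArg (fun f => f v) h)
    (fun c a b => by
      ext v
      have h : wedgeAlg q k l (c • a) b = c • wedgeAlg q k l a b := by
        simp only [wedgeAlg, ← AlternatingMap.domCoprod'_apply,
          ContinuousAlternatingMap.toAlternatingMap_smul, ← TensorProduct.smul_tmul', map_smul]
        ext v; simp
      exact congrArg (fun f => f v) h)
    (fun a b b' => by
      ext v
      have h : wedgeAlg q k l a (b + b') = wedgeAlg q k l a b + wedgeAlg q k l a b' := by
        simp only [wedgeAlg, ← AlternatingMap.domCoprod'_apply,
          ContinuousAlternatingMap.toAlternatingMap_add, TensorProduct.tmul_add, map_add]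
        ext v; simp
      exact congrArg (fun f => f v) h)
    (fun c a b => by
      ext v
      have h : wedgeAlg q k l a (c • b) = c • wedgeAlg q k l a b := by
        simp only [wedgeAlg, ← AlternatingMap.domCoprod'_apply,
          ContinuousAlternatingMap.toAlternatingMap_smul, TensorProduct.tmul_smul, map_smul]
        ext v; simp
      exact congrArg (fun f => f v) h)

theorem Form.contDiffOn_wedge {q k l : ℕ} (φ : Form q k) (η : Form q l) :
    ContDiffOn ℝ ∞ (fun x => wedge q k l (φ.1 x) (η.1 x)) (simplex q) := by
  let B : Alt q k →L[ℝ] Alt q l →L[ℝ] Alt q (k + l) := LinearMap.toContinuousLinearMap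
    { toFun := fun a => LinearMap.toContinuousLinearMap (wedge q k l a)
      map_add' := fun a b => by ext; simp
      map_smul' := fun c a => by ext; simp }
  exact (B.contDiff.comp_contDiffOn (Form.contDiffOn φ)).clm_apply (Form.contDiffOn η)

/-- The exterior product `A^k(Δ^q) × A^l(Δ^q) → A^{k+l}(Δ^q)`. -/
def Form.wedge (q k l : ℕ) : Form q k →ₗ[ℝ] Form q l →ₗ[ℝ] Form q (k + l) :=
  LinearMap.mk₂ ℝ
    (fun φ η => Form.mk (fun x => TwistedTorsion.wedge q k l (φ.1 x) (η.1 x))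
      (Form.contDiffOn_wedge φ η))
    (fun φ φ' η => Form.ext' fun x hx => by
      refine (Form.mk_apply _ (Form.contDiffOn_wedge (φ + φ') η) hx).trans ?_
      refine Eq.trans ?_ (congrArg₂ (· + ·) (Form.mk_apply _ (Form.contDiffOn_wedge φ η) hx)
        (Form.mk_apply _ (Form.contDiffOn_wedge φ' η) hx)).symm
      exact LinearMap.map_add₂ _ _ _ _)
    (fun c φ η => Form.ext' fun x hx => by
      refine (Form.mk_apply _ (Form.contDiffOn_wedge (c • φ) η) hx).trans ?_
      refine Eq.trans ?_ (congrArg (c • ·) (Form.mk_apply _ (Form.contDiffOn_wedge φ η) hx)).symm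
      exact LinearMap.map_smul₂ _ _ _ _)
    (fun φ η η' => Form.ext' fun x hx => by
      refine (Form.mk_apply _ (Form.contDiffOn_wedge φ (η + η')) hx).trans ?_
      refine Eq.trans ?_ (congrArg₂ (· + ·) (Form.mk_apply _ (Form.contDiffOn_wedge φ η) hx)
        (Form.mk_apply _ (Form.contDiffOn_wedge φ η') hx)).symm
      exact LinearMap.map_add _ _ _)
    (fun c φ η => Form.ext' fun x hx => by
      refine (Form.mk_apply _ (Form.contDiffOn_wedge φ (c • η)) hx).trans ?_
      refine Eq.trans ?_ (congrArg (c • ·) (Form.mk_apply _ (Form.contDiffOn_wedge φ η) hx)).symm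
      exact LinearMap.map_smul _ _ _)

/-! ### Ordered simplicial complexes, edge paths, universal covering -/

/-- A simplicial complex with a partial order on its vertices which is total on each simplex (for
instance, a simplicial complex with totally ordered vertices). The order orients the simplexes and
numbers their faces. -/
structure OrderedComplex (V : Type*) [PartialOrder V] extends AbstractSimplicialComplex V where
  isChain : ∀ s ∈ faces, IsChain (· ≤ ·) (s : Set V)

variable {V : Type*} [PartialOrder V]

namespace OrderedComplex

variable (K : OrderedComplex V)

/-- `K_q`: the `q`-simplexes of `K`, each given by the increasing list of its `q + 1` vertices. -/
def Simplex (q : ℕ) : Type _ :=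
  {s : Fin (q + 1) ↪o V // Finset.univ.map s.toEmbedding ∈ K.faces}

variable {K}

/-- The face operator `ε_i : K_{q+1} → K_q` omits the `i`-th vertex. -/
def Simplex.face {q : ℕ} (i : Fin (q + 2)) (s : K.Simplex (q + 1)) : K.Simplex q :=
  ⟨(Fin.succAboveOrderEmb i).trans s.1, by
    refine (K.isRelLowerSet_faces s.2).2 (fun x hx => ?_) (by simp)
    simp only [Finset.mem_map, Finset.mem_univ, true_and] at hx ⊢
    obtain ⟨j, rfl⟩ := hx
    exact ⟨i.succAbove j, rfl⟩⟩

variable (K)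

/-- The dimension of a finite simplicial complex: the maximal dimension of its simplexes. -/
def dim : ℕ := sSup {q | Nonempty (K.Simplex q)}

/-- The vertices of `K`, as the objects of the quiver of edges of `K`: there is one edge from `v` to
`w` when `v` and `w` lie in a common simplex (in particular a constant edge from `v` to `v`). -/
def Pt (_ : OrderedComplex V) : Type _ := V

instance : Quiver K.Pt where
  Hom v w := PLift (∃ s ∈ K.faces, (v : V) ∈ s ∧ (w : V) ∈ s)

/-- The elementary homotopies of edge paths: the two edges `uv`, `vw` may be replaced by the edge
`uw` when `u, v, w` lie in a common simplex, and constant edges may be omitted. -/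
inductive EdgeRel : HomRel (Paths K.Pt)
  | triangle (u v w : K.Pt)
      (h : ∃ s ∈ K.faces, (u : V) ∈ s ∧ (v : V) ∈ s ∧ (w : V) ∈ s)
      (a : u ⟶ v) (b : v ⟶ w) (c : u ⟶ w) :
      EdgeRel ((Paths.of K.Pt).map a ≫ (Paths.of K.Pt).map b) ((Paths.of K.Pt).map c)
  | const (v : K.Pt) (a : v ⟶ v) : EdgeRel ((Paths.of K.Pt).map a) (𝟙 ((Paths.of K.Pt).obj v))

/-- The edge path groupoid of `K`: objects are the vertices, morphisms are the homotopy classes of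
edge paths. -/
abbrev EdgePaths : Type _ := Quotient K.EdgeRel

/-- A vertex as an object of the edge path groupoid. -/
def obj (v : V) : K.EdgePaths := (Quotient.functor K.EdgeRel).obj
  ((Paths.of K.Pt).obj v)

/-- The class of an edge. -/
def edge {v w : V} (h : ∃ s ∈ K.faces, v ∈ s ∧ w ∈ s) : K.obj v ⟶ K.obj w :=
  (Quotient.functor K.EdgeRel).map ((Paths.of K.Pt).map (X := v) (Y := w) ⟨h⟩)

theorem edge_self (v : V) (h : ∃ s ∈ K.faces, v ∈ s ∧ v ∈ s) : K.edge h = 𝟙 (K.obj v) :=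
  (CategoryTheory.Quotient.sound _ (EdgeRel.const (K := K) v ⟨h⟩)).trans
    ((Quotient.functor K.EdgeRel).map_id _)

/-- The complex `K` is connected: any two vertices are joined by an edge path. -/
def IsConnected : Prop := ∀ v w : V, Nonempty (K.obj v ⟶ K.obj w)

/-- The fundamental group `π₁(K, v₀)`: homotopy classes of edge loops at `v₀`. (As in Mathlib, the
product `g * h` in an automorphism group is `h` followed by `g` as a composition of morphisms.) -/
abbrev π₁ (v₀ : V) : Type _ := Aut (K.obj v₀)

variable (v₀ : V)

/-- A vertex of the universal covering `K̃`: a vertex `pt` of `K` with a homotopy class of edge paths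
from the base point to `pt`. -/
@[ext]
structure CoverVertex where
  /-- The image in `K`. -/
  pt : V
  /-- The class of edge paths. -/
  path : K.obj v₀ ⟶ K.obj pt

/-- The vertices of `K̃` are ordered so that the projection is strictly increasing. -/
instance : PartialOrder (K.CoverVertex v₀) where
  le x y := x = y ∨ x.pt < y.pt
  le_refl _ := Or.inl rfl
  le_trans x y z := by
    rintro (rfl | h) (rfl | h')
    · exact Or.inl rfl
    · exact Or.inr h'
    · exact Or.inr h
    · exact Or.inr (h.trans h')
  le_antisymm x y := by
    rintro (rfl | h) (h' | h')
    · rfl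
    · rfl
    · exact h'.symm
    · exact absurd (h.trans h') (lt_irrefl _)

variable {K v₀}

theorem CoverVertex.le_def {x y : K.CoverVertex v₀} : x ≤ y ↔ x = y ∨ x.pt < y.pt := Iff.rfl

theorem CoverVertex.lt_iff {x y : K.CoverVertex v₀} : x < y ↔ x.pt < y.pt := by
  rw [lt_iff_le_and_ne, CoverVertex.le_def]
  constructor
  · rintro ⟨h | h, h'⟩
    · exact absurd h h'
    · exact h
  · exact fun h => ⟨Or.inr h, fun h' => absurd h (h' ▸ lt_irrefl _)⟩

variable (K v₀)

/-- The universal covering `K̃` of a connected complex `K`. A finite non-empty set of vertices of `K̃`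
is a simplex if it projects into a simplex of `K` and, for `x` and `y` in the set, the path class of
`y` is that of `x` followed by the edge from `x` to `y`. -/
def cover : OrderedComplex (K.CoverVertex v₀) where
  faces := {s | s.Nonempty ∧ (∃ t ∈ K.faces, ∀ x ∈ s, x.pt ∈ t) ∧
    ∀ x ∈ s, ∀ y ∈ s, ∃ h : ∃ t ∈ K.faces, x.pt ∈ t ∧ y.pt ∈ t, x.path ≫ K.edge h = y.path}
  isRelLowerSet_faces := by
    rintro s ⟨hs, ⟨t, ht, hst⟩, he⟩
    refine ⟨hs, fun s' hs' hn => ⟨hn, ⟨t, ht, fun x hx => hst x (hs' hx)⟩, ?_⟩⟩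
    exact fun x hx y hy => he x (hs' hx) y (hs' hy)
  singleton_mem v := by
    refine ⟨Finset.singleton_nonempty v, ⟨{v.pt}, K.singleton_mem _, ?_⟩, ?_⟩
    · simp
    · intro x hx y hy
      rw [Finset.mem_singleton] at hx hy
      subst hx
      subst hy
      refine ⟨⟨{y.pt}, K.singleton_mem _, by simp, by simp⟩, ?_⟩
      rw [edge_self, Category.comp_id]
  isChain := by
    rintro s ⟨-, ⟨t, ht, hst⟩, he⟩ x hx y hy hxy
    have hpt : x.pt ≠ y.pt := by
      intro h
      obtain ⟨hh, hp⟩ := he x hx y hy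
      apply hxy
      obtain ⟨p, a⟩ := x
      obtain ⟨p', b⟩ := y
      obtain rfl : p = p' := h
      rw [edge_self, Category.comp_id] at hp
      exact congrArg _ hp
    rcases K.isChain t ht (hst x hx) (hst y hy) hpt with h | h
    · exact Or.inl (Or.inr (lt_of_le_of_ne h hpt))
    · exact Or.inr (Or.inr (lt_of_le_of_ne h hpt.symm))

variable {K v₀}

/-- The projection `π : K̃ → K` on simplexes. -/
def Simplex.proj {q : ℕ} (s : (K.cover v₀).Simplex q) : K.Simplex q :=
  ⟨OrderEmbedding.ofStrictMono (fun i => (s.1 i).pt)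
      (fun _ _ h => CoverVertex.lt_iff.1 (s.1.strictMono h)), by
    obtain ⟨-, ⟨t, ht, hst⟩, -⟩ := s.2
    refine (K.isRelLowerSet_faces ht).2 (fun x hx => ?_) (by simp)
    simp only [Finset.mem_map, Finset.mem_univ, true_and] at hx
    obtain ⟨i, rfl⟩ := hx
    exact hst (s.1 i) (by simp)⟩

theorem Simplex.proj_face {q : ℕ} (i : Fin (q + 2)) (s : (K.cover v₀).Simplex (q + 1)) :
    (s.face i).proj = s.proj.face i := rfl

/-- The covering transformation of `K̃` given by `g ∈ π₁(K, v₀)`, on vertices. The left action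
`g • x = x · g⁻¹` corresponds to the right action `x · g` which composes the loop `g` with the
path `x`. -/
def CoverVertex.deck (g : K.π₁ v₀) (x : K.CoverVertex v₀) : K.CoverVertex v₀ :=
  ⟨x.pt, g.inv ≫ x.path⟩

/-- The covering transformations on simplexes. -/
def Simplex.deck {q : ℕ} (g : K.π₁ v₀) (s : (K.cover v₀).Simplex q) : (K.cover v₀).Simplex q :=
  ⟨OrderEmbedding.ofStrictMono (fun i => (s.1 i).deck g)
      (fun i j h => CoverVertex.lt_iff.2 <| by
        have h' := CoverVertex.lt_iff.1 (s.1.strictMono h)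
        exact h'), by
    obtain ⟨-, ⟨t, ht, hst⟩, he⟩ := s.2
    refine ⟨by simp, ⟨t, ht, fun x hx => ?_⟩, fun x hx y hy => ?_⟩
    · simp only [Finset.mem_map, Finset.mem_univ, true_and] at hx
      obtain ⟨i, rfl⟩ := hx
      exact hst (s.1 i) (by simp)
    · simp only [Finset.mem_map, Finset.mem_univ, true_and] at hx hy
      obtain ⟨i, rfl⟩ := hx
      obtain ⟨j, rfl⟩ := hy
      obtain ⟨h, hp⟩ := he (s.1 i) (by simp) (s.1 j) (by simp)
      refine ⟨h, ?_⟩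
      change (g.inv ≫ (s.1 i).path) ≫ K.edge h = g.inv ≫ (s.1 j).path
      rw [Category.assoc, hp]⟩

variable (K)

/-! ### Piecewise smooth forms, simplicial chains, Dupont's currents -/

/-- `A^k(K)`: piecewise smooth forms on `K`, that is, families of forms `φ_σ ∈ A^k(Δ^q)` for
`σ ∈ K_q`, `q ≥ 0`, with `φ_{ε_i σ} = (ε^i)^* φ_σ`. -/
def PLForm (k : ℕ) : Submodule ℝ (∀ q, K.Simplex q → Form q k) where
  carrier := {φ | ∀ q (i : Fin (q + 2)) (s : K.Simplex (q + 1)),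
    φ q (s.face i) = Form.pull q k i (φ (q + 1) s)}
  add_mem' h h' q i s := by simp [h q i s, h' q i s]
  zero_mem' q i s := by simp
  smul_mem' c φ h q i s := by simp [h q i s]

variable {K}

/-- The pull-back `π^* : A^k(K) → A^k(K̃)`. -/
def PLForm.pullCover (k : ℕ) : K.PLForm k →ₗ[ℝ] (K.cover v₀).PLForm k where
  toFun φ := ⟨fun q s => φ.1 q s.proj, fun q i s => φ.2 q i s.proj⟩
  map_add' _ _ := rfl
  map_smul' _ _ := rfl

variable (K)

/-- The simplicial chains `C_•(K) = ⨁ C_q(K)` with real coefficients. -/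
abbrev Chain : Type _ := (Σ q, K.Simplex q) →₀ ℝ

/-- The boundary of a simplex, `∂ σ = ∑ (-1)^i ε_i σ`. -/
def Chain.boundaryGen : (Σ q, K.Simplex q) → K.Chain
  | ⟨0, _⟩ => 0
  | ⟨q + 1, s⟩ => ∑ i : Fin (q + 2), (-1 : ℝ) ^ (i : ℕ) • Finsupp.single ⟨q, s.face i⟩ 1

/-- The boundary operator of `C_•(K)`. -/
def Chain.boundary : K.Chain →ₗ[ℝ] K.Chain :=
  Finsupp.linearCombination ℝ (Chain.boundaryGen K)

/-- Dupont's complex of currents, `Du_•(K) = ⨁_{q, j} A^j(Δ^q) ⊗ C_q(K)`, as the direct sum of a copy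
of `A^j(Δ^q)` for all `j` and all `σ ∈ K_q`. The degree of the summand of `(σ, j)` is `q - j`; note
that `A^j(Δ^q) = 0` for `j > q`. -/
abbrev Du : Type _ := DirectSum ((Σ q, K.Simplex q) × ℕ) fun x => Form x.1.1 x.2

open scoped Classical in
/-- The map `φ ↦ φ ⊗ σ`, from `A^j(Δ^q)` to `Du_{q-j}(K)`, for `σ ∈ K_q`. -/
def Du.of {q : ℕ} (s : K.Simplex q) (j : ℕ) : Form q j →ₗ[ℝ] K.Du :=
  DirectSum.lof ℝ ((Σ q, K.Simplex q) × ℕ) (fun x => Form x.1.1 x.2) (⟨q, s⟩, j)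

open scoped Classical in
/-- The linear map on `Du_•(K)` with given restrictions `φ ⊗ σ ↦ f σ j φ`. -/
def Du.lift {N : Type*} [AddCommMonoid N] [Module ℝ N]
    (f : ∀ (x : Σ q, K.Simplex q) (j : ℕ), Form x.1 j →ₗ[ℝ] N) : K.Du →ₗ[ℝ] N :=
  DirectSum.toModule ℝ _ N fun x => f x.1 x.2

open scoped Classical in
theorem Du.lift_of {N : Type*} [AddCommMonoid N] [Module ℝ N]
    (f : ∀ (x : Σ q, K.Simplex q) (j : ℕ), Form x.1 j →ₗ[ℝ] N) {q : ℕ} (s : K.Simplex q) (j : ℕ)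
    (φ : Form q j) : Du.lift K f (Du.of K s j φ) = f ⟨q, s⟩ j φ :=
  DirectSum.toModule_lof _ _ _

open scoped Classical in
theorem Du.hom_ext {N : Type*} [AddCommMonoid N] [Module ℝ N] {f g : K.Du →ₗ[ℝ] N}
    (h : ∀ q (s : K.Simplex q) j (φ : Form q j), f (Du.of K s j φ) = g (Du.of K s j φ)) : f = g :=
  DirectSum.linearMap_ext _ fun x => LinearMap.ext fun φ => h x.1.1 x.1.2 x.2 φ

/-- The part `φ ⊗ σ ↦ ∑ (-1)^i (ε^i)^* φ ⊗ ε_i σ` of the differential of `Du_•(K)`. -/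
def Du.facePart : ∀ (x : Σ q, K.Simplex q) (j : ℕ), Form x.1 j →ₗ[ℝ] K.Du
  | ⟨0, _⟩, _ => 0
  | ⟨q + 1, s⟩, j =>
      ∑ i : Fin (q + 2), (-1 : ℝ) ^ (i : ℕ) • (Du.of K (s.face i) j ∘ₗ Form.pull q j i)

/-- The differential of `Du_•(K)`: for `φ ∈ A^j(Δ^q)` and `σ ∈ K_q`, with `n = q - j`,
`∂(φ ⊗ σ) = (-1)^n dφ ⊗ σ + ∑ (-1)^i (ε^i)^* φ ⊗ ε_i σ`. -/
def Du.boundary : K.Du →ₗ[ℝ] K.Du :=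
  Du.lift K fun x j =>
    (-1 : ℝ) ^ (x.1 + j) • (Du.of K x.2 (j + 1) ∘ₗ Form.d x.1 j) + Du.facePart K x j

/-- The chain map `ψ : C_•(K) → Du_•(K)`, `ψ(σ) = 1 ⊗ σ`. -/
def psi : K.Chain →ₗ[ℝ] K.Du :=
  Finsupp.linearCombination ℝ fun x => Du.of K x.2 0 (Form.one x.1)

/-- `ψ` is a chain map. -/
theorem psi_boundary (c : K.Chain) :
    K.psi (Chain.boundary K c) = Du.boundary K (K.psi c) := by
  have h : K.psi ∘ₗ Chain.boundary K = Du.boundary K ∘ₗ K.psi := by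
    refine Finsupp.lhom_ext' fun x => LinearMap.ext_ring ?_
    obtain ⟨q, s⟩ := x
    simp only [LinearMap.comp_apply, Finsupp.lsingle_apply, psi, Chain.boundary,
      Finsupp.linearCombination_single, one_smul, Du.boundary, Du.lift_of, LinearMap.add_apply,
      LinearMap.smul_apply, Form.d_one, map_zero, smul_zero, zero_add]
    cases q with
    | zero => simp [Chain.boundaryGen, Du.facePart]
    | succ q =>
      simp [Chain.boundaryGen, Du.facePart, LinearMap.sum_apply, map_sum,
        Finsupp.linearCombination_single, Form.pull_one]
  exact LinearMap.congr_fun h c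

/-- The product of a form `φ ∈ A^k(K)` with currents, `φ · (η ⊗ σ) = (φ_σ ∧ η) ⊗ σ`. -/
def Du.mul (k : ℕ) (φ : K.PLForm k) : K.Du →ₗ[ℝ] K.Du :=
  Du.lift K fun x j => Du.of K x.2 (k + j) ∘ₗ Form.wedge x.1 k j (φ.1 x.1 x.2)

/-- The operator `η ⊗ σ ↦ (-1)^{k n} φ · (η ⊗ σ)` on `Du_•(K)`, where `φ ∈ A^k(K)` and `n` is the degree
of `φ · (η ⊗ σ)`, that is `n = q - j - k` for `η ∈ A^j(Δ^q)`, `σ ∈ K_q`. It is linear in `φ`. -/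
def Du.signedMul (k : ℕ) : K.PLForm k →ₗ[ℝ] K.Du →ₗ[ℝ] K.Du where
  toFun φ := Du.lift K fun x j => (-1 : ℝ) ^ (k * (x.1 + j + k)) •
    (Du.mul K k φ ∘ₗ Du.of K x.2 j)
  map_add' φ φ' := Du.hom_ext K fun q s j η => by
    simp only [Du.lift_of, Du.mul, LinearMap.smul_apply, LinearMap.comp_apply, LinearMap.add_apply,
      Submodule.coe_add, Pi.add_apply, map_add, smul_add]
  map_smul' c φ := Du.hom_ext K fun q s j η => by
    simp only [Du.lift_of, Du.mul, LinearMap.smul_apply, LinearMap.comp_apply, RingHom.id_apply,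
      Submodule.coe_smul, Pi.smul_apply, map_smul]
    rw [smul_comm]

end OrderedComplex

/-! ### Cohomology and determinant lines -/

section Cohomology

variable {𝕜 ι M M' : Type*} [Field 𝕜] [AddGroupWithOne ι] [AddCommGroup M] [Module 𝕜 M]
  [AddCommGroup M'] [Module 𝕜 M']

/-- The degree `n` cocycles of a graded complex. The grading `G` is by `ι = ℤ`, or by `ι = ZMod 2` with
`0` for the even and `1` for the odd part; the differential `d` maps `G n` to `G (n + 1)`. -/
abbrev Cocycles (G : ι → Submodule 𝕜 M) (d : M →ₗ[𝕜] M) (n : ι) : Submodule 𝕜 M :=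
  G n ⊓ LinearMap.ker d

/-- The coboundaries `d (G (n - 1))`, in the space of cocycles. -/
abbrev Coboundaries (G : ι → Submodule 𝕜 M) (d : M →ₗ[𝕜] M) (n : ι) :
    Submodule 𝕜 (Cocycles G d n) :=
  ((G (n - 1)).map d).submoduleOf (Cocycles G d n)

/-- The cohomology in degree `n`. -/
abbrev Coh (G : ι → Submodule 𝕜 M) (d : M →ₗ[𝕜] M) (n : ι) : Type _ :=
  Cocycles G d n ⧸ Coboundaries G d n

/-- The cohomology class of a cocycle. -/
def Coh.mk (G : ι → Submodule 𝕜 M) (d : M →ₗ[𝕜] M) (n : ι) :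
    Cocycles G d n →ₗ[𝕜] Coh G d n :=
  (Coboundaries G d n).mkQ

/-- The map induced in cohomology by a map which preserves degrees and differentials. -/
def Coh.map {G : ι → Submodule 𝕜 M} {d : M →ₗ[𝕜] M} {G' : ι → Submodule 𝕜 M'} {d' : M' →ₗ[𝕜] M'}
    (f : M →ₗ[𝕜] M') (hG : ∀ n, ∀ x ∈ G n, f x ∈ G' n) (hd : ∀ x, f (d x) = d' (f x)) (n : ι) :
    Coh G d n →ₗ[𝕜] Coh G' d' n :=
  Submodule.mapQ _ _
    (f.restrict (p := Cocycles G d n) (q := Cocycles G' d' n) fun x hx =>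
      ⟨hG n x hx.1, LinearMap.mem_ker.2 <| by
        rw [← hd, LinearMap.mem_ker.1 hx.2, map_zero]⟩)
    (by
      rintro ⟨x, hx⟩ ⟨y, hy, hyx⟩
      exact ⟨f y, hG _ y hy, (hd y).symm.trans (congrArg f hyx)⟩)

variable (𝕜) (W : Type*) [AddCommGroup W] [Module 𝕜 W]

/-- The line `det W = ⋀^{dim W} W` of a finite dimensional vector space `W`. -/
abbrev Det : Type _ := ⋀[𝕜]^(Module.finrank 𝕜 W) W

variable {𝕜 W} {I : Type*} [LinearOrder I] [Fintype I]

/-- A basis indexed by a finite linearly ordered set, renumbered by `0, …, dim W - 1` in increasing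
order. -/
def finBasis (b : Module.Basis I 𝕜 W) : Module.Basis (Fin (Module.finrank 𝕜 W)) 𝕜 W :=
  b.reindex (Fintype.orderIsoFinOfCardEq I (Module.finrank_eq_card_basis b).symm).symm.toEquiv

/-- The generator `b₁ ∧ ⋯ ∧ b_n` of `det W` given by an (ordered) basis `b` of `W`. -/
def Det.vol (b : Module.Basis I 𝕜 W) : Det 𝕜 W :=
  exteriorPower.ιMulti 𝕜 (Module.finrank 𝕜 W) (finBasis b)

/-- The generator of `(det W)⁻¹ = Hom(det W, 𝕜)` which takes the value `1` on `b₁ ∧ ⋯ ∧ b_n`. -/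
def Det.dualVol (b : Module.Basis I 𝕜 W) : Module.Dual 𝕜 (Det 𝕜 W) :=
  exteriorPower.alternatingMapLinearEquiv (finBasis b).det

theorem Det.dualVol_vol (b : Module.Basis I 𝕜 W) : Det.dualVol b (Det.vol b) = 1 := by
  rw [Det.dualVol, Det.vol, exteriorPower.alternatingMapLinearEquiv_apply_ιMulti,
    Module.Basis.det_self]

/-- The determinant line `⨂_{0 ≤ i ≤ N} (det H i)^{(-1)^i}` of a graded vector space concentrated in
degrees `0, …, N`; the factors of even index are written first. Its degree as a graded line is
`∑ (-1)^i dim H i`. -/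
abbrev DetGraded (𝕜 : Type*) [Field 𝕜] (N : ℕ) (H : ℕ → Type*) [∀ i, AddCommGroup (H i)]
    [∀ i, Module 𝕜 (H i)] : Type _ :=
  (⨂[𝕜] i : {i : Fin (N + 1) // Even (i : ℕ)}, Det 𝕜 (H i.1)) ⊗[𝕜]
    (⨂[𝕜] i : {i : Fin (N + 1) // ¬ Even (i : ℕ)}, Module.Dual 𝕜 (Det 𝕜 (H i.1)))

/-- The determinant line `det H^{ev} ⊗ (det H^{od})⁻¹` of a `ℤ/2`-graded vector space. Its degree as a
graded line is `dim H^{ev} - dim H^{od}`. -/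
abbrev DetMod2 (𝕜 : Type*) [Field 𝕜] (H : ZMod 2 → Type*) [∀ i, AddCommGroup (H i)]
    [∀ i, Module 𝕜 (H i)] : Type _ :=
  Det 𝕜 (H 0) ⊗[𝕜] Module.Dual 𝕜 (Det 𝕜 (H 1))

end Cohomology

/-! ### Cochains with values in a representation of the fundamental group -/

namespace OrderedComplex

variable (K : OrderedComplex V) {v₀ : V}

/-- The action of a covering transformation on `C_•(K̃)`. -/
def Chain.deck (g : K.π₁ v₀) : (K.cover v₀).Chain →ₗ[ℝ] (K.cover v₀).Chain :=
  Finsupp.lmapDomain ℝ ℝ fun x => ⟨x.1, x.2.deck g⟩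

/-- The action of a covering transformation on `Du_•(K̃)`. -/
def Du.deck (g : K.π₁ v₀) : (K.cover v₀).Du →ₗ[ℝ] (K.cover v₀).Du :=
  Du.lift _ fun x j => Du.of _ (x.2.deck g) j

theorem psi_deck (g : K.π₁ v₀) (c : (K.cover v₀).Chain) :
    (K.cover v₀).psi (Chain.deck K g c) = Du.deck K g ((K.cover v₀).psi c) := by
  have h : (K.cover v₀).psi ∘ₗ Chain.deck K g = Du.deck K g ∘ₗ (K.cover v₀).psi := by
    refine Finsupp.lhom_ext' fun x => LinearMap.ext_ring ?_
    simp [psi, Chain.deck, Du.deck, Du.lift_of, Finsupp.mapDomain_single]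
  exact LinearMap.congr_fun h c

variable {𝕜 E : Type*} [RCLike 𝕜] [AddCommGroup E] [Module 𝕜 E] [Module ℝ E] [IsScalarTower ℝ 𝕜 E]
  (ρ : Representation 𝕜 (K.π₁ v₀) E)

/-- `C^n(K, E)`, the degree `n` part of `Hom_{ℝ[π₁(K)]}(C_•(K̃), E)`. With `ι = ZMod 2` this is the
even or odd part. -/
def cochains (ι : Type*) [AddGroupWithOne ι] (n : ι) :
    Submodule 𝕜 ((K.cover v₀).Chain →ₗ[ℝ] E) where
  carrier := {f | (∀ g c, f (Chain.deck K g c) = ρ g (f c)) ∧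
    ∀ q (s : (K.cover v₀).Simplex q), (q : ι) ≠ n → f (Finsupp.single ⟨q, s⟩ 1) = 0}
  add_mem' h h' := ⟨fun g c => by simp [h.1 g c, h'.1 g c],
    fun q s hq => by simp [h.2 q s hq, h'.2 q s hq]⟩
  zero_mem' := ⟨fun _ _ => by simp, fun _ _ _ => rfl⟩
  smul_mem' a f h := ⟨fun g c => by simp [h.1 g c], fun q s hq => by simp [h.2 q s hq]⟩

/-- `𝔪^n(K, E)`, the degree `n` part of `𝔪^•(K, E) = Hom_{ℝ[π₁(K)]}(Du_•(K̃), E)`. With `ι = ZMod 2` this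
is the even or odd part. -/
def currents (ι : Type*) [AddGroupWithOne ι] (n : ι) :
    Submodule 𝕜 ((K.cover v₀).Du →ₗ[ℝ] E) where
  carrier := {f | (∀ g c, f (Du.deck K g c) = ρ g (f c)) ∧
    ∀ q (s : (K.cover v₀).Simplex q) j (φ : Form q j), (q : ι) - (j : ι) ≠ n →
      f (Du.of _ s j φ) = 0}
  add_mem' h h' := ⟨fun g c => by simp [h.1 g c, h'.1 g c],
    fun q s j φ hq => by simp [h.2 q s j φ hq, h'.2 q s j φ hq]⟩
  zero_mem' := ⟨fun _ _ => by simp, fun _ _ _ _ _ => rfl⟩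
  smul_mem' a f h := ⟨fun g c => by simp [h.1 g c], fun q s j φ hq => by simp [h.2 q s j φ hq]⟩

/-- The filtration `F_p = ⨁_{n ≥ p} 𝔪^n(K, E)` of `𝔪^•(K, E)`. -/
def filtration (p : ℤ) : Submodule 𝕜 ((K.cover v₀).Du →ₗ[ℝ] E) where
  carrier := {f | (∀ g c, f (Du.deck K g c) = ρ g (f c)) ∧
    ∀ q (s : (K.cover v₀).Simplex q) j (φ : Form q j), (q : ℤ) - (j : ℤ) < p →
      f (Du.of _ s j φ) = 0}
  add_mem' h h' := ⟨fun g c => by simp [h.1 g c, h'.1 g c],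
    fun q s j φ hq => by simp [h.2 q s j φ hq, h'.2 q s j φ hq]⟩
  zero_mem' := ⟨fun _ _ => by simp, fun _ _ _ _ _ => rfl⟩
  smul_mem' a f h := ⟨fun g c => by simp [h.1 g c], fun q s j φ hq => by simp [h.2 q s j φ hq]⟩

variable (𝕜 E)

variable (v₀)

/-- The differential `f ↦ f ∘ ∂` of `C^•(K, E)`. -/
def dCochains : ((K.cover v₀).Chain →ₗ[ℝ] E) →ₗ[𝕜] ((K.cover v₀).Chain →ₗ[ℝ] E) :=
  LinearMap.lcomp 𝕜 E (Chain.boundary (K.cover v₀))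

/-- The differential `f ↦ f ∘ ∂` of `𝔪^•(K, E)`. -/
def dCurrents : ((K.cover v₀).Du →ₗ[ℝ] E) →ₗ[𝕜] ((K.cover v₀).Du →ₗ[ℝ] E) :=
  LinearMap.lcomp 𝕜 E (Du.boundary (K.cover v₀))

/-- The map `ψ^* : 𝔪^•(K, E) → C^•(K, E)`, `f ↦ f ∘ ψ`. -/
def psiStar : ((K.cover v₀).Du →ₗ[ℝ] E) →ₗ[𝕜] ((K.cover v₀).Chain →ₗ[ℝ] E) :=
  LinearMap.lcomp 𝕜 E (K.cover v₀).psi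

variable {v₀} in
theorem psiStar_mem (n : ℤ) (f : (K.cover v₀).Du →ₗ[ℝ] E) (hf : f ∈ K.currents ρ ℤ n) :
    K.psiStar v₀ 𝕜 E f ∈ K.cochains ρ ℤ n := by
  refine ⟨fun g c => ?_, fun q s hq => ?_⟩
  · change f (psi _ (Chain.deck K g c)) = ρ g (f (psi _ c))
    rw [psi_deck, hf.1]
  · change f (psi _ (Finsupp.single ⟨q, s⟩ 1)) = 0
    rw [psi, Finsupp.linearCombination_single, one_smul]
    exact hf.2 q s 0 _ (by simpa using hq)

/-- `ψ^*` is a map of complexes. -/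
theorem psiStar_d (f : (K.cover v₀).Du →ₗ[ℝ] E) :
    K.psiStar v₀ 𝕜 E (K.dCurrents v₀ 𝕜 E f) = K.dCochains v₀ 𝕜 E (K.psiStar v₀ 𝕜 E f) :=
  LinearMap.ext fun c => congrArg f (psi_boundary (K.cover v₀) c).symm

variable {v₀ 𝕜 E}

/-- The cohomology `H^n(K, E)` of `C^•(K, E)`. -/
abbrev H (n : ℤ) : Type _ := Coh (K.cochains ρ ℤ) (K.dCochains v₀ 𝕜 E) n

/-- The cohomology `H^n(𝔪^•(K, E), ∂)`. -/
abbrev HCurrents (n : ℤ) : Type _ := Coh (K.currents ρ ℤ) (K.dCurrents v₀ 𝕜 E) n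

/-- The map `H^n(𝔪^•(K, E), ∂) → H^n(K, E)` induced by `ψ^*`. -/
def HPsi (n : ℤ) : K.HCurrents ρ n →ₗ[𝕜] K.H ρ n :=
  Coh.map (K.psiStar v₀ 𝕜 E) (K.psiStar_mem 𝕜 E ρ) (K.psiStar_d v₀ 𝕜 E) n

/-! ### Twisted cohomology -/

/-- The space `⨁_{i ≥ 1} A^{2i+1}(K)` of forms with all components of odd degree at least `3`. -/
abbrev OddForm : Type _ := DirectSum ℕ fun i => K.PLForm (2 * i + 3)

/-- The condition `d t = 0`. -/
def IsClosed (t : K.OddForm) : Prop :=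
  ∀ i q (s : K.Simplex q), Form.d q (2 * i + 3) ((t i).1 q s) = 0

variable (v₀ 𝕜 E)

/-- The operator on `Du_•(K̃)` which induces the product by `t` on `𝔪^•(K, E)`: for `φ ∈ A^k(K)` and
`f ∈ 𝔪^n(K, E)`, `(φ · f)(x) = (-1)^{k n} f(φ · x)`. -/
def twist : K.OddForm →ₗ[ℝ] (K.cover v₀).Du →ₗ[ℝ] (K.cover v₀).Du :=
  DirectSum.toModule ℝ ℕ _ fun i =>
    Du.signedMul (K.cover v₀) (2 * i + 3) ∘ₗ PLForm.pullCover (2 * i + 3)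

/-- The twisted differential `∂_t = ∂ + t ·` of `𝔪^•(K, E)`. -/
def dTwisted (t : K.OddForm) :
    ((K.cover v₀).Du →ₗ[ℝ] E) →ₗ[𝕜] ((K.cover v₀).Du →ₗ[ℝ] E) :=
  K.dCurrents v₀ 𝕜 E + LinearMap.lcomp 𝕜 E (K.twist v₀ t)

variable {v₀ 𝕜 E}

/-- The twisted cohomology `H^{ev}(K, E, t)` (`e = 0`) and `H^{od}(K, E, t)` (`e = 1`). -/
abbrev HTwisted (t : K.OddForm) (e : ZMod 2) : Type _ :=
  Coh (K.currents ρ (ZMod 2)) (K.dTwisted v₀ 𝕜 E t) e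

/-- The determinant line `det H^•(K, E) = ⨂_i (det H^i(K, E))^{(-1)^i}`. -/
abbrev DetH : Type _ := DetGraded 𝕜 K.dim fun i => K.H ρ i

/-- The determinant line `det H^•(K, E, t) = det H^{ev}(K, E, t) ⊗ (det H^{od}(K, E, t))⁻¹`. -/
abbrev DetHTwisted (t : K.OddForm) : Type _ := DetMod2 𝕜 (K.HTwisted ρ t)

/-! ### The canonical isomorphism -/

/-- The element `x` of `F_p` has a leading term `z ∈ 𝔪^p(K, E)` with `∂ z = 0`, whose class in
`H^p(𝔪^•(K, E), ∂)`, that is in `E_2^{p, •}`, is mapped to `γ` by the isomorphism induced by `ψ^*`. -/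
def Represents (p : ℤ) (x : (K.cover v₀).Du →ₗ[ℝ] E) (γ : K.H ρ p) : Prop :=
  ∃ z : Cocycles (K.currents ρ ℤ) (K.dCurrents v₀ 𝕜 E) p,
    x - z.1 ∈ K.filtration ρ (p + 1) ∧ K.HPsi ρ p (Coh.mk _ _ p z) = γ

/-- A basis of the cohomology `E_2 = H^•(𝔪^•(K, E), ∂) = H^•(K, E)` which is adapted to all the pages
`(E_r, d_r)` of the spectral sequence of `(𝔪^•(K, E), ∂_t)`, filtered by the `F_p`, and to its limit
`H^•(K, E, t)`. It consists of

* pairs of classes, with representatives `x a` and `∂_t (x a)`, in the degrees `src a` and `tgt a`; so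
  `d_r [x a] = [∂_t (x a)]` in the page `E_r`, `r = tgt a - src a`, and the pair dies in `E_{r+1}`;
* classes with `∂_t`-closed representatives `h c`, in the degrees `deg c`; these survive to `E_∞`, and
  the classes of the `h c` are a basis of `H^•(K, E, t)`.

Pairs and surviving classes are listed in increasing order of degrees. In degree `i` the basis is
ordered so that the classes of the `∂_t (x a)` come first, then those of the `h c`, then those of the
`x a`. -/
structure SpectralBasis (t : K.OddForm) where
  /-- The number of pairs. -/
  pairs : ℕ
  /-- The number of surviving classes. -/
  survivors : ℕ
  /-- The degree of `x a`. -/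
  src : Fin pairs → Fin (K.dim + 1)
  /-- The degree of the leading term of `∂_t (x a)`. -/
  tgt : Fin pairs → Fin (K.dim + 1)
  /-- The degree of `h c`. -/
  deg : Fin survivors → Fin (K.dim + 1)
  mono_pairs : Monotone fun a => toLex (src a, tgt a)
  mono_survivors : Monotone deg
  /-- Representatives of the sources of the pairs. -/
  x : Fin pairs → ((K.cover v₀).Du →ₗ[ℝ] E)
  /-- Representatives of the surviving classes. -/
  h : Fin survivors → ((K.cover v₀).Du →ₗ[ℝ] E)
  x_mem : ∀ a, x a ∈ K.currents ρ (ZMod 2) (((src a : ℕ) : ZMod 2))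
  h_mem : ∀ c, h c ∈ K.currents ρ (ZMod 2) (((deg c : ℕ) : ZMod 2))
  h_closed : ∀ c, K.dTwisted v₀ 𝕜 E t (h c) = 0
  /-- The basis of `H^i(K, E)`. -/
  basis : ∀ i : Fin (K.dim + 1), Module.Basis
    ({a // tgt a = i} ⊕ₗ ({c // deg c = i} ⊕ₗ {a // src a = i})) 𝕜 (K.H ρ (i : ℕ))
  src_rep : ∀ a, K.Represents ρ (src a : ℕ) (x a)
    (basis (src a) (toLex (Sum.inr (toLex (Sum.inr ⟨a, rfl⟩)))))
  tgt_rep : ∀ a, K.Represents ρ (tgt a : ℕ) (K.dTwisted v₀ 𝕜 E t (x a))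
    (basis (tgt a) (toLex (Sum.inl ⟨a, rfl⟩)))
  h_rep : ∀ c, K.Represents ρ (deg c : ℕ) (h c)
    (basis (deg c) (toLex (Sum.inr (toLex (Sum.inl ⟨c, rfl⟩)))))
  /-- The basis of `H^{ev}(K, E, t)` and of `H^{od}(K, E, t)`. -/
  twistedBasis : ∀ e : ZMod 2,
    Module.Basis {c // (((deg c : Fin (K.dim + 1)) : ℕ) : ZMod 2) = e} 𝕜 (K.HTwisted ρ t e)
  twistedBasis_eq : ∀ e c, ∃ hc : h c.1 ∈ Cocycles (K.currents ρ (ZMod 2)) (K.dTwisted v₀ 𝕜 E t) e,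
    twistedBasis e c = Coh.mk _ _ e ⟨h c.1, hc⟩

variable {K ρ}

/-- The generator of `det H^•(K, E)` given by the basis of `H^•(K, E)`. -/
def SpectralBasis.vol {t : K.OddForm} (S : K.SpectralBasis ρ t) : K.DetH ρ :=
  (PiTensorProduct.tprod 𝕜 fun i => Det.vol (S.basis i.1)) ⊗ₜ[𝕜]
    (PiTensorProduct.tprod 𝕜 fun i => Det.dualVol (S.basis i.1))

/-- The generator of `det H^•(K, E, t)` given by the basis of `H^•(K, E, t)`. -/
def SpectralBasis.twistedVol {t : K.OddForm} (S : K.SpectralBasis ρ t) : K.DetHTwisted ρ t :=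
  Det.vol (S.twistedBasis 0) ⊗ₜ[𝕜] Det.dualVol (S.twistedBasis 1)

variable (K ρ)

/-- An isomorphism `det H^•(K, E) ≅ det H^•(K, E, t)` is the canonical one if it is the composite of
the identification `det H^•(K, E) = det H^•(𝔪^•(K, E), ∂) = det E_2` given by `ψ^*`, the isomorphisms
`det E_r = det H(E_r, d_r) = det E_{r+1}` for `r ≥ 2`, and the isomorphism
`det E_∞ = det H^•(K, E, t)` given by the filtration of `H^•(K, E, t)`. In terms of bases this means:
for all bases adapted to the spectral sequence, it takes the generator given by the basis of
`H^•(K, E)` to the generator given by the surviving classes. -/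
def IsCanonical (t : K.OddForm) (Φ : K.DetH ρ ≃ₗ[𝕜] K.DetHTwisted ρ t) : Prop :=
  ∀ S : K.SpectralBasis ρ t, Φ S.vol = S.twistedVol

end OrderedComplex

end

end TwistedTorsion

/-! Part (i). On one simplex the Poincaré lemma contracts the forms onto the constants, by coning
from the first vertex. Applied to every simplex, the operator `Du.cone` contracts the exterior
derivative part of the differential of currents onto the image of `ψ` (`Du.extBoundary_cone`).
Coning is not compatible with faces, so for the whole differential it is only a homotopy from the
identity to `Du.contr`, which is `ψ ∘ eval` minus an error term. The error lowers the dimension of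
simplexes, and `Du.contr` is the identity on the image of `ψ`; hence its power with exponent `dim K
+ 1` maps into that image and gives a chain retraction onto simplicial chains which inverts `ψ` up
to homotopy. The same formula is used on every simplex, so everything commutes with covering
transformations, and composing equivariant functionals with these operators gives `HPsi_bijective`.

Part (ii). The complex of currents is infinite dimensional, and the first step replaces it by a
finite dimensional one. Choose a contraction `k` of the untwisted complex with `dkd = d`, `kdk = k`,
`k² = 0`. The product `τ` with `t` raises degrees by at least `3`, so `τk` is nilpotent, and `k(1 +
τk)⁻¹` is a contraction `κ` adapted to the twisted differential `D = d + τ`. The operator `1 - Dκ -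
κD` is then a projection, commutes with `D`, is homotopic to the identity and preserves filtration
and parity. Its image, the perturbed harmonic space, computes twisted cohomology, and its graded
pieces are the spaces `H^i(K, E)` (`PerturbedComplex.harmonicComplex`).

What remains is linear algebra of a finite dimensional filtered space with an odd square-zero
operator. It has a basis adapted to the filtration made of pairs `x`, `Dx` and of closed survivors
(`FilteredComplex.exists_normalForm`); these normal forms correspond to spectral bases. The degrees
that occur are invariants, since they are counted by the dimensions of `F i` and of `D (F i) ⊓ F j`
(`NormalForm.degrees_eq`).

Compare two normal forms in one parity. The transition matrix is block triangular for the
filtration, with the base changes of the `H^i` as diagonal blocks. It is also block triangular for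
the order targets, survivors, sources, and `D` identifies the target block with the source block of
the opposite parity. In the quotient of the even by the odd determinant all source blocks cancel,
and the quotient of the survivor determinants is left (`NormalForm.prod_det_leadBasis`). So the
generators of the two determinant lines change by the same scalar. Sending one to the other is
therefore independent of the basis, and unique because both spaces are lines. The Euler
characteristics agree because the two members of a pair have opposite parity. -/

namespace TwistedTorsion

noncomputable section

open scoped ContDiff TensorProduct
open CategoryTheory

/-! ### Radial averages -/

section Radial

open MeasureTheory

variable {V G : Type} [NormedAddCommGroup V] [NormedSpace ℝ V] [NormedAddCommGroup G]
  [NormedSpace ℝ G] {s : Set V}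

/-- The weighted radial average `∫₀¹ t^k F(t x) dt`. -/
def radialMean (k : ℕ) (F : V → G) (x : V) : G := ∫ t in (0 : ℝ)..1, t ^ k • F (t • x)

theorem smul_mem_of_star (hs : Convex ℝ s) (h0 : (0 : V) ∈ s) {x : V} (hx : x ∈ s) {t : ℝ}
    (ht : t ∈ Set.Icc (0 : ℝ) 1) : t • x ∈ s :=
  hs.smul_mem_of_zero_mem h0 hx ht

theorem continuousOn_radial (hs : Convex ℝ s) (h0 : (0 : V) ∈ s) {F : V → G}
    (hF : ContinuousOn F s) {x : V} (hx : x ∈ s) (k : ℕ) :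
    ContinuousOn (fun t : ℝ => t ^ k • F (t • x)) (Set.Icc 0 1) := by
  refine ContinuousOn.smul (by fun_prop) ?_
  exact hF.comp (by fun_prop) fun t ht => smul_mem_of_star hs h0 hx ht

theorem intervalIntegrable_radial (hs : Convex ℝ s) (h0 : (0 : V) ∈ s) {F : V → G}
    (hF : ContinuousOn F s) {x : V} (hx : x ∈ s) (k : ℕ) :
    IntervalIntegrable (fun t : ℝ => t ^ k • F (t • x)) volume 0 1 :=
  ContinuousOn.intervalIntegrable_of_Icc zero_le_one (continuousOn_radial hs h0 hF hx k)

/-- Differentiation under the integral sign, proved from uniform continuity of the derivative on the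
compact set `s` and the mean value inequality on the segment from `t • x` to `t • y`. It holds up to
the boundary of `s`; the chain rule supplies the factor `t` that raises the weight from `k` to `k +
1`. -/
theorem hasFDerivWithinAt_radialMean [CompleteSpace G] (hs : Convex ℝ s) (hc : IsCompact s)
    (h0 : (0 : V) ∈ s) {F : V → G} {F' : V → V →L[ℝ] G}
    (hF : ∀ x ∈ s, HasFDerivWithinAt F (F' x) s x) (hF' : ContinuousOn F' s) (k : ℕ) {x : V}
    (hx : x ∈ s) :
    HasFDerivWithinAt (radialMean k F) (radialMean (k + 1) F' x) s x := by
  have hFc : ContinuousOn F s := fun x hx => (hF x hx).continuousWithinAt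
  have huc : UniformContinuousOn F' s := hc.uniformContinuousOn_of_continuous hF'
  rw [hasFDerivWithinAt_iff_isLittleO, Asymptotics.isLittleO_iff]
  intro ε hε
  obtain ⟨δ, hδ, hδ'⟩ := Metric.uniformContinuousOn_iff.1 huc ε hε
  have : ∀ᶠ y in nhdsWithin x s, dist y x < δ :=
    Filter.Eventually.filter_mono nhdsWithin_le_nhds (Metric.ball_mem_nhds x hδ)
  filter_upwards [this, self_mem_nhdsWithin] with y hy hys
  have hint1 := intervalIntegrable_radial hs h0 hFc hys k
  have hint2 := intervalIntegrable_radial hs h0 hFc hx k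
  have hint3 := intervalIntegrable_radial hs h0 hF' hx (k + 1)
  have happ : radialMean (k + 1) F' x (y - x) =
      ∫ t in (0 : ℝ)..1, (t ^ (k + 1) • F' (t • x)) (y - x) := by
    rw [radialMean, ContinuousLinearMap.intervalIntegral_apply hint3]
  rw [happ, radialMean, radialMean, ← intervalIntegral.integral_sub hint1 hint2,
    ← intervalIntegral.integral_sub (hint1.sub hint2)]
  · have hb : ∀ t ∈ Set.uIoc (0 : ℝ) 1, ‖t ^ k • F (t • y) - t ^ k • F (t • x) -
        (t ^ (k + 1) • F' (t • x)) (y - x)‖ ≤ ε * ‖y - x‖ := by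
      intro t ht
      rw [Set.uIoc_of_le zero_le_one] at ht
      have ht' : t ∈ Set.Icc (0 : ℝ) 1 := ⟨ht.1.le, ht.2⟩
      have hmv : ‖F (t • y) - F (t • x) - F' (t • x) (t • y - t • x)‖ ≤ ε * ‖t • y - t • x‖ := by
        have hsub : segment ℝ (t • x) (t • y) ⊆ s :=
          hs.segment_subset (smul_mem_of_star hs h0 hx ht') (smul_mem_of_star hs h0 hys ht')
        refine Convex.norm_image_sub_le_of_norm_hasFDerivWithin_le'
          (f' := F') (s := segment ℝ (t • x) (t • y)) (fun z hz => (hF z (hsub hz)).mono hsub)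
          (fun z hz => ?_) (convex_segment _ _) (left_mem_segment _ _ _) (right_mem_segment _ _ _)
        have hz' : dist z (t • x) < δ := by
          -- Scaling by `t ≤ 1` shrinks distances, so one `δ` serves for all `t`.
          have h1 : dist z (t • x) ≤ dist (t • x) (t • y) := segment_subset_closedBall_left _ _ hz
          refine h1.trans_lt (lt_of_le_of_lt ?_ hy)
          rw [dist_comm, dist_eq_norm, dist_eq_norm, ← smul_sub, norm_smul, Real.norm_of_nonneg ht'.1]
          exact mul_le_of_le_one_left (norm_nonneg _) ht'.2
        have := hδ' z (hsub hz) (t • x) (smul_mem_of_star hs h0 hx ht') hz'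
        rw [dist_eq_norm] at this
        exact this.le
      have heq : t ^ k • F (t • y) - t ^ k • F (t • x) - (t ^ (k + 1) • F' (t • x)) (y - x) =
          t ^ k • (F (t • y) - F (t • x) - F' (t • x) (t • y - t • x)) := by
        rw [← smul_sub t y x, map_smul, smul_sub, smul_sub, smul_smul, pow_succ]
        rfl
      rw [heq, norm_smul, norm_pow, Real.norm_of_nonneg ht'.1]
      calc t ^ k * _ ≤ 1 * (ε * ‖t • y - t • x‖) :=
            mul_le_mul (pow_le_one₀ ht'.1 ht'.2) hmv (norm_nonneg _) zero_le_one
        _ ≤ ε * ‖y - x‖ := by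
            rw [one_mul, ← smul_sub, norm_smul, Real.norm_of_nonneg ht'.1]
            exact mul_le_mul_of_nonneg_left (mul_le_of_le_one_left (norm_nonneg _) ht'.2) hε.le
    simpa using intervalIntegral.norm_integral_le_of_norm_le_const hb
  · exact ⟨(ContinuousLinearMap.apply ℝ G (y - x)).integrable_comp hint3.1,
      (ContinuousLinearMap.apply ℝ G (y - x)).integrable_comp hint3.2⟩

theorem contDiffOn_radialMean [CompleteSpace G] (hs : Convex ℝ s) (hc : IsCompact s)
    (hu : UniqueDiffOn ℝ s) (h0 : (0 : V) ∈ s) (k : ℕ) {F : V → G} (hF : ContDiffOn ℝ ∞ F s) :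
    ContDiffOn ℝ ∞ (radialMean k F) s := by
  refine contDiffOn_infty.2 fun n => ?_
  -- The derivative of a radial mean is a radial mean of larger weight with values in another space,
  -- hence the generalization over `k` and `G`.
  induction n generalizing k G with
  | zero =>
    rw [CharP.cast_eq_zero, contDiffOn_zero]
    exact fun x hx => (hasFDerivWithinAt_radialMean hs hc h0
      (fun x hx => (hF.differentiableOn (by simp) x hx).hasFDerivWithinAt)
      (hF.continuousOn_fderivWithin hu (by simp)) k hx).continuousWithinAt
  | succ n ih =>
    have hd : ∀ x ∈ s, HasFDerivWithinAt (radialMean k F)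
        (radialMean (k + 1) (fderivWithin ℝ F s) x) s x := fun x hx =>
      hasFDerivWithinAt_radialMean hs hc h0
        (fun x hx => (hF.differentiableOn (by simp) x hx).hasFDerivWithinAt)
        (hF.continuousOn_fderivWithin hu (by simp)) k hx
    rw [Nat.cast_succ, contDiffOn_succ_iff_fderivWithin hu]
    refine ⟨fun x hx => (hd x hx).differentiableWithinAt, by simp, ?_⟩
    refine (ih (k + 1) (hF.fderivWithin hu (by simp))).congr fun x hx => ?_
    exact (hd x hx).fderivWithin (hu x hx)

end Radial

/-! ### Integration along rays and contraction with the radial vector field. -/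

section Radial

open MeasureTheory

variable {V G : Type} [NormedAddCommGroup V] [NormedSpace ℝ V] [NormedAddCommGroup G]
  [NormedSpace ℝ G] {s : Set V}

theorem hasDerivAt_radial (hs : Convex ℝ s) (h0 : (0 : V) ∈ s) {F : V → G}
    (hF : DifferentiableOn ℝ F s) {x : V} (hx : x ∈ s) {t : ℝ} (ht : t ∈ Set.Ioo (0 : ℝ) 1) :
    HasDerivAt (fun t : ℝ => F (t • x)) (fderivWithin ℝ F s (t • x) x) t := by
  have ht' : t ∈ Set.Icc (0 : ℝ) 1 := Set.Ioo_subset_Icc_self ht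
  have h1 := (hF _ (smul_mem_of_star hs h0 hx ht')).hasFDerivWithinAt
  have h2 : HasDerivWithinAt (fun t : ℝ => t • x) x (Set.Icc 0 1) t := by
    simpa using ((hasDerivAt_id t).smul_const x).hasDerivWithinAt
  exact (h1.comp_hasDerivWithinAt t h2 fun u hu => smul_mem_of_star hs h0 hx hu).hasDerivAt
    (Icc_mem_nhds ht.1 ht.2)

theorem radialMean_clm_comp [CompleteSpace G] {H : Type} [NormedAddCommGroup H] [NormedSpace ℝ H]
    [CompleteSpace H] (hs : Convex ℝ s) (h0 : (0 : V) ∈ s) {F : V → G} (hF : ContinuousOn F s)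
    (k : ℕ) (L : G →L[ℝ] H) {x : V} (hx : x ∈ s) :
    radialMean k (fun y => L (F y)) x = L (radialMean k F x) := by
  rw [radialMean, radialMean, ← L.intervalIntegral_comp_comm
    (intervalIntegrable_radial hs h0 hF hx k)]
  simp

theorem radialMean_congr (hs : Convex ℝ s) (h0 : (0 : V) ∈ s) {F F' : V → G}
    (h : ∀ y ∈ s, F y = F' y) (k : ℕ) {x : V} (hx : x ∈ s) :
    radialMean k F x = radialMean k F' x := by
  refine intervalIntegral.integral_congr fun t ht => ?_
  rw [Set.uIcc_of_le zero_le_one] at ht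
  simp only [h _ (smul_mem_of_star hs h0 hx ht)]

/-- The fundamental theorem of calculus for `t ↦ F (t • x)` on `[0, 1]`. -/
theorem radialMean_zero_fderivWithin [CompleteSpace G] (hs : Convex ℝ s) (hu : UniqueDiffOn ℝ s)
    (h0 : (0 : V) ∈ s) {F : V → G} (hF : ContDiffOn ℝ ∞ F s) {x : V} (hx : x ∈ s) :
    radialMean 0 (fderivWithin ℝ F s) x x = F x - F 0 := by
  have hint := intervalIntegrable_radial hs h0 (hF.continuousOn_fderivWithin hu (by simp)) hx 0
  rw [radialMean, ContinuousLinearMap.intervalIntegral_apply hint,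
    intervalIntegral.integral_eq_sub_of_hasDerivAt_of_le (f := fun t => F (t • x)) zero_le_one]
  · simp
  · simpa using continuousOn_radial hs h0 hF.continuousOn hx 0
  · intro t ht
    simpa using hasDerivAt_radial hs h0 (hF.differentiableOn (by simp)) hx ht
  · exact ⟨(ContinuousLinearMap.apply ℝ G x).integrable_comp hint.1,
      (ContinuousLinearMap.apply ℝ G x).integrable_comp hint.2⟩

/-- Integrate the derivative of `t ^ (k + 1) • F (t • x)` over `[0, 1]`; the boundary term at `0`
vanishes. For forms of degree `k + 1` this plays the role of integrating the Lie derivative along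
the radial field. -/
theorem radialMean_succ_fderivWithin [CompleteSpace G] (hs : Convex ℝ s) (hu : UniqueDiffOn ℝ s)
    (h0 : (0 : V) ∈ s) {F : V → G} (hF : ContDiffOn ℝ ∞ F s) (k : ℕ) {x : V} (hx : x ∈ s) :
    radialMean (k + 1) (fderivWithin ℝ F s) x x + (k + 1 : ℝ) • radialMean k F x = F x := by
  have hint := intervalIntegrable_radial hs h0 (hF.continuousOn_fderivWithin hu (by simp)) hx
    (k + 1)
  have hint' := intervalIntegrable_radial hs h0 hF.continuousOn hx k
  have hint2 : IntervalIntegrable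
      (fun t : ℝ => (t ^ (k + 1) • fderivWithin ℝ F s (t • x)) x) volume 0 1 :=
    ⟨(ContinuousLinearMap.apply ℝ G x).integrable_comp hint.1,
      (ContinuousLinearMap.apply ℝ G x).integrable_comp hint.2⟩
  have hint3 : IntervalIntegrable (fun t : ℝ => (k + 1 : ℝ) • t ^ k • F (t • x)) volume 0 1 :=
    hint'.smul (k + 1 : ℝ)
  rw [radialMean, ContinuousLinearMap.intervalIntegral_apply hint, radialMean,
    ← intervalIntegral.integral_smul, ← intervalIntegral.integral_add hint2 hint3,
    intervalIntegral.integral_eq_sub_of_hasDerivAt_of_le (f := fun t => t ^ (k + 1) • F (t • x))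
      zero_le_one]
  · simp
  · exact continuousOn_radial hs h0 hF.continuousOn hx (k + 1)
  · intro t ht
    have h1 := hasDerivAt_radial hs h0 (hF.differentiableOn (by simp)) hx ht
    have h2 : HasDerivAt (fun t : ℝ => t ^ (k + 1)) ((k + 1 : ℝ) * t ^ k) t := by
      simpa using hasDerivAt_pow (k + 1) t
    refine (h2.smul h1).congr_deriv ?_
    rw [smul_smul, smul_apply]
  · exact hint2.add hint3

theorem contDiffOn_clm_apply_self {H : Type} [NormedAddCommGroup H] [NormedSpace ℝ H]
    (L : G →ₗᵢ[ℝ] V →L[ℝ] H) {f : V → G} (hf : ContDiffOn ℝ ∞ f s) :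
    ContDiffOn ℝ ∞ (fun x => L (f x) x) s :=
  (L.contDiff.comp_contDiffOn hf).clm_apply contDiffOn_id

/-- Meant for the interior product `L`: the product rule for a form contracted with the radial
field, whose derivative is the identity. -/
theorem fderivWithin_clm_apply_self {H : Type} [NormedAddCommGroup H] [NormedSpace ℝ H]
    (L : G →ₗᵢ[ℝ] V →L[ℝ] H) {f : V → G} {f' : V →L[ℝ] G} {x : V}
    (hf : HasFDerivWithinAt f f' s x) (hu : UniqueDiffWithinAt ℝ s x) :
    fderivWithin ℝ (fun x => L (f x) x) s x =
      L (f x) + (L.toContinuousLinearMap.flip x).comp f' := by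
  have h : HasFDerivWithinAt (fun y => L (f y)) (L.toContinuousLinearMap.comp f') s x :=
    L.toContinuousLinearMap.hasFDerivAt.comp_hasFDerivWithinAt x hf
  refine (h.clm_apply (hasFDerivWithinAt_id x s)).fderivWithin hu |>.trans ?_
  ext v
  simp

end Radial

/-! ### The Poincaré lemma on the standard simplex -/

theorem zero_mem_simplex (q : ℕ) : (0 : Fin q → ℝ) ∈ simplex q := by simp [simplex]

theorem isCompact_simplex (q : ℕ) : IsCompact (simplex q) := by
  refine (isCompact_Icc (a := (0 : Fin q → ℝ)) (b := 1)).of_isClosed_subset ?_ ?_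
  · simp only [simplex, Set.ofPred_and, Set.ofPred_forall]
    exact (isClosed_iInter fun i => isClosed_le (by fun_prop) (by fun_prop)).inter
      (isClosed_le (by fun_prop) (by fun_prop))
  · refine fun x hx => ⟨hx.1, fun i => ?_⟩
    exact (Finset.single_le_sum (fun j _ => hx.1 j) (Finset.mem_univ i)).trans hx.2

/-- Interior product with the radial vector field, as a map `ω ↦ (x ↦ ω (x, ·))`. -/
abbrev curryLeftCLM (q k : ℕ) :=
  (ContinuousAlternatingMap.curryLeftLI (𝕜 := ℝ) (E := Fin q → ℝ) (F := ℝ)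
    (n := k)).toContinuousLinearMap

/-- Cartan's formula at a point, with the derivative `L` of a form as a free variable. Inserting `x`
in the alternation of `L` gives `L x` from the slot of `x`; each remaining term has an extra minus
sign and cancels a term of the second alternation. -/
theorem curryLeft_alternatizeUncurryFin_add {q k : ℕ}
    (L : (Fin q → ℝ) →L[ℝ] Alt q (k + 1)) (x : Fin q → ℝ) :
    (ContinuousAlternatingMap.alternatizeUncurryFin L).curryLeft x +
      ContinuousAlternatingMap.alternatizeUncurryFin (((curryLeftCLM q k).flip x).comp L) = L x := by
  ext v
  simp only [ContinuousAlternatingMap.add_apply, ContinuousAlternatingMap.curryLeft_apply_apply,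
    ContinuousAlternatingMap.alternatizeUncurryFin_apply]
  rw [Fin.sum_univ_succ, add_assoc, ← Finset.sum_add_distrib]
  simp only [Fin.val_zero, pow_zero, one_smul, Matrix.cons_val_zero]
  rw [Finset.sum_eq_zero, add_zero]
  · simp [Matrix.vecCons]
  · intro i _
    have : i.succ.removeNth (Matrix.vecCons x v) = Matrix.vecCons x (i.removeNth v) := by
      funext j
      refine Fin.cases ?_ (fun j => ?_) j <;> simp [Fin.removeNth]
    rw [this]
    simp [pow_succ]

theorem curryLeft_alternatizeUncurryFin_zero {q : ℕ}
    (L : (Fin q → ℝ) →L[ℝ] Alt q 0) (x : Fin q → ℝ) :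
    (ContinuousAlternatingMap.alternatizeUncurryFin L).curryLeft x = L x := by
  ext v
  simp [ContinuousAlternatingMap.alternatizeUncurryFin_apply, Matrix.vecCons]

theorem Form.contDiffOn_cone {q k : ℕ} (φ : Form q (k + 1)) :
    ContDiffOn ℝ ∞ (fun x => (radialMean k φ.1 x).curryLeft x) (simplex q) := by
  exact contDiffOn_clm_apply_self (ContinuousAlternatingMap.curryLeftLI (𝕜 := ℝ)
    (E := Fin q → ℝ) (F := ℝ) (n := k)) (contDiffOn_radialMean (convex_simplex q)
      (isCompact_simplex q) (uniqueDiffOn_simplex q) (zero_mem_simplex q) k (Form.contDiffOn φ))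

/-- The homotopy operator of the Poincaré lemma. -/
def Form.cone (q k : ℕ) : Form q (k + 1) →ₗ[ℝ] Form q k where
  toFun φ := Form.mk _ (Form.contDiffOn_cone φ)
  map_add' φ η := Form.ext' fun x hx => by
    refine (Form.mk_apply _ (Form.contDiffOn_cone (φ + η)) hx).trans ?_
    refine Eq.trans ?_ (congrArg₂ (· + ·) (Form.mk_apply _ (Form.contDiffOn_cone φ) hx)
      (Form.mk_apply _ (Form.contDiffOn_cone η) hx)).symm
    have h : radialMean k (φ + η).1 x = radialMean k φ.1 x + radialMean k η.1 x := by
      rw [radialMean, radialMean, radialMean, ← intervalIntegral.integral_add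
        (intervalIntegrable_radial (convex_simplex q) (zero_mem_simplex q)
          (Form.contDiffOn φ).continuousOn hx k)
        (intervalIntegrable_radial (convex_simplex q) (zero_mem_simplex q)
          (Form.contDiffOn η).continuousOn hx k)]
      simp
    rw [h]
    rfl
  map_smul' c φ := Form.ext' fun x hx => by
    refine (Form.mk_apply _ (Form.contDiffOn_cone (c • φ)) hx).trans ?_
    refine Eq.trans ?_ (congrArg (c • ·) (Form.mk_apply _ (Form.contDiffOn_cone φ) hx)).symm
    have h : radialMean k (c • φ).1 x = c • radialMean k φ.1 x := by
      rw [radialMean, radialMean, ← intervalIntegral.integral_smul]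
      simp [smul_comm c]
    rw [h]
    rfl

theorem Form.cone_apply {q k : ℕ} (φ : Form q (k + 1)) {x : Fin q → ℝ} (hx : x ∈ simplex q) :
    (Form.cone q k φ).1 x = (radialMean k φ.1 x).curryLeft x :=
  Form.mk_apply _ (Form.contDiffOn_cone φ) hx

theorem Form.cone_d_apply {q k : ℕ} (φ : Form q k) {x : Fin q → ℝ} (hx : x ∈ simplex q) :
    (Form.cone q k (Form.d q k φ)).1 x = (ContinuousAlternatingMap.alternatizeUncurryFin
      (radialMean k (fderivWithin ℝ φ.1 (simplex q)) x)).curryLeft x := by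
  rw [Form.cone_apply _ hx, radialMean_congr (convex_simplex q) (zero_mem_simplex q)
    (fun y hy => Form.d_apply φ hy) k hx]
  congr 1
  exact congrArg _ (radialMean_clm_comp (convex_simplex q) (zero_mem_simplex q)
    ((Form.contDiffOn φ).continuousOn_fderivWithin (uniqueDiffOn_simplex q) (by simp)) k
    (ContinuousAlternatingMap.alternatizeUncurryFinCLM ℝ (Fin q → ℝ) ℝ (n := k)) hx)

/-- In degree zero the homotopy misses the value at the origin, which in these coordinates is the
first vertex of the simplex. -/
theorem Form.cone_d_zero {q : ℕ} (φ : Form q 0) :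
    Form.cone q 0 (Form.d q 0 φ) = φ - (φ.1 0 ![]) • Form.one q := Form.ext' fun x hx => by
  rw [Form.cone_d_apply _ hx, curryLeft_alternatizeUncurryFin_zero,
    radialMean_zero_fderivWithin (convex_simplex q) (uniqueDiffOn_simplex q) (zero_mem_simplex q)
    (Form.contDiffOn φ) hx]
  change _ = φ.1 x - (φ.1 0 ![]) • (Form.one q).1 x
  rw [Form.one_apply hx]
  congr 1
  ext v
  simp [Subsingleton.elim v ![]]

/-- The terms with the derivative of the form add up, by Cartan's formula at a point, to the
weighted mean of the derivative evaluated on `x`; together with `k + 1` times the mean itself this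
is the form, by `radialMean_succ_fderivWithin`. -/
theorem Form.d_cone_add_cone_d {q k : ℕ} (φ : Form q (k + 1)) :
    Form.d q k (Form.cone q k φ) + Form.cone q (k + 1) (Form.d q (k + 1) φ) = φ :=
  Form.ext' fun x hx => by
    change (Form.d q k (Form.cone q k φ)).1 x +
      (Form.cone q (k + 1) (Form.d q (k + 1) φ)).1 x = φ.1 x
    rw [Form.cone_d_apply _ hx, Form.d_apply _ hx,
      extDerivWithin_congr' (fun y hy => Form.cone_apply φ hy) hx]
    have hJ := hasFDerivWithinAt_radialMean (convex_simplex q) (isCompact_simplex q)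
      (zero_mem_simplex q)
      (fun y hy => ((Form.contDiffOn φ).differentiableOn (by simp) y hy).hasFDerivWithinAt)
      ((Form.contDiffOn φ).continuousOn_fderivWithin (uniqueDiffOn_simplex q) (by simp)) k hx
    have hd := fderivWithin_clm_apply_self (ContinuousAlternatingMap.curryLeftLI (𝕜 := ℝ)
      (E := Fin q → ℝ) (F := ℝ) (n := k)) hJ (uniqueDiffOn_simplex q x hx)
    -- The multiple `k + 1` comes from differentiating the inserted vector `x`: alternating the
    -- curried form of degree `k + 1` multiplies it by `k + 1`.
    have hfd : extDerivWithin (fun y => (radialMean k φ.1 y).curryLeft y) (simplex q) x =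
        (k + 1) • radialMean k φ.1 x + ContinuousAlternatingMap.alternatizeUncurryFin
          (((curryLeftCLM q k).flip x).comp
            (radialMean (k + 1) (fderivWithin ℝ φ.1 (simplex q)) x)) := by
      refine (congrArg ContinuousAlternatingMap.alternatizeUncurryFin hd).trans ?_
      rw [ContinuousAlternatingMap.alternatizeUncurryFin_add,
        ← ContinuousAlternatingMap.alternatizeUncurryFin_curryLeft]
      rfl
    rw [hfd, add_assoc, add_comm (ContinuousAlternatingMap.alternatizeUncurryFin _),
      curryLeft_alternatizeUncurryFin_add]
    refine ((add_comm _ _).trans ?_).trans (radialMean_succ_fderivWithin (convex_simplex q) (uniqueDiffOn_simplex q)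
      (zero_mem_simplex q) (Form.contDiffOn φ) k hx)
    generalize radialMean k φ.1 x = J
    refine congrArg _ ((Nat.cast_smul_eq_nsmul ℝ (k + 1) J).symm.trans ?_)
    rw [Nat.cast_succ]

/-! ### Exterior derivative and restriction to faces -/

/-- This makes second derivatives within the simplex symmetric at boundary points too, as `d² = 0`
and the naturality of `d` require. -/
theorem simplex_subset_closure_interior (q : ℕ) : simplex q ⊆ closure (interior (simplex q)) := by
  rw [(convex_simplex q).closure_interior_eq_closure_of_nonempty_interior
    (nonempty_interior_simplex q)]
  exact subset_closure

theorem Form.d_d {q k : ℕ} (φ : Form q k) : Form.d q (k + 1) (Form.d q k φ) = 0 :=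
  Form.ext' fun x hx => by
    rw [Form.d_apply _ hx, extDerivWithin_congr' (fun y hy => Form.d_apply φ hy) hx]
    exact extDerivWithin_extDerivWithin_apply (Form.contDiffOn φ x hx)
      (by rw [minSmoothness_of_isRCLikeNormedField]; exact ENat.LEInfty.out) (uniqueDiffOn_simplex q)
      (simplex_subset_closure_interior q hx) hx

theorem Form.d_pull {q k : ℕ} (i : Fin (q + 2)) (φ : Form (q + 1) k) :
    Form.d q k (Form.pull q k i φ) = Form.pull q (k + 1) i (Form.d (q + 1) k φ) :=
  Form.ext' fun x hx => by
    have hf : ∀ y ∈ simplex q, fderivWithin ℝ (faceMap q i) (simplex q) y = faceLin q i :=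
      fun y hy => (hasFDerivAt_faceMap q i y).hasFDerivWithinAt.fderivWithin
        (uniqueDiffOn_simplex q y hy)
    rw [Form.d_apply _ hx, Form.pull_apply _ _ hx, Form.d_apply _ (faceMap_mem i hx),
      ← hf x hx, ← extDerivWithin_pullback (r := ∞) ((Form.contDiffOn φ).differentiableOn (by simp) _
        (faceMap_mem i hx)) (contDiff_faceMap q i).contDiffWithinAt
        (by rw [minSmoothness_of_isRCLikeNormedField]; exact ENat.LEInfty.out) (uniqueDiffOn_simplex q)
        (simplex_subset_closure_interior q hx) hx (fun y hy => faceMap_mem i hy)]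
    exact extDerivWithin_congr' (fun y hy => by rw [Form.pull_apply _ _ hy, hf y hy]) hx

/-! ### The exterior algebra of alternating forms -/

/-- The sum is the double alternation of an expression symmetric in its first two arguments, and
such an alternation vanishes. -/
theorem alternatizeUncurryFin_smulRight_add {V : Type*} [NormedAddCommGroup V] [NormedSpace ℝ V]
    {k : ℕ} (ξ η : V →L[ℝ] ℝ) (a : V [⋀^Fin k]→L[ℝ] ℝ) :
    ContinuousAlternatingMap.alternatizeUncurryFin
        (ξ.smulRight (ContinuousAlternatingMap.alternatizeUncurryFin (η.smulRight a))) +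
      ContinuousAlternatingMap.alternatizeUncurryFin
        (η.smulRight (ContinuousAlternatingMap.alternatizeUncurryFin (ξ.smulRight a))) = 0 := by
  let f : V →ₗ[ℝ] V →ₗ[ℝ] V [⋀^Fin k]→ₗ[ℝ] ℝ :=
    ξ.toLinearMap.smulRight (η.toLinearMap.smulRight a.toAlternatingMap) +
      η.toLinearMap.smulRight (ξ.toLinearMap.smulRight a.toAlternatingMap)
  have h := AlternatingMap.alternatizeUncurryFin_alternatizeUncurryFinLM_comp_of_symmetric
    (f := f) (fun x y => by
      ext v
      simp only [f, LinearMap.add_apply, LinearMap.smulRight_apply, LinearMap.smul_apply,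
        AlternatingMap.add_apply, AlternatingMap.smul_apply, smul_eq_mul]
      ring)
  ext v
  have hv := congrArg (fun g => g v) h
  simpa [f, AlternatingMap.alternatizeUncurryFin_apply,
    ContinuousAlternatingMap.alternatizeUncurryFin_apply, Finset.sum_add_distrib, mul_add]
    using hv

theorem fderivWithin_clm_apply_clm_apply {V G H I : Type*} [NormedAddCommGroup V] [NormedSpace ℝ V]
    [NormedAddCommGroup G] [NormedSpace ℝ G] [NormedAddCommGroup H] [NormedSpace ℝ H]
    [NormedAddCommGroup I] [NormedSpace ℝ I] (B : G →L[ℝ] H →L[ℝ] I) {s : Set V} {x : V}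
    {f : V → G} {g : V → H} (hf : DifferentiableWithinAt ℝ f s x)
    (hg : DifferentiableWithinAt ℝ g s x) (hu : UniqueDiffWithinAt ℝ s x) (v : V) :
    fderivWithin ℝ (fun y => B (f y) (g y)) s x v =
      B (fderivWithin ℝ f s x v) (g x) + B (f x) (fderivWithin ℝ g s x v) := by
  have h := (((B.hasFDerivAt.comp_hasFDerivWithinAt x hf.hasFDerivWithinAt).clm_apply
    hg.hasFDerivWithinAt).fderivWithin hu)
  refine (congrArg (fun L : V →L[ℝ] I => L v) h).trans ?_
  simp [add_comm]

/-- The form `v ↦ det (ξ_i (v_j))`. -/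
def detForm {q k : ℕ} (ξ : Fin k → (Fin q → ℝ) →L[ℝ] ℝ) : Alt q k :=
  { (Matrix.detRowAlternating (R := ℝ) (n := Fin k)).compLinearMap
      (LinearMap.pi fun i => (ξ i).toLinearMap) with
    cont := continuous_alternating _ }

theorem detForm_apply {q k : ℕ} (ξ : Fin k → (Fin q → ℝ) →L[ℝ] ℝ) (v : Fin k → Fin q → ℝ) :
    detForm ξ v = Matrix.det (Matrix.of fun j i => ξ i (v j)) := rfl

/-- The exterior product `ξ ∧ a` with a `1`-form `ξ`. -/
def wedgeOne {q : ℕ} (ξ : (Fin q → ℝ) →L[ℝ] ℝ) (k : ℕ) : Alt q k →ₗ[ℝ] Alt q (k + 1) where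
  toFun a := ContinuousAlternatingMap.alternatizeUncurryFin (ξ.smulRight a)
  map_add' a b := by
    rw [← ContinuousAlternatingMap.alternatizeUncurryFin_add]
    congr 1
    ext
    simp
  map_smul' c a := by
    rw [RingHom.id_apply, ← ContinuousAlternatingMap.alternatizeUncurryFin_smul]
    congr 1
    ext
    simp [mul_left_comm]

theorem wedgeOne_apply {q k : ℕ} (ξ : (Fin q → ℝ) →L[ℝ] ℝ) (a : Alt q k)
    (v : Fin (k + 1) → Fin q → ℝ) :
    wedgeOne ξ k a v = ∑ i : Fin (k + 1), (-1 : ℝ) ^ (i : ℕ) * (ξ (v i) * a (i.removeNth v)) := by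
  refine (ContinuousAlternatingMap.alternatizeUncurryFin_apply _ _).trans ?_
  simp [zsmul_eq_mul]

/-- Laplace expansion along the first column. -/
theorem detForm_cons {q k : ℕ} (ξ : (Fin q → ℝ) →L[ℝ] ℝ) (η : Fin k → (Fin q → ℝ) →L[ℝ] ℝ) :
    detForm (Fin.cons ξ η) = wedgeOne ξ k (detForm η) := by
  ext v
  rw [detForm_apply, wedgeOne_apply, Matrix.det_succ_column_zero]
  refine Finset.sum_congr rfl fun i _ => ?_
  rw [mul_assoc]
  rfl

/-- Both forms are alternatizations of products of `1`-forms, and the shuffle product of two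
alternatizations is the alternatization of the product. Through this lemma the algebra of `wedge`
reduces to lists of `1`-forms. -/
theorem wedge_detForm {q k l : ℕ} (ξ : Fin k → (Fin q → ℝ) →L[ℝ] ℝ)
    (η : Fin l → (Fin q → ℝ) →L[ℝ] ℝ) :
    wedge q k l (detForm ξ) (detForm η) = detForm (Fin.append ξ η) := by
  have halt : ∀ {n : ℕ} (ζ : Fin n → (Fin q → ℝ) →L[ℝ] ℝ), (detForm ζ).toAlternatingMap =
      MultilinearMap.alternatization ((MultilinearMap.mkPiAlgebra ℝ (Fin n) ℝ).compLinearMap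
        fun i => (ζ i).toLinearMap) := by
    intro n ζ
    ext v
    change Matrix.det (Matrix.of fun j i => ζ i (v j)) = _
    rw [Matrix.det_apply, MultilinearMap.alternatization_apply]
    rfl
  ext v
  change LinearMap.mul' ℝ ℝ (((detForm ξ).toAlternatingMap.domCoprod
    (detForm η).toAlternatingMap) (fun i => v (finSumFinEquiv i))) =
      (detForm (Fin.append ξ η)).toAlternatingMap v
  rw [halt, halt, halt, ← MultilinearMap.domCoprod_alternization,
    MultilinearMap.alternatization_apply, MultilinearMap.alternatization_apply, map_sum]
  refine Fintype.sum_equiv (Equiv.permCongr finSumFinEquiv) _ _ fun σ => ?_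
  rw [Equiv.Perm.sign_permCongr]
  simp only [Units.smul_def, map_zsmul]
  congr 1
  simp [MultilinearMap.domCoprod_apply, Fin.prod_univ_add]

/-- The direct sum of all `Λ^k (ℝ^q)^*`. -/
abbrev AltSum (q : ℕ) : Type := DirectSum ℕ fun k => Alt q k

instance (q : ℕ) : AddCommGroup (AltSum q) := Module.addCommMonoidToAddCommGroup ℝ

/-- The inclusion of `Λ^k` in the direct sum. -/
abbrev AltSum.of (q k : ℕ) : Alt q k →ₗ[ℝ] AltSum q := DirectSum.lof ℝ ℕ (fun k => Alt q k) k

/-- The operator `ξ ∧ ·`, for a `1`-form `ξ`. -/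
def AltSum.mulOne {q : ℕ} (ξ : (Fin q → ℝ) →L[ℝ] ℝ) : AltSum q →ₗ[ℝ] AltSum q :=
  DirectSum.toModule ℝ ℕ _ fun k => AltSum.of q (k + 1) ∘ₗ wedgeOne ξ k

/-- The operator `a ∧ ·`. -/
def AltSum.mul (q k : ℕ) : Alt q k →ₗ[ℝ] AltSum q →ₗ[ℝ] AltSum q where
  toFun a := DirectSum.toModule ℝ ℕ _ fun l => AltSum.of q (k + l) ∘ₗ wedge q k l a
  map_add' a b := by ext l : 1; ext c : 1; simp [DirectSum.toModule_lof]
  map_smul' r a := by ext l : 1; ext c : 1; simp [DirectSum.toModule_lof]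

theorem AltSum.mulOne_of {q k : ℕ} (ξ : (Fin q → ℝ) →L[ℝ] ℝ) (a : Alt q k) :
    AltSum.mulOne ξ (AltSum.of q k a) = AltSum.of q (k + 1) (wedgeOne ξ k a) :=
  DirectSum.toModule_lof _ _ _

theorem AltSum.mul_of {q k l : ℕ} (a : Alt q k) (b : Alt q l) :
    AltSum.mul q k a (AltSum.of q l b) = AltSum.of q (k + l) (wedge q k l a b) :=
  DirectSum.toModule_lof _ _ _

theorem AltSum.of_injective (q k : ℕ) : Function.Injective (AltSum.of q k) :=
  DirectSum.of_injective k

theorem AltSum.hom_ext {q : ℕ} {f g : AltSum q →ₗ[ℝ] AltSum q}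
    (h : ∀ k a, f (AltSum.of q k a) = g (AltSum.of q k a)) : f = g :=
  DirectSum.linearMap_ext _ fun k => LinearMap.ext fun a => h k a

/-- The coordinate `1`-form `dx_i`. -/
abbrev coordForm {q : ℕ} (i : Fin q) : (Fin q → ℝ) →L[ℝ] ℝ := ContinuousLinearMap.proj i

theorem clm_eq_sum_smulRight {q k : ℕ} (L : (Fin q → ℝ) →L[ℝ] Alt q k) :
    L = ∑ i, (coordForm i).smulRight (L (Pi.single i 1)) := by
  ext v w
  conv_lhs => rw [pi_eq_sum_univ' v]
  simp [ContinuousAlternatingMap.sum_apply, sum_apply]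

theorem alternatizeUncurryFin_eq_sum {q k : ℕ} (L : (Fin q → ℝ) →L[ℝ] Alt q k) :
    ContinuousAlternatingMap.alternatizeUncurryFin L =
      ∑ i, wedgeOne (coordForm i) k (L (Pi.single i 1)) := by
  conv_lhs => rw [clm_eq_sum_smulRight L]
  exact map_sum (ContinuousAlternatingMap.alternatizeUncurryFinCLM ℝ (Fin q → ℝ) ℝ (n := k)) _ _

/-- Wedging each `dx_i` with the contraction by the `i`-th basis vector and summing multiplies a
form of degree `k + 1` by `k + 1`. -/
theorem alt_eq_sum_wedgeOne {q k : ℕ} (a : Alt q (k + 1)) :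
    a = ∑ i, wedgeOne (coordForm i) k (((k : ℝ) + 1)⁻¹ • a.curryLeft (Pi.single i 1)) := by
  have h := ContinuousAlternatingMap.alternatizeUncurryFin_curryLeft a
  rw [alternatizeUncurryFin_eq_sum] at h
  simp only [map_smul]
  rw [← Finset.smul_sum, h, ← Nat.cast_smul_eq_nsmul ℝ, smul_smul]
  push_cast
  rw [inv_mul_cancel₀ (by positivity), one_smul]

theorem alt_zero_eq {q : ℕ} (a : Alt q 0) : a = (a ![]) • detForm ![] := by
  ext v
  simp [detForm_apply, Subsingleton.elim v ![]]

/-- Induction for alternating forms: they are sums of products of `1`-forms. -/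
theorem alt_induction {q : ℕ} {P : ∀ k, Submodule ℝ (Alt q k)} (h0 : detForm ![] ∈ P 0)
    (h1 : ∀ k ξ a, a ∈ P k → wedgeOne ξ k a ∈ P (k + 1)) (k : ℕ) (a : Alt q k) : a ∈ P k := by
  induction k with
  | zero => rw [alt_zero_eq a]; exact (P 0).smul_mem _ h0
  | succ k ih =>
    rw [alt_eq_sum_wedgeOne a]
    exact Submodule.sum_mem _ fun i _ => h1 k _ _ (ih _)

theorem mem_span_detForm {q k : ℕ} (a : Alt q k) :
    a ∈ Submodule.span ℝ (Set.range (detForm (q := q) (k := k))) := by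
  refine alt_induction (P := fun k => Submodule.span ℝ (Set.range (detForm (q := q) (k := k))))
    (Submodule.subset_span ⟨_, rfl⟩) (fun k ξ a ha => ?_) k a
  have h : Submodule.span ℝ (Set.range (detForm (q := q) (k := k))) ≤
      (Submodule.span ℝ (Set.range (detForm (q := q) (k := k + 1)))).comap (wedgeOne ξ k) := by
    rw [Submodule.span_le]
    rintro _ ⟨η, rfl⟩
    exact Submodule.subset_span ⟨Fin.cons ξ η, detForm_cons ξ η⟩
  exact h ha

theorem alt_hom_ext {q k : ℕ} {N : Type*} [AddCommMonoid N] [Module ℝ N] {f g : Alt q k →ₗ[ℝ] N}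
    (h : ∀ ξ, f (detForm ξ) = g (detForm ξ)) : f = g :=
  LinearMap.ext fun a => LinearMap.eqOn_span (s := Set.range detForm)
    (by rintro _ ⟨ξ, rfl⟩; exact h ξ) (mem_span_detForm a)

/-- Associativity and commutativity relate degrees which are equal but not definitionally so; in the
direct sum of all degrees the cast disappears. -/
theorem of_detForm_cast {q m n : ℕ} (h : m = n) (ξ : Fin n → (Fin q → ℝ) →L[ℝ] ℝ) :
    AltSum.of q m (detForm (ξ ∘ Fin.cast h)) = AltSum.of q n (detForm ξ) := by
  subst h
  rfl

/-- Associativity when the first factor is a `1`-form: for products of `1`-forms both sides are the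
determinant form of the same list. -/
theorem AltSum.mul_wedgeOne {q k : ℕ} (ξ : (Fin q → ℝ) →L[ℝ] ℝ) (a : Alt q k) :
    AltSum.mul q (k + 1) (wedgeOne ξ k a) = AltSum.mulOne ξ ∘ₗ AltSum.mul q k a := by
  have h : AltSum.mul q (k + 1) ∘ₗ wedgeOne ξ k =
      LinearMap.lcomp ℝ _ (LinearMap.id) ∘ₗ
        (LinearMap.llcomp ℝ _ _ _ (AltSum.mulOne ξ)) ∘ₗ AltSum.mul q k := by
    refine alt_hom_ext fun η => AltSum.hom_ext fun l b => ?_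
    have h' : AltSum.mul q (k + 1) (wedgeOne ξ k (detForm η)) ∘ₗ AltSum.of q l =
        AltSum.mulOne ξ ∘ₗ AltSum.mul q k (detForm η) ∘ₗ AltSum.of q l := by
      refine alt_hom_ext fun ζ => ?_
      simp only [LinearMap.comp_apply, AltSum.mul_of, ← detForm_cons, wedge_detForm,
        AltSum.mulOne_of]
      rw [← of_detForm_cast (by omega : k + 1 + l = k + l + 1)]
      congr 2
      exact Fin.append_cons _ _ _
    exact LinearMap.congr_fun h' b
  exact LinearMap.congr_fun h a

theorem AltSum.mul_detForm_nil {q : ℕ} :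
    AltSum.mul q 0 (detForm ![]) = LinearMap.id := by
  refine AltSum.hom_ext fun l b => ?_
  have h' : AltSum.mul q 0 (detForm ![]) ∘ₗ AltSum.of q l = AltSum.of q l := by
    refine alt_hom_ext fun ζ => ?_
    rw [LinearMap.comp_apply, AltSum.mul_of, wedge_detForm,
      ← of_detForm_cast (by omega : 0 + l = l)]
    congr 2
    exact Fin.elim0_append _
  exact LinearMap.congr_fun h' b

theorem AltSum.mulOne_mulOne {q : ℕ} (ξ η : (Fin q → ℝ) →L[ℝ] ℝ) (x : AltSum q) :
    AltSum.mulOne ξ (AltSum.mulOne η x) = -AltSum.mulOne η (AltSum.mulOne ξ x) := by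
  have h : AltSum.mulOne ξ ∘ₗ AltSum.mulOne η + AltSum.mulOne η ∘ₗ AltSum.mulOne ξ = 0 := by
    refine AltSum.hom_ext fun k a => ?_
    simp only [LinearMap.add_apply, LinearMap.comp_apply, AltSum.mulOne_of, LinearMap.zero_apply]
    rw [← map_add]
    exact (congrArg _ (alternatizeUncurryFin_smulRight_add ξ η a)).trans (map_zero _)
  exact eq_neg_of_add_eq_zero_left (LinearMap.congr_fun h x)

/-- Move `ξ` past the `1`-forms of which `a` is built, one sign for each of the `k` factors. -/
theorem AltSum.mulOne_mul {q k : ℕ} (ξ : (Fin q → ℝ) →L[ℝ] ℝ) (a : Alt q k) (x : AltSum q) :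
    AltSum.mulOne ξ (AltSum.mul q k a x) =
      (-1 : ℝ) ^ k • AltSum.mul q k a (AltSum.mulOne ξ x) := by
  have h := alt_induction (P := fun k => LinearMap.ker
    (LinearMap.llcomp ℝ _ _ _ (AltSum.mulOne ξ) ∘ₗ AltSum.mul q k -
      (-1 : ℝ) ^ k • LinearMap.lcomp ℝ _ (AltSum.mulOne ξ) ∘ₗ AltSum.mul q k)) ?_ ?_ k a
  · exact sub_eq_zero.1 (LinearMap.congr_fun h x)
  · refine LinearMap.mem_ker.2 (LinearMap.ext fun x => ?_)
    simp [AltSum.mul_detForm_nil]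
  · intro k η b hb
    refine LinearMap.mem_ker.2 (LinearMap.ext fun x => ?_)
    have hb' : AltSum.mulOne ξ (AltSum.mul q k b x) =
        (-1 : ℝ) ^ k • AltSum.mul q k b (AltSum.mulOne ξ x) :=
      sub_eq_zero.1 (LinearMap.congr_fun (LinearMap.mem_ker.1 hb) x)
    simp [AltSum.mul_wedgeOne, AltSum.mulOne_mulOne ξ, hb', pow_succ]

/-- Graded commutativity, for operators acting on an arbitrary `x`: by induction the `1`-forms of
`a` move past `b`, each with the sign given by `AltSum.mulOne_mul`. -/
theorem AltSum.mul_mul {q k l : ℕ} (a : Alt q k) (b : Alt q l) (x : AltSum q) :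
    AltSum.mul q k a (AltSum.mul q l b x) =
      (-1 : ℝ) ^ (k * l) • AltSum.mul q l b (AltSum.mul q k a x) := by
  have h := alt_induction (P := fun k => LinearMap.ker
    (LinearMap.lcomp ℝ _ (AltSum.mul q l b) ∘ₗ AltSum.mul q k -
      (-1 : ℝ) ^ (k * l) • LinearMap.llcomp ℝ _ _ _ (AltSum.mul q l b) ∘ₗ AltSum.mul q k))
      ?_ ?_ k a
  · exact sub_eq_zero.1 (LinearMap.congr_fun h x)
  · refine LinearMap.mem_ker.2 (LinearMap.ext fun x => ?_)
    simp [AltSum.mul_detForm_nil]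
  · intro k η a ha
    refine LinearMap.mem_ker.2 (LinearMap.ext fun x => ?_)
    have ha' : AltSum.mul q k a (AltSum.mul q l b x) =
        (-1 : ℝ) ^ (k * l) • AltSum.mul q l b (AltSum.mul q k a x) :=
      sub_eq_zero.1 (LinearMap.congr_fun (LinearMap.mem_ker.1 ha) x)
    simp [AltSum.mul_wedgeOne, ha', AltSum.mulOne_mul, smul_smul, add_mul, pow_add, mul_assoc]

/-- The Leibniz rule at a point, with `M`, `L`, `L'` in the role of the derivatives. Writing
alternation as the sum of the `dx_i ∧ ·`, the sign arises from moving `dx_i` past `a`. -/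
theorem alternatizeUncurryFin_wedge {q k l : ℕ} (a : Alt q k) (b : Alt q l)
    (L : (Fin q → ℝ) →L[ℝ] Alt q k) (L' : (Fin q → ℝ) →L[ℝ] Alt q l)
    (M : (Fin q → ℝ) →L[ℝ] Alt q (k + l))
    (h : ∀ v, M v = wedge q k l (L v) b + wedge q k l a (L' v)) :
    AltSum.of q (k + l + 1) (ContinuousAlternatingMap.alternatizeUncurryFin M) =
      AltSum.mul q (k + 1) (ContinuousAlternatingMap.alternatizeUncurryFin L) (AltSum.of q l b) +
      (-1 : ℝ) ^ k • AltSum.mul q k a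
        (AltSum.of q (l + 1) (ContinuousAlternatingMap.alternatizeUncurryFin L')) := by
  rw [alternatizeUncurryFin_eq_sum, alternatizeUncurryFin_eq_sum, alternatizeUncurryFin_eq_sum,
    map_sum, map_sum, map_sum, map_sum, LinearMap.sum_apply, Finset.smul_sum,
    ← Finset.sum_add_distrib]
  refine Finset.sum_congr rfl fun i _ => ?_
  rw [← AltSum.mulOne_of, ← AltSum.mulOne_of, h, map_add, map_add, ← AltSum.mul_of,
    ← AltSum.mul_of, AltSum.mul_wedgeOne, AltSum.mulOne_mul (a := a)]
  rfl

theorem wedge_compContinuousLinearMap {q q' k l : ℕ} (a : Alt q k) (b : Alt q l)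
    (f : (Fin q' → ℝ) →L[ℝ] (Fin q → ℝ)) :
    (wedge q k l a b).compContinuousLinearMap f =
      wedge q' k l (a.compContinuousLinearMap f) (b.compContinuousLinearMap f) := by
  ext v
  change LinearMap.mul' ℝ ℝ ((a.toAlternatingMap.domCoprod b.toAlternatingMap) _) =
    LinearMap.mul' ℝ ℝ (((a.compContinuousLinearMap f).toAlternatingMap.domCoprod
      (b.compContinuousLinearMap f).toAlternatingMap) _)
  congr 1
  rw [AlternatingMap.domCoprod_apply, AlternatingMap.domCoprod_apply, sum_apply, sum_apply]
  refine Finset.sum_congr rfl fun σ _ => ?_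
  induction σ using Quotient.inductionOn' with | _ σ
  rfl

/-! ### Exterior products of forms -/

theorem Form.wedge_apply {q k l : ℕ} (φ : Form q k) (η : Form q l) {x : Fin q → ℝ}
    (hx : x ∈ simplex q) :
    (Form.wedge q k l φ η).1 x = TwistedTorsion.wedge q k l (φ.1 x) (η.1 x) :=
  Form.mk_apply _ (Form.contDiffOn_wedge φ η) hx

theorem Form.pull_wedge {q k l : ℕ} (i : Fin (q + 2)) (φ : Form (q + 1) k) (η : Form (q + 1) l) :
    Form.pull q (k + l) i (Form.wedge (q + 1) k l φ η) =
      Form.wedge q k l (Form.pull q k i φ) (Form.pull q l i η) := Form.ext' fun x hx => by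
  rw [Form.pull_apply _ _ hx, Form.wedge_apply _ _ (faceMap_mem i hx), Form.wedge_apply _ _ hx,
    Form.pull_apply _ _ hx, Form.pull_apply _ _ hx, wedge_compContinuousLinearMap]

theorem Form.d_wedge_of_closed {q k l : ℕ} (φ : Form q k) (η : Form q l)
    (hφ : Form.d q k φ = 0) :
    (Form.d q (k + l) (Form.wedge q k l φ η) : Form q (k + l + 1)) =
      (-1 : ℝ) ^ k • Form.wedge q k (l + 1) φ (Form.d q l η) := Form.ext' fun x hx => by
  let B : Alt q k →L[ℝ] Alt q l →L[ℝ] Alt q (k + l) := LinearMap.toContinuousLinearMap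
    { toFun := fun a => LinearMap.toContinuousLinearMap (TwistedTorsion.wedge q k l a)
      map_add' := fun a b => by ext; simp
      map_smul' := fun c a => by ext; simp }
  have h1 := (Form.contDiffOn φ).differentiableOn (by simp) x hx
  have h2 := (Form.contDiffOn η).differentiableOn (by simp) x hx
  have h3 := alternatizeUncurryFin_wedge (φ.1 x) (η.1 x) (fderivWithin ℝ φ.1 (simplex q) x)
    (fderivWithin ℝ η.1 (simplex q) x)
    (fderivWithin ℝ (fun y => TwistedTorsion.wedge q k l (φ.1 y) (η.1 y)) (simplex q) x)
    (fderivWithin_clm_apply_clm_apply B h1 h2 (uniqueDiffOn_simplex q x hx))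
  have h4 : ContinuousAlternatingMap.alternatizeUncurryFin (fderivWithin ℝ φ.1 (simplex q) x) =
      0 := by
    refine (Form.d_apply φ hx).symm.trans ?_
    rw [hφ]
    rfl
  rw [h4, map_zero, LinearMap.zero_apply, zero_add, AltSum.mul_of, ← map_smul] at h3
  rw [Form.d_apply _ hx, extDerivWithin_congr' (fun y hy => Form.wedge_apply φ η hy) hx]
  refine (AltSum.of_injective _ _ h3).trans ?_
  refine Eq.trans ?_ (congrArg ((-1 : ℝ) ^ k • ·) (Form.wedge_apply φ (Form.d q l η) hx)).symm
  rw [Form.d_apply _ hx]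
  rfl

instance {V : Type*} [PartialOrder V] (K : OrderedComplex V) : AddCommGroup K.Du :=
  Module.addCommMonoidToAddCommGroup ℝ

theorem Du.of_eq_neg_of {V : Type*} [PartialOrder V] {K : OrderedComplex V} {q a b : ℕ}
    (s : K.Simplex q) (h : a = b) (φ : Form q a) (η : Form q b)
    (hφ : ∀ x ∈ simplex q, AltSum.of q a (φ.1 x) = -AltSum.of q b (η.1 x)) :
    OrderedComplex.Du.of K s a φ = -OrderedComplex.Du.of K s b η := by
  subst h
  rw [← map_neg]
  congr 1
  refine Form.ext' fun x hx => AltSum.of_injective q a ?_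
  rw [hφ x hx, ← map_neg]
  rfl

/-- Two forms of odd degree anticommute. The statement is in `Du` because the degrees `k + (l + j)`
and `l + (k + j)` are only propositionally equal. -/
theorem Du.of_wedge_wedge {V : Type*} [PartialOrder V] {K : OrderedComplex V} {q k l j : ℕ}
    (s : K.Simplex q) (hk : Odd k) (hl : Odd l) (φ : Form q k) (ψ : Form q l) (η : Form q j) :
    OrderedComplex.Du.of K s (k + (l + j)) (Form.wedge q k (l + j) φ (Form.wedge q l j ψ η)) =
      -OrderedComplex.Du.of K s (l + (k + j))
        (Form.wedge q l (k + j) ψ (Form.wedge q k j φ η)) := by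
  refine Du.of_eq_neg_of s (by omega) _ _ fun x hx => ?_
  rw [Form.wedge_apply _ _ hx, Form.wedge_apply _ _ hx, Form.wedge_apply _ _ hx,
    Form.wedge_apply _ _ hx, ← AltSum.mul_of, ← AltSum.mul_of, AltSum.mul_mul, ← AltSum.mul_of,
    ← AltSum.mul_of, (hk.mul hl).neg_one_pow, neg_one_smul]

/-! ### Iterated faces -/

/-- The simplicial identity, stated through the involution `(i, j) ↦ (i.succAbove j, j.predAbove i)`
of the pairs of omitted vertices; this form allows pairing off the terms of the double boundary. -/
theorem insertNth_insertNth_eq {n : ℕ} (i : Fin (n + 2)) (j : Fin (n + 1)) (b : Fin n → ℝ) :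
    (i.insertNth (α := fun _ => ℝ) 0 (j.insertNth (α := fun _ => ℝ) 0 b : Fin (n + 1) → ℝ) :
      Fin (n + 2) → ℝ) =
    (i.succAbove j).insertNth (α := fun _ => ℝ) 0
      ((j.predAbove i).insertNth (α := fun _ => ℝ) 0 b : Fin (n + 1) → ℝ) := by
  funext m
  refine Fin.succAboveCases (i.succAbove j) ?_ (fun m => ?_) m
  · simp
  · rw [Fin.insertNth_apply_succAbove]
    refine Fin.succAboveCases (j.predAbove i) ?_ (fun m => ?_) m
    · rw [Fin.succAbove_succAbove_predAbove]
      simp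
    · rw [Fin.succAbove_succAbove_succAbove_predAbove]
      simp

/-- Barycentric coordinates. -/
def bary {q : ℕ} (x : Fin q → ℝ) : Fin (q + 1) → ℝ := Fin.cons (1 - ∑ j, x j) x

/-- The coordinate of index `0` is recovered from the others because barycentric coordinates add up
to `1`. -/
theorem bary_faceMap {q : ℕ} (i : Fin (q + 2)) (x : Fin q → ℝ) :
    bary (faceMap q i x) = i.insertNth (α := fun _ => ℝ) 0 (bary x) := by
  set b : Fin (q + 2) → ℝ := i.insertNth (α := fun _ => ℝ) 0 (bary x) with hb
  have hb1 : ∑ j, b j = 1 := by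
    rw [hb, Fin.sum_insertNth, bary, Fin.sum_univ_succ]
    simp
  have h : faceMap q i x = Fin.tail b := rfl
  rw [h, bary, ← hb1, Fin.sum_univ_succ]
  refine Eq.trans ?_ (Fin.cons_self_tail b)
  congr 1
  simp [Fin.tail]

theorem faceMap_faceMap {q : ℕ} (i : Fin (q + 3)) (j : Fin (q + 2)) (x : Fin q → ℝ) :
    faceMap (q + 1) i (faceMap q j x) =
      faceMap (q + 1) (i.succAbove j) (faceMap q (j.predAbove i) x) := by
  have h : bary (faceMap (q + 1) i (faceMap q j x)) =
      bary (faceMap (q + 1) (i.succAbove j) (faceMap q (j.predAbove i) x)) := by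
    rw [bary_faceMap, bary_faceMap, bary_faceMap, bary_faceMap, insertNth_insertNth_eq]
  have h' := congrArg Fin.tail h
  rwa [bary, bary, Fin.tail_cons, Fin.tail_cons] at h'

/-- Differentiate the corresponding identity of the affine face maps. -/
theorem faceLin_faceLin {q : ℕ} (i : Fin (q + 3)) (j : Fin (q + 2)) :
    (faceLin (q + 1) i).comp (faceLin q j) =
      (faceLin (q + 1) (i.succAbove j)).comp (faceLin q (j.predAbove i)) := by
  have h : ∀ i j, HasFDerivAt (fun x => faceMap (q + 1) i (faceMap q j x))
      ((faceLin (q + 1) i).comp (faceLin q j)) 0 := fun i j =>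
    (hasFDerivAt_faceMap (q + 1) i _).comp 0 (hasFDerivAt_faceMap q j 0)
  refine (h i j).unique ?_
  rw [funext (faceMap_faceMap i j)]
  exact h _ _

theorem Form.pull_pull {q k : ℕ} (i : Fin (q + 3)) (j : Fin (q + 2)) (φ : Form (q + 2) k) :
    Form.pull q k j (Form.pull (q + 1) k i φ) =
      Form.pull q k (j.predAbove i) (Form.pull (q + 1) k (i.succAbove j) φ) :=
  Form.ext' fun x hx => by
    rw [Form.pull_apply _ _ hx, Form.pull_apply _ _ (faceMap_mem j hx), Form.pull_apply _ _ hx,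
      Form.pull_apply _ _ (faceMap_mem _ hx), faceMap_faceMap]
    ext v
    simp only [ContinuousAlternatingMap.compContinuousLinearMap_apply]
    congr 1
    funext m
    exact congrArg (fun f => f (v m)) (faceLin_faceLin i j)

namespace OrderedComplex

variable {V : Type*} [PartialOrder V] {K : OrderedComplex V}

theorem Simplex.face_face {q : ℕ} (i : Fin (q + 3)) (j : Fin (q + 2)) (s : K.Simplex (q + 2)) :
    (s.face i).face j = (s.face (i.succAbove j)).face (j.predAbove i) := by
  refine Subtype.ext (RelEmbedding.ext fun m => ?_)
  change s.1 (i.succAbove (j.succAbove m)) =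
    s.1 ((i.succAbove j).succAbove ((j.predAbove i).succAbove m))
  rw [Fin.succAbove_succAbove_succAbove_predAbove]

variable (K)

/-! ### The twisted differential has square zero -/

/-- The face part of the differential of `Du_•(K)`. -/
def Du.faceBoundary : K.Du →ₗ[ℝ] K.Du := Du.lift K (Du.facePart K)

/-- The exterior derivative part of the differential of `Du_•(K)`. -/
def Du.extBoundary : K.Du →ₗ[ℝ] K.Du :=
  Du.lift K fun x j => (-1 : ℝ) ^ (x.1 + j) • (Du.of K x.2 (j + 1) ∘ₗ Form.d x.1 j)

theorem Du.boundary_eq : Du.boundary K = Du.extBoundary K + Du.faceBoundary K :=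
  Du.hom_ext K fun q s j φ => by
    simp [Du.boundary, Du.extBoundary, Du.faceBoundary, Du.lift_of]

theorem Du.extBoundary_of {q : ℕ} (s : K.Simplex q) (j : ℕ) (φ : Form q j) :
    Du.extBoundary K (Du.of K s j φ) =
      (-1 : ℝ) ^ (q + j) • Du.of K s (j + 1) (Form.d q j φ) := by
  simp [Du.extBoundary, Du.lift_of]

theorem Du.faceBoundary_of_zero (s : K.Simplex 0) (j : ℕ) (φ : Form 0 j) :
    Du.faceBoundary K (Du.of K s j φ) = 0 := by
  simp [Du.faceBoundary, Du.lift_of, Du.facePart]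

theorem Du.faceBoundary_of_succ {q : ℕ} (s : K.Simplex (q + 1)) (j : ℕ) (φ : Form (q + 1) j) :
    Du.faceBoundary K (Du.of K s j φ) = ∑ i : Fin (q + 2),
      (-1 : ℝ) ^ (i : ℕ) • Du.of K (s.face i) j (Form.pull q j i φ) := by
  simp [Du.faceBoundary, Du.lift_of, Du.facePart, LinearMap.sum_apply]

theorem Du.extBoundary_extBoundary : Du.extBoundary K ∘ₗ Du.extBoundary K = 0 :=
  Du.hom_ext K fun q s j φ => by
    simp [Du.extBoundary_of, Form.d_d]

theorem Du.faceBoundary_faceBoundary : Du.faceBoundary K ∘ₗ Du.faceBoundary K = 0 :=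
  Du.hom_ext K fun q s j φ => by
    rw [LinearMap.comp_apply, LinearMap.zero_apply]
    match q, s, φ with
    | 0, s, φ => rw [Du.faceBoundary_of_zero, map_zero]
    | 1, s, φ =>
      rw [Du.faceBoundary_of_succ, map_sum]
      exact Finset.sum_eq_zero fun i _ => by rw [map_smul, Du.faceBoundary_of_zero, smul_zero]
    | q + 2, s, φ =>
      rw [Du.faceBoundary_of_succ, map_sum]
      simp only [map_smul, Du.faceBoundary_of_succ, Finset.smul_sum, smul_smul, ← pow_add]
      rw [← Finset.sum_product']
      -- The involution keeps the iterated face and the restricted form and reverses the sign.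
      refine Finset.sum_involution (fun x _ => (x.1.succAbove x.2, x.2.predAbove x.1)) ?_ ?_ ?_ ?_
      · rintro ⟨i, j⟩ -
        simp only
        rw [Simplex.face_face i j, Form.pull_pull i j, ← add_smul]
        have h : (-1 : ℝ) ^ ((i.succAbove j : ℕ) + (j.predAbove i : ℕ)) =
            -(-1 : ℝ) ^ ((i : ℕ) + (j : ℕ)) :=
          Fin.neg_one_pow_succAbove_add_predAbove i j
        rw [h, add_neg_cancel, zero_smul]
      · rintro ⟨i, j⟩ - - h
        exact Fin.succAbove_ne i j (congrArg Prod.fst h)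
      · intros; exact Finset.mem_univ _
      · rintro ⟨i, j⟩ -
        simp only [Prod.mk.injEq]
        exact ⟨Fin.succAbove_succAbove_predAbove i j, Fin.predAbove_predAbove_succAbove i j⟩

/-- Restriction to faces commutes with `d`, while the sign `(-1) ^ (q + j)` changes when `q` drops
by one. -/
theorem Du.extBoundary_faceBoundary :
    Du.extBoundary K ∘ₗ Du.faceBoundary K + Du.faceBoundary K ∘ₗ Du.extBoundary K = 0 :=
  Du.hom_ext K fun q s j φ => by
    simp only [LinearMap.add_apply, LinearMap.comp_apply, LinearMap.zero_apply]
    cases q with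
    | zero =>
      rw [Du.faceBoundary_of_zero, Du.extBoundary_of, map_smul, Du.faceBoundary_of_zero]
      simp
    | succ q =>
      rw [Du.faceBoundary_of_succ, Du.extBoundary_of, map_smul, Du.faceBoundary_of_succ, map_sum,
        Finset.smul_sum, ← Finset.sum_add_distrib]
      refine Finset.sum_eq_zero fun i _ => ?_
      rw [map_smul, Du.extBoundary_of, Form.d_pull, smul_smul, smul_smul, ← add_smul]
      ring_nf
      simp

theorem Du.boundary_boundary : Du.boundary K ∘ₗ Du.boundary K = 0 := by
  rw [Du.boundary_eq, LinearMap.add_comp, LinearMap.comp_add, LinearMap.comp_add,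
    Du.extBoundary_extBoundary, Du.faceBoundary_faceBoundary, zero_add, add_zero,
    Du.extBoundary_faceBoundary]

theorem Du.signedMul_of {k : ℕ} (φ : K.PLForm k) {q : ℕ} (s : K.Simplex q) (j : ℕ)
    (η : Form q j) : Du.signedMul K k φ (Du.of K s j η) =
      (-1 : ℝ) ^ (k * (q + j + k)) • Du.of K s (k + j) (Form.wedge q k j (φ.1 q s) η) := by
  simp [Du.signedMul, Du.mul, Du.lift_of]

/-- For odd `k` the sign depends only on the degree of the current, exactly as in the exterior
derivative part of the boundary; this is why the anticommutation relations below hold. -/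
theorem Du.signedMul_of_odd {k : ℕ} (hk : Odd k) (φ : K.PLForm k) {q : ℕ} (s : K.Simplex q)
    (j : ℕ) (η : Form q j) : Du.signedMul K k φ (Du.of K s j η) =
      -((-1 : ℝ) ^ (q + j) • Du.of K s (k + j) (Form.wedge q k j (φ.1 q s) η)) := by
  rw [Du.signedMul_of, pow_mul, hk.neg_one_pow, pow_add, hk.neg_one_pow, mul_neg_one, neg_smul]

/-- The two parts of the boundary anticommute with the product separately: the exterior derivative
by the Leibniz rule for a closed form of odd degree, the face part because `φ` restricts to faces
compatibly and the sign depends on the dimension. -/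
theorem Du.boundary_signedMul {k : ℕ} (hk : Odd k) (φ : K.PLForm k)
    (hφ : ∀ q s, Form.d q k (φ.1 q s) = 0) :
    Du.boundary K ∘ₗ Du.signedMul K k φ + Du.signedMul K k φ ∘ₗ Du.boundary K = 0 := by
  have h1 : Du.extBoundary K ∘ₗ Du.signedMul K k φ +
      Du.signedMul K k φ ∘ₗ Du.extBoundary K = 0 := Du.hom_ext K fun q s j η => by
    simp only [LinearMap.add_apply, LinearMap.comp_apply, LinearMap.zero_apply]
    rw [Du.signedMul_of_odd K hk, Du.extBoundary_of, map_neg, map_smul, map_smul,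
      Du.signedMul_of_odd K hk, Du.extBoundary_of, Form.d_wedge_of_closed _ _ (hφ q s),
      hk.neg_one_pow, map_smul, smul_neg, smul_smul, smul_smul, smul_smul, ← neg_smul, ← neg_smul]
    refine (add_smul _ _ _).symm.trans ?_
    have h : (-1 : ℝ) ^ (q + (k + j)) = -(-1 : ℝ) ^ (q + j) := by
      rw [show q + (k + j) = k + (q + j) by ring, pow_add, hk.neg_one_pow, neg_one_mul]
    rw [h, ← add_assoc, pow_succ]
    ring_nf
    simp
  have h2 : Du.faceBoundary K ∘ₗ Du.signedMul K k φ +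
      Du.signedMul K k φ ∘ₗ Du.faceBoundary K = 0 := Du.hom_ext K fun q s j η => by
    simp only [LinearMap.add_apply, LinearMap.comp_apply, LinearMap.zero_apply]
    cases q with
    | zero =>
      rw [Du.faceBoundary_of_zero, Du.signedMul_of, map_smul, Du.faceBoundary_of_zero]
      simp
    | succ q =>
      rw [Du.faceBoundary_of_succ, Du.signedMul_of_odd K hk, map_neg, map_smul,
        Du.faceBoundary_of_succ, map_sum, Finset.smul_sum, ← Finset.sum_neg_distrib,
        ← Finset.sum_add_distrib]
      refine Finset.sum_eq_zero fun i _ => ?_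
      rw [map_smul, Du.signedMul_of_odd K hk, Form.pull_wedge, φ.2 q i s, smul_neg, smul_smul,
        smul_smul, ← neg_smul, ← neg_smul, ← add_smul]
      ring_nf
      simp
  rw [Du.boundary_eq, LinearMap.add_comp, LinearMap.comp_add, add_add_add_comm, h1, h2, add_zero]

/-- The degree signs are the same in both orders, as `k` and `l` are odd, so the relation is the
anticommutation of odd forms. -/
theorem Du.signedMul_signedMul {k l : ℕ} (hk : Odd k) (hl : Odd l) (φ : K.PLForm k)
    (ψ : K.PLForm l) :
    Du.signedMul K k φ ∘ₗ Du.signedMul K l ψ + Du.signedMul K l ψ ∘ₗ Du.signedMul K k φ = 0 :=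
  Du.hom_ext K fun q s j η => by
    simp only [LinearMap.add_apply, LinearMap.comp_apply, LinearMap.zero_apply]
    rw [Du.signedMul_of_odd K hk, Du.signedMul_of_odd K hl, map_neg, map_neg, map_smul, map_smul,
      Du.signedMul_of_odd K hk, Du.signedMul_of_odd K hl, Du.of_wedge_wedge s hk hl]
    have h : ∀ {k : ℕ}, Odd k → (-1 : ℝ) ^ (q + (k + j)) = -(-1 : ℝ) ^ (q + j) := fun {k} hk => by
      rw [show q + (k + j) = k + (q + j) by ring, pow_add, hk.neg_one_pow, neg_one_mul]
    rw [h hk, h hl]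
    simp

variable {K} {v₀ : V}

theorem twist_of (i : ℕ) (φ : K.PLForm (2 * i + 3)) :
    K.twist v₀ (DirectSum.of (fun i => K.PLForm (2 * i + 3)) i φ) =
      Du.signedMul (K.cover v₀) (2 * i + 3) (PLForm.pullCover (2 * i + 3) φ) :=
  DirectSum.toModule_lof ℝ (M := fun i => K.PLForm (2 * i + 3)) i φ

theorem odd_two_mul_add_three (i : ℕ) : Odd (2 * i + 3) := ⟨i + 1, by ring⟩

/-- Polarized form of the vanishing of the square: it is bilinear, so it reduces to single
homogeneous components, and with `t = u` it gives twice the square. -/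
theorem twist_twist_add (t u : K.OddForm) :
    K.twist v₀ t ∘ₗ K.twist v₀ u + K.twist v₀ u ∘ₗ K.twist v₀ t = 0 := by
  classical
  refine LinearMap.ext fun x => ?_
  rw [← DirectSum.sum_support_of t, ← DirectSum.sum_support_of u, map_sum, map_sum]
  simp only [LinearMap.add_apply, LinearMap.comp_apply, LinearMap.sum_apply, map_sum,
    LinearMap.zero_apply]
  rw [Finset.sum_comm, ← Finset.sum_add_distrib]
  refine Finset.sum_eq_zero fun j _ => ?_
  rw [← Finset.sum_add_distrib]
  refine Finset.sum_eq_zero fun i _ => ?_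
  rw [twist_of, twist_of]
  exact LinearMap.congr_fun (Du.signedMul_signedMul _ (odd_two_mul_add_three _)
    (odd_two_mul_add_three _) _ _) x

theorem eq_zero_of_add_self {N : Type*} [AddCommGroup N] [Module ℝ N] {f : N →ₗ[ℝ] N}
    (h : f + f = 0) : f = 0 := by
  rw [← two_smul ℝ f] at h
  exact (smul_eq_zero.1 h).resolve_left two_ne_zero

theorem twist_twist (t : K.OddForm) : K.twist v₀ t ∘ₗ K.twist v₀ t = 0 :=
  eq_zero_of_add_self (twist_twist_add t t)

theorem boundary_twist {t : K.OddForm} (ht : K.IsClosed t) :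
    Du.boundary (K.cover v₀) ∘ₗ K.twist v₀ t + K.twist v₀ t ∘ₗ Du.boundary (K.cover v₀) = 0 := by
  classical
  refine LinearMap.ext fun x => ?_
  rw [← DirectSum.sum_support_of t, map_sum]
  simp only [LinearMap.add_apply, LinearMap.comp_apply, LinearMap.sum_apply, map_sum,
    LinearMap.zero_apply]
  rw [← Finset.sum_add_distrib]
  refine Finset.sum_eq_zero fun i _ => ?_
  rw [twist_of]
  exact LinearMap.congr_fun (Du.boundary_signedMul _ (odd_two_mul_add_three i) _
    fun q s => ht i q s.proj) x

theorem boundary_add_twist_sq {t : K.OddForm} (ht : K.IsClosed t) :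
    (Du.boundary (K.cover v₀) + K.twist v₀ t) ∘ₗ (Du.boundary (K.cover v₀) + K.twist v₀ t) = 0 := by
  rw [LinearMap.add_comp, LinearMap.comp_add, LinearMap.comp_add, Du.boundary_boundary,
    twist_twist, zero_add, add_zero, boundary_twist ht]

end OrderedComplex

namespace OrderedComplex

section Contraction

variable {V : Type*} [PartialOrder V] (K : OrderedComplex V)

/-! ### Degrees -/

/-- The span of the elements `φ ⊗ σ` of `Du_•(K)` whose degree satisfies `P`. -/
def Du.supp (P : ℤ → Prop) : Submodule ℝ K.Du :=
  Submodule.span ℝ {y | ∃ q, ∃ s : K.Simplex q, ∃ j, ∃ φ : Form q j,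
    P ((q : ℤ) - j) ∧ y = Du.of K s j φ}

variable {K}

theorem Du.of_mem_supp {P : ℤ → Prop} {q : ℕ} {s : K.Simplex q} {j : ℕ} {φ : Form q j}
    (h : P ((q : ℤ) - j)) : Du.of K s j φ ∈ Du.supp K P :=
  Submodule.subset_span ⟨q, s, j, φ, h, rfl⟩

theorem Du.supp_le {P : ℤ → Prop} {W : Submodule ℝ K.Du}
    (h : ∀ q (s : K.Simplex q) j (φ : Form q j), P ((q : ℤ) - j) → Du.of K s j φ ∈ W) :
    Du.supp K P ≤ W := by
  refine Submodule.span_le.2 ?_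
  rintro _ ⟨q, s, j, φ, hP, rfl⟩
  exact h q s j φ hP

theorem Du.supp_mono {P Q : ℤ → Prop} (h : ∀ m, P m → Q m) : Du.supp K P ≤ Du.supp K Q :=
  Du.supp_le fun _ _ _ _ hP => Du.of_mem_supp (h _ hP)

/-- The operator `A` changes degrees according to the relation `R`. -/
def Du.Shifts (A : K.Du →ₗ[ℝ] K.Du) (R : ℤ → ℤ → Prop) : Prop :=
  ∀ q (s : K.Simplex q) j (φ : Form q j),
    A (Du.of K s j φ) ∈ Du.supp K (R ((q : ℤ) - j))

theorem Du.Shifts.map {A : K.Du →ₗ[ℝ] K.Du} {R : ℤ → ℤ → Prop} (hA : Du.Shifts A R)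
    {P Q : ℤ → Prop} (h : ∀ m n, P m → R m n → Q n) {x : K.Du} (hx : x ∈ Du.supp K P) :
    A x ∈ Du.supp K Q := by
  have h' : Du.supp K P ≤ (Du.supp K Q).comap A := Du.supp_le fun q s j φ hP =>
    Du.supp_mono (fun n hn => h _ n hP hn) (hA q s j φ)
  exact h' hx

theorem Du.Shifts.comp {A B : K.Du →ₗ[ℝ] K.Du} {R S T : ℤ → ℤ → Prop} (hA : Du.Shifts A R)
    (hB : Du.Shifts B S) (h : ∀ l m n, S l m → R m n → T l n) : Du.Shifts (A ∘ₗ B) T :=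
  fun q s j φ => hA.map (fun m n => h _ m n) (hB q s j φ)

theorem Du.Shifts.add {A B : K.Du →ₗ[ℝ] K.Du} {R : ℤ → ℤ → Prop} (hA : Du.Shifts A R)
    (hB : Du.Shifts B R) : Du.Shifts (A + B) R :=
  fun q s j φ => Submodule.add_mem _ (hA q s j φ) (hB q s j φ)

theorem Du.Shifts.sub {A B : K.Du →ₗ[ℝ] K.Du} {R : ℤ → ℤ → Prop} (hA : Du.Shifts A R)
    (hB : Du.Shifts B R) : Du.Shifts (A - B) R :=
  fun q s j φ => Submodule.sub_mem _ (hA q s j φ) (hB q s j φ)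

variable (K)

theorem Du.shifts_extBoundary : Du.Shifts (Du.extBoundary K) fun m n => n = m - 1 :=
  fun q s j φ => by
    rw [Du.extBoundary_of]
    exact Submodule.smul_mem _ _ (Du.of_mem_supp (by push_cast; ring))

theorem Du.shifts_faceBoundary : Du.Shifts (Du.faceBoundary K) fun m n => n = m - 1 :=
  fun q s j φ => by
    cases q with
    | zero => rw [Du.faceBoundary_of_zero]; exact Submodule.zero_mem _
    | succ q =>
      rw [Du.faceBoundary_of_succ]
      exact Submodule.sum_mem _ fun i _ =>
        Submodule.smul_mem _ _ (Du.of_mem_supp (by push_cast; ring))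

theorem Du.shifts_boundary : Du.Shifts (Du.boundary K) fun m n => n = m - 1 := by
  rw [Du.boundary_eq]
  exact (Du.shifts_extBoundary K).add (Du.shifts_faceBoundary K)

/-! ### The contraction of `Du_•(K)` onto `C_•(K)` -/

/-- The part of the homotopy operator of the Poincaré lemma on each simplex. -/
def Du.coneGen : ∀ (x : Σ q, K.Simplex q) (j : ℕ), Form x.1 j →ₗ[ℝ] K.Du
  | _, 0 => 0
  | x, j + 1 => (-1 : ℝ) ^ (x.1 + j) • (Du.of K x.2 j ∘ₗ Form.cone x.1 j)

/-- The homotopy operator of the Poincaré lemma on each simplex. -/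
def Du.cone : K.Du →ₗ[ℝ] K.Du := Du.lift K (Du.coneGen K)

/-- Evaluation of the forms of degree zero at the first vertex. -/
def Du.evalGen : ∀ (x : Σ q, K.Simplex q) (j : ℕ), Form x.1 j →ₗ[ℝ] K.Chain
  | x, 0 => { toFun := fun φ => φ.1 0 ![] • Finsupp.single x 1
              map_add' := fun φ η => add_smul (φ.1 0 ![]) (η.1 0 ![]) _
              map_smul' := fun c φ => mul_smul c (φ.1 0 ![]) _ }
  | _, _ + 1 => 0

/-- The left inverse of `ψ` given by evaluation at the first vertex. -/
def Du.eval : K.Du →ₗ[ℝ] K.Chain := Du.lift K (Du.evalGen K)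

theorem Du.cone_of_zero {q : ℕ} (s : K.Simplex q) (φ : Form q 0) :
    Du.cone K (Du.of K s 0 φ) = 0 := by
  simp [Du.cone, Du.lift_of, Du.coneGen]

theorem Du.cone_of_succ {q : ℕ} (s : K.Simplex q) (j : ℕ) (φ : Form q (j + 1)) :
    Du.cone K (Du.of K s (j + 1) φ) = (-1 : ℝ) ^ (q + j) • Du.of K s j (Form.cone q j φ) := by
  simp [Du.cone, Du.lift_of, Du.coneGen]

theorem Du.eval_of_zero {q : ℕ} (s : K.Simplex q) (φ : Form q 0) :
    Du.eval K (Du.of K s 0 φ) = φ.1 0 ![] • Finsupp.single ⟨q, s⟩ 1 := by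
  rw [Du.eval, Du.lift_of]
  rfl

theorem Du.eval_of_succ {q : ℕ} (s : K.Simplex q) (j : ℕ) (φ : Form q (j + 1)) :
    Du.eval K (Du.of K s (j + 1) φ) = 0 := by
  rw [Du.eval, Du.lift_of]
  rfl

theorem psi_single {q : ℕ} (s : K.Simplex q) :
    K.psi (Finsupp.single ⟨q, s⟩ 1) = Du.of K s 0 (Form.one q) := by
  rw [psi, Finsupp.linearCombination_single, one_smul]

theorem Du.eval_psi : Du.eval K ∘ₗ K.psi = LinearMap.id := by
  refine Finsupp.lhom_ext' fun x => LinearMap.ext_ring ?_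
  obtain ⟨q, s⟩ := x
  simp only [LinearMap.comp_apply, Finsupp.lsingle_apply, psi_single, Du.eval_of_zero,
    LinearMap.id_apply]
  rw [Form.one_apply (zero_mem_simplex q)]
  simp

theorem Du.cone_psi : Du.cone K ∘ₗ K.psi = 0 := by
  refine Finsupp.lhom_ext' fun x => LinearMap.ext_ring ?_
  obtain ⟨q, s⟩ := x
  simp only [LinearMap.comp_apply, Finsupp.lsingle_apply, psi_single, Du.cone_of_zero,
    LinearMap.zero_apply]

/-- The Poincaré lemma on each simplex. The signs in `Du.coneGen` are chosen so that they cancel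
those of the exterior derivative; in degree zero the missing constant is `ψ` of the value at the
first vertex. -/
theorem Du.extBoundary_cone : Du.extBoundary K ∘ₗ Du.cone K + Du.cone K ∘ₗ Du.extBoundary K =
    LinearMap.id - K.psi ∘ₗ Du.eval K := Du.hom_ext K fun q s j φ => by
  simp only [LinearMap.add_apply, LinearMap.comp_apply, LinearMap.sub_apply, LinearMap.id_apply]
  cases j with
  | zero =>
    rw [Du.cone_of_zero, Du.extBoundary_of, map_smul, Du.cone_of_succ, Form.cone_d_zero,
      Du.eval_of_zero, map_smul, psi_single, map_zero, zero_add, smul_smul, add_zero, ← mul_pow,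
      eq_sub_iff_add_eq]
    simp only [mul_neg, mul_one, neg_neg, one_pow, one_smul]
    rw [← map_smul, ← map_add]
    exact congrArg _ (Form.ext' fun x _ => sub_add_cancel (φ.1 x) _)
  | succ j =>
    rw [Du.cone_of_succ, Du.extBoundary_of, Du.eval_of_succ, map_smul, map_smul, map_zero,
      sub_zero, Du.extBoundary_of, Du.cone_of_succ, smul_smul, smul_smul, ← mul_pow, ← mul_pow]
    simp only [mul_neg, mul_one, neg_neg, one_pow, one_smul]
    rw [← map_add, Form.d_cone_add_cone_d]

/-- The correction term of the contraction; it lowers the dimension of simplexes. -/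
def Du.defect : K.Du →ₗ[ℝ] K.Du :=
  Du.faceBoundary K ∘ₗ Du.cone K + Du.cone K ∘ₗ Du.faceBoundary K

/-- A chain map homotopic to the identity, whose iterates map to the image of `ψ`. -/
def Du.contr : Module.End ℝ K.Du := K.psi ∘ₗ Du.eval K - Du.defect K

/-- Faces which omit the first vertex have another cone point, so coning does not anticommute with
the face part; the discrepancy is `Du.defect`. -/
theorem Du.boundary_cone : Du.boundary K ∘ₗ Du.cone K + Du.cone K ∘ₗ Du.boundary K =
    LinearMap.id - Du.contr K := by
  rw [Du.boundary_eq, LinearMap.add_comp, LinearMap.comp_add, add_add_add_comm,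
    Du.extBoundary_cone, Du.contr, sub_sub_eq_add_sub, sub_add_eq_add_sub]
  rfl

/-- The cone operator kills the image of `ψ`, and this image is stable under the boundary, so the
homotopy of `Du.boundary_cone` vanishes on it. -/
theorem Du.contr_psi (c : K.Chain) : Du.contr K (K.psi c) = K.psi c := by
  have h := LinearMap.congr_fun (Du.boundary_cone K) (K.psi c)
  have h1 : ∀ c, Du.cone K (K.psi c) = 0 := fun c => LinearMap.congr_fun (Du.cone_psi K) c
  simp only [LinearMap.add_apply, LinearMap.comp_apply, h1, map_zero, ← psi_boundary, add_zero,
    LinearMap.sub_apply, LinearMap.id_apply] at h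
  exact (sub_eq_zero.1 h.symm).symm

/-- The currents on the simplexes of dimension less than `m`. -/
def Du.skel (m : ℕ) : Submodule ℝ K.Du :=
  Submodule.span ℝ {y | ∃ q, ∃ s : K.Simplex q, ∃ j, ∃ φ : Form q j,
    q < m ∧ y = Du.of K s j φ}

variable {K} in
theorem Du.of_mem_skel {m q : ℕ} {s : K.Simplex q} {j : ℕ} {φ : Form q j}
    (h : q < m) : Du.of K s j φ ∈ Du.skel K m :=
  Submodule.subset_span ⟨q, s, j, φ, h, rfl⟩

variable {K} in
theorem Du.skel_le {m : ℕ} {W : Submodule ℝ K.Du}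
    (h : ∀ q (s : K.Simplex q) j (φ : Form q j), q < m → Du.of K s j φ ∈ W) :
    Du.skel K m ≤ W := by
  refine Submodule.span_le.2 ?_
  rintro _ ⟨q, s, j, φ, hP, rfl⟩
  exact h q s j φ hP

theorem Du.cone_mem_skel {m : ℕ} {x : K.Du} (hx : x ∈ Du.skel K m) :
    Du.cone K x ∈ Du.skel K m := by
  have h : Du.skel K m ≤ (Du.skel K m).comap (Du.cone K) := Du.skel_le fun q s j φ hq => by
    rw [Submodule.mem_comap]
    cases j with
    | zero => rw [Du.cone_of_zero]; exact Submodule.zero_mem _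
    | succ j => rw [Du.cone_of_succ]; exact Submodule.smul_mem _ _ (Du.of_mem_skel hq)
  exact h hx

theorem Du.faceBoundary_mem_skel {m : ℕ} {x : K.Du} (hx : x ∈ Du.skel K (m + 1)) :
    Du.faceBoundary K x ∈ Du.skel K m := by
  have h : Du.skel K (m + 1) ≤ (Du.skel K m).comap (Du.faceBoundary K) :=
    Du.skel_le fun q s j φ hq => by
      rw [Submodule.mem_comap]
      cases q with
      | zero => rw [Du.faceBoundary_of_zero]; exact Submodule.zero_mem _
      | succ q =>
        rw [Du.faceBoundary_of_succ]
        exact Submodule.sum_mem _ fun i _ =>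
          Submodule.smul_mem _ _ (Du.of_mem_skel (by omega))
  exact h hx

/-- Each application of `Du.contr` produces a term in the image of `ψ`, which later applications
fix, and an error supported on simplexes of smaller dimension; after `m` steps no error is left. -/
theorem Du.contr_pow_mem_range (m : ℕ) {x : K.Du} (hx : x ∈ Du.skel K m) :
    (Du.contr K ^ m) x ∈ LinearMap.range K.psi := by
  induction m generalizing x with
  | zero =>
    have h : Du.skel K 0 ≤ ⊥ := Du.skel_le fun q s j φ hq => absurd hq (Nat.not_lt_zero _)
    rw [(Submodule.mem_bot ℝ).1 (h hx), map_zero]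
    exact Submodule.zero_mem _
  | succ m ih =>
    have hpsi : ∀ (m : ℕ) c, (Du.contr K ^ m) (K.psi c) = K.psi c := by
      intro m c
      induction m with
      | zero => rfl
      | succ m ih => rw [pow_succ, Module.End.mul_apply, Du.contr_psi, ih]
    have hx' : Du.contr K x = K.psi (Du.eval K x) - Du.defect K x := rfl
    rw [pow_succ, Module.End.mul_apply, hx', map_sub, hpsi]
    -- Both terms of the defect contain one face operator, hence lie in the smaller skeleton.
    refine Submodule.sub_mem _ ⟨_, rfl⟩ (ih (Submodule.add_mem _ ?_ ?_))
    · exact Du.faceBoundary_mem_skel K (Du.cone_mem_skel K hx)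
    · exact Du.cone_mem_skel K (Du.faceBoundary_mem_skel K hx)

theorem Du.boundary_contr : Du.boundary K ∘ₗ Du.contr K = Du.contr K ∘ₗ Du.boundary K := by
  have h : Du.contr K = LinearMap.id -
      (Du.boundary K ∘ₗ Du.cone K + Du.cone K ∘ₗ Du.boundary K) := by
    rw [Du.boundary_cone, sub_sub_cancel]
  have hb := Du.boundary_boundary K
  rw [h, LinearMap.comp_sub, LinearMap.sub_comp, LinearMap.comp_add, LinearMap.add_comp,
    ← LinearMap.comp_assoc, hb, LinearMap.comp_assoc, LinearMap.comp_assoc, hb,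
    LinearMap.zero_comp, LinearMap.comp_zero, LinearMap.comp_id, LinearMap.id_comp]
  simp

/-- The homotopy between the identity and the `m`-th iterate of `Du.contr`. -/
def Du.homotopy (m : ℕ) : K.Du →ₗ[ℝ] K.Du :=
  Du.cone K ∘ₗ (∑ i ∈ Finset.range m, Du.contr K ^ i : Module.End ℝ K.Du)

theorem Du.boundary_contr_pow (m : ℕ) :
    Du.boundary K ∘ₗ (Du.contr K ^ m) = (Du.contr K ^ m) ∘ₗ Du.boundary K :=
  (Commute.pow_right (a := (Du.boundary K : Module.End ℝ K.Du)) (Du.boundary_contr K) m)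

/-- The geometric sum of the powers of `Du.contr` commutes with the boundary, and multiplying it by
`id - contr` gives `id - contr ^ m`. -/
theorem Du.boundary_homotopy (m : ℕ) :
    Du.boundary K ∘ₗ Du.homotopy K m + Du.homotopy K m ∘ₗ Du.boundary K =
      LinearMap.id - Du.contr K ^ m := by
  set G : Module.End ℝ K.Du := ∑ i ∈ Finset.range m, Du.contr K ^ i with hG
  have hc : Du.boundary K ∘ₗ G = G ∘ₗ Du.boundary K :=
    Commute.sum_right (b := (Du.boundary K : Module.End ℝ K.Du)) _ _
      fun i _ => Du.boundary_contr_pow K i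
  have h : (LinearMap.id - Du.contr K) ∘ₗ G = LinearMap.id - Du.contr K ^ m :=
    mul_neg_geom_sum (Du.contr K) m
  rw [← h, ← Du.boundary_cone, Du.homotopy, ← hG, LinearMap.add_comp, LinearMap.comp_assoc,
    LinearMap.comp_assoc, LinearMap.comp_assoc, hc]

theorem Du.shifts_cone : Du.Shifts (Du.cone K) fun m n => n = m + 1 :=
  fun q s j φ => by
    cases j with
    | zero => rw [Du.cone_of_zero]; exact Submodule.zero_mem _
    | succ j =>
      rw [Du.cone_of_succ]
      exact Submodule.smul_mem _ _ (Du.of_mem_supp (by push_cast; ring))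

theorem Du.shifts_psi_eval : Du.Shifts (K.psi ∘ₗ Du.eval K) fun m n => n = m :=
  fun q s j φ => by
    rw [LinearMap.comp_apply]
    cases j with
    | zero =>
      rw [Du.eval_of_zero, map_smul, psi_single]
      exact Submodule.smul_mem _ _ (Du.of_mem_supp rfl)
    | succ j => rw [Du.eval_of_succ, map_zero]; exact Submodule.zero_mem _

theorem Du.shifts_contr : Du.Shifts (Du.contr K) fun m n => n = m :=
  (Du.shifts_psi_eval K).sub
    (((Du.shifts_faceBoundary K).comp (Du.shifts_cone K) (by intros; omega)).add
      ((Du.shifts_cone K).comp (Du.shifts_faceBoundary K) (by intros; omega)))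

theorem Du.shifts_contr_pow (m : ℕ) : Du.Shifts (Du.contr K ^ m) fun m n => n = m := by
  induction m with
  | zero => exact fun q s j φ => Du.of_mem_supp rfl
  | succ m ih => exact Du.Shifts.comp ih (Du.shifts_contr K) (by intros; omega)

theorem Du.shifts_homotopy (m : ℕ) : Du.Shifts (Du.homotopy K m) fun m n => n = m + 1 := by
  refine (Du.shifts_cone K).comp (S := fun m n => n = m) (fun q s j φ => ?_) (by intros; omega)
  rw [LinearMap.sum_apply]
  exact Submodule.sum_mem _ fun i _ => Du.shifts_contr_pow K i q s j φ

end Contraction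

/-! ### Covering transformations -/

section Deck

variable {V : Type*} [PartialOrder V] (K : OrderedComplex V) {v₀ : V} (g : K.π₁ v₀)

theorem Du.deck_of {q : ℕ} (s : (K.cover v₀).Simplex q) (j : ℕ) (φ : Form q j) :
    Du.deck K g (Du.of _ s j φ) = Du.of _ (s.deck g) j φ := by
  rw [Du.deck, Du.lift_of]

/-- As for the other operators below, equivariance holds because the formula on a simplex involves
only its form and its faces, which a covering transformation respects. -/
theorem Du.deck_faceBoundary : Du.deck K g ∘ₗ Du.faceBoundary (K.cover v₀) =
    Du.faceBoundary (K.cover v₀) ∘ₗ Du.deck K g := Du.hom_ext _ fun q s j φ => by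
  rw [LinearMap.comp_apply, LinearMap.comp_apply, Du.deck_of]
  cases q with
  | zero => rw [Du.faceBoundary_of_zero, Du.faceBoundary_of_zero, map_zero]
  | succ q =>
    rw [Du.faceBoundary_of_succ, Du.faceBoundary_of_succ, map_sum]
    refine Finset.sum_congr rfl fun i _ => ?_
    rw [map_smul, Du.deck_of]
    rfl

theorem Du.deck_extBoundary : Du.deck K g ∘ₗ Du.extBoundary (K.cover v₀) =
    Du.extBoundary (K.cover v₀) ∘ₗ Du.deck K g := Du.hom_ext _ fun q s j φ => by
  rw [LinearMap.comp_apply, LinearMap.comp_apply, Du.deck_of, Du.extBoundary_of,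
    Du.extBoundary_of, map_smul, Du.deck_of]

theorem Du.deck_boundary : Du.deck K g ∘ₗ Du.boundary (K.cover v₀) =
    Du.boundary (K.cover v₀) ∘ₗ Du.deck K g := by
  rw [Du.boundary_eq, LinearMap.comp_add, LinearMap.add_comp, Du.deck_extBoundary,
    Du.deck_faceBoundary]

theorem Du.deck_cone : Du.deck K g ∘ₗ Du.cone (K.cover v₀) =
    Du.cone (K.cover v₀) ∘ₗ Du.deck K g := Du.hom_ext _ fun q s j φ => by
  rw [LinearMap.comp_apply, LinearMap.comp_apply, Du.deck_of]
  cases j with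
  | zero => rw [Du.cone_of_zero, Du.cone_of_zero, map_zero]
  | succ j => rw [Du.cone_of_succ, Du.cone_of_succ, map_smul, Du.deck_of]

theorem Du.deck_eval : Chain.deck K g ∘ₗ Du.eval (K.cover v₀) =
    Du.eval (K.cover v₀) ∘ₗ Du.deck K g := Du.hom_ext _ fun q s j φ => by
  rw [LinearMap.comp_apply, LinearMap.comp_apply, Du.deck_of]
  cases j with
  | zero =>
    rw [Du.eval_of_zero, Du.eval_of_zero, map_smul]
    congr 1
    exact Finsupp.mapDomain_single
  | succ j => rw [Du.eval_of_succ, Du.eval_of_succ, map_zero]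

theorem Du.deck_contr : Du.deck K g ∘ₗ Du.contr (K.cover v₀) =
    Du.contr (K.cover v₀) ∘ₗ Du.deck K g := by
  have h : Du.contr (K.cover v₀) = LinearMap.id - (Du.boundary (K.cover v₀) ∘ₗ
      Du.cone (K.cover v₀) + Du.cone (K.cover v₀) ∘ₗ Du.boundary (K.cover v₀)) := by
    rw [Du.boundary_cone, sub_sub_cancel]
  rw [h, LinearMap.comp_sub, LinearMap.sub_comp, LinearMap.comp_add, LinearMap.add_comp,
    ← LinearMap.comp_assoc, ← LinearMap.comp_assoc, Du.deck_boundary, Du.deck_cone,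
    LinearMap.comp_assoc, LinearMap.comp_assoc, Du.deck_boundary, Du.deck_cone]
  rfl

theorem Du.deck_contr_pow (m : ℕ) : Du.deck K g ∘ₗ (Du.contr (K.cover v₀) ^ m) =
    (Du.contr (K.cover v₀) ^ m) ∘ₗ Du.deck K g :=
  (Commute.pow_right (a := (Du.deck K g : Module.End ℝ (K.cover v₀).Du)) (Du.deck_contr K g) m)

theorem Du.deck_homotopy (m : ℕ) : Du.deck K g ∘ₗ Du.homotopy (K.cover v₀) m =
    Du.homotopy (K.cover v₀) m ∘ₗ Du.deck K g := by
  have hc : Du.deck K g ∘ₗ (∑ i ∈ Finset.range m, Du.contr (K.cover v₀) ^ i :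
      Module.End ℝ (K.cover v₀).Du) = (∑ i ∈ Finset.range m, Du.contr (K.cover v₀) ^ i :
      Module.End ℝ (K.cover v₀).Du) ∘ₗ Du.deck K g :=
    Commute.sum_right (b := (Du.deck K g : Module.End ℝ (K.cover v₀).Du)) _ _
      fun i _ => Du.deck_contr_pow K g i
  rw [Du.homotopy, LinearMap.comp_assoc, ← hc, ← LinearMap.comp_assoc, Du.deck_cone,
    LinearMap.comp_assoc]

theorem Du.deck_signedMul {k : ℕ} (φ : K.PLForm k) :
    Du.deck K g ∘ₗ Du.signedMul (K.cover v₀) k (PLForm.pullCover k φ) =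
      Du.signedMul (K.cover v₀) k (PLForm.pullCover k φ) ∘ₗ Du.deck K g :=
  Du.hom_ext _ fun q s j η => by
    rw [LinearMap.comp_apply, LinearMap.comp_apply, Du.deck_of, Du.signedMul_of, Du.signedMul_of,
      map_smul, Du.deck_of]
    rfl

theorem Du.deck_twist (t : K.OddForm) :
    Du.deck K g ∘ₗ K.twist v₀ t = K.twist v₀ t ∘ₗ Du.deck K g := by
  classical
  refine LinearMap.ext fun x => ?_
  rw [← DirectSum.sum_support_of t, map_sum]
  simp only [LinearMap.comp_apply, LinearMap.sum_apply, map_sum]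
  refine Finset.sum_congr rfl fun i _ => ?_
  rw [twist_of]
  exact LinearMap.congr_fun (Du.deck_signedMul K g _) x

theorem Du.shifts_twist (t : K.OddForm) :
    Du.Shifts (K.twist v₀ t) fun m n => n + 3 ≤ m ∧ Odd (m - n) := by
  classical
  intro q s j φ
  rw [← DirectSum.sum_support_of t, map_sum, LinearMap.sum_apply]
  refine Submodule.sum_mem _ fun i _ => ?_
  rw [twist_of, Du.signedMul_of]
  refine Submodule.smul_mem _ _ (Du.of_mem_supp ⟨?_, ?_⟩)
  · push_cast; omega
  · push_cast; exact ⟨i + 1, by ring⟩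

end Deck

end OrderedComplex

/-- More than `q` vectors in `ℝ^q` are dependent. Consequently currents have no negative degrees,
and natural numbers suffice to grade them. -/
theorem Form.eq_zero_of_lt {q j : ℕ} (h : q < j) (φ : Form q j) : φ = 0 :=
  Form.ext' fun x _ => by
    ext v
    refine (φ.1 x).toAlternatingMap.map_linearDependent v fun hv => ?_
    have := hv.fintype_card_le_finrank
    simp only [Fintype.card_fin, Module.finrank_fintype_fun_eq_card] at this
    omega

namespace OrderedComplex

/-! ### The retraction of currents onto simplicial chains. -/

section Contraction

variable {V : Type*} [PartialOrder V] (K : OrderedComplex V)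

theorem Simplex.le_dim [Finite V] {K : OrderedComplex V} {q : ℕ} (s : K.Simplex q) :
    q ≤ K.dim := by
  -- `dim` is a supremum of natural numbers, so a bound is required: a simplex has distinct vertices
  -- in the finite set `V`.
  refine le_csSup ⟨Nat.card V, ?_⟩ ⟨s⟩
  rintro m ⟨t⟩
  have := Nat.card_le_card_of_injective _ t.1.injective
  rw [Nat.card_eq_fintype_card, Fintype.card_fin] at this
  omega

theorem Du.mem_of_forall {K : OrderedComplex V} {W : Submodule ℝ K.Du}
    (h : ∀ q (s : K.Simplex q) j (φ : Form q j), Du.of K s j φ ∈ W) (x : K.Du) : x ∈ W := by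
  have h' : W.mkQ = 0 := Du.hom_ext K fun q s j φ => by
    rw [Submodule.mkQ_apply, (Submodule.Quotient.mk_eq_zero W).2 (h q s j φ)]
    rfl
  exact (Submodule.Quotient.mk_eq_zero W).1 (LinearMap.congr_fun h' x)

/-- The retraction `Du_•(K) → C_•(K)` onto simplicial chains, when all simplexes of `K` have
dimension less than `m`. -/
def Du.retract (m : ℕ) : K.Du →ₗ[ℝ] K.Chain := Du.eval K ∘ₗ (Du.contr K ^ m)

theorem Du.retract_psi (m : ℕ) : Du.retract K m ∘ₗ K.psi = LinearMap.id := by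
  refine LinearMap.ext fun c => ?_
  have hpsi : ∀ m : ℕ, (Du.contr K ^ m) (K.psi c) = K.psi c := by
    intro m
    induction m with
    | zero => rfl
    | succ m ih => rw [pow_succ, Module.End.mul_apply, Du.contr_psi, ih]
  rw [LinearMap.comp_apply, Du.retract, LinearMap.comp_apply, hpsi]
  exact LinearMap.congr_fun (Du.eval_psi K) c

variable {K} {m : ℕ} (hm : ∀ q, K.Simplex q → q < m)
include hm

theorem Du.psi_retract : K.psi ∘ₗ Du.retract K m = Du.contr K ^ m := by
  refine LinearMap.ext fun x => ?_
  obtain ⟨c, hc⟩ := Du.contr_pow_mem_range K m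
    (Du.mem_of_forall (W := Du.skel K m) (fun q s j φ => Du.of_mem_skel (hm q s)) x)
  have h : Du.eval K (K.psi c) = c := LinearMap.congr_fun (Du.eval_psi K) c
  rw [LinearMap.comp_apply, Du.retract, LinearMap.comp_apply, ← hc, h]

/-- After composition with the injective chain map `ψ` this says that the boundary commutes with
`contr ^ m`. -/
theorem Du.boundary_retract :
    Chain.boundary K ∘ₗ Du.retract K m = Du.retract K m ∘ₗ Du.boundary K := by
  refine LinearMap.ext fun x => ?_
  have hinj : Function.Injective K.psi :=
    Function.LeftInverse.injective (g := Du.eval K) fun c => LinearMap.congr_fun (Du.eval_psi K) c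
  have h : ∀ x, K.psi (Du.retract K m x) = (Du.contr K ^ m) x :=
    fun x => LinearMap.congr_fun (Du.psi_retract hm) x
  apply hinj
  rw [LinearMap.comp_apply, psi_boundary, h, LinearMap.comp_apply, h]
  exact LinearMap.congr_fun (Du.boundary_contr_pow K m) x

end Contraction

section Hom

variable {V : Type*} [PartialOrder V] {K : OrderedComplex V} {v₀ : V}
variable {𝕜 E : Type*} [RCLike 𝕜] [AddCommGroup E] [Module 𝕜 E] [Module ℝ E] [IsScalarTower ℝ 𝕜 E]
  {ρ : Representation 𝕜 (K.π₁ v₀) E}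

/-! ### `ψ^*` is a quasi-isomorphism -/

theorem apply_eq_zero_of_mem_supp {f : (K.cover v₀).Du →ₗ[ℝ] E} {P : ℤ → Prop}
    (h : ∀ q (s : (K.cover v₀).Simplex q) j (φ : Form q j), P ((q : ℤ) - j) →
      f (Du.of _ s j φ) = 0) {x : (K.cover v₀).Du} (hx : x ∈ Du.supp _ P) : f x = 0 := by
  have h' : Du.supp _ P ≤ LinearMap.ker f := Du.supp_le h
  exact h' hx

theorem currents_apply {ι : Type*} [AddGroupWithOne ι] {n : ι} {f : (K.cover v₀).Du →ₗ[ℝ] E}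
    (hf : f ∈ K.currents ρ ι n) {x : (K.cover v₀).Du}
    (hx : x ∈ Du.supp _ fun m => ((m : ℤ) : ι) ≠ n) : f x = 0 :=
  apply_eq_zero_of_mem_supp (fun q s j φ h => hf.2 q s j φ (by simpa using h)) hx

/-- The operator on `Du_•(K̃)` commutes with covering transformations. -/
def Du.Equivariant (A : (K.cover v₀).Du →ₗ[ℝ] (K.cover v₀).Du) : Prop :=
  ∀ g, Du.deck K g ∘ₗ A = A ∘ₗ Du.deck K g

omit [IsScalarTower ℝ 𝕜 E] in
theorem comp_deck {A : (K.cover v₀).Du →ₗ[ℝ] (K.cover v₀).Du} (hA : Du.Equivariant A)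
    {f : (K.cover v₀).Du →ₗ[ℝ] E} (hf : ∀ g c, f (Du.deck K g c) = ρ g (f c)) (g : K.π₁ v₀)
    (c : (K.cover v₀).Du) : (f ∘ₗ A) (Du.deck K g c) = ρ g ((f ∘ₗ A) c) := by
  have h := LinearMap.congr_fun (hA g) c
  rw [LinearMap.comp_apply, LinearMap.comp_apply] at h
  rw [LinearMap.comp_apply, ← h, hf, LinearMap.comp_apply]

theorem comp_mem_currents {ι : Type*} [AddGroupWithOne ι] {n n' : ι}
    {A : (K.cover v₀).Du →ₗ[ℝ] (K.cover v₀).Du} (hA : Du.Equivariant A) {R : ℤ → ℤ → Prop}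
    (hR : Du.Shifts A R) (h : ∀ l m : ℤ, R l m → (m : ι) = n → (l : ι) = n')
    {f : (K.cover v₀).Du →ₗ[ℝ] E} (hf : f ∈ K.currents ρ ι n) : f ∘ₗ A ∈ K.currents ρ ι n' := by
  refine ⟨comp_deck hA hf.1, fun q s j φ hq => ?_⟩
  rw [LinearMap.comp_apply]
  refine currents_apply hf ?_
  refine Du.supp_mono ?_ (hR q s j φ)
  intro m hm hmn
  refine hq ?_
  have := h _ m hm hmn
  rwa [Int.cast_sub, Int.cast_natCast, Int.cast_natCast] at this

theorem comp_retract_mem {n : ℤ} (m : ℕ) {g : (K.cover v₀).Chain →ₗ[ℝ] E}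
    (hg : g ∈ K.cochains ρ ℤ n) :
    g ∘ₗ Du.retract (K.cover v₀) m ∈ K.currents ρ ℤ n := by
  have he : g ∘ₗ Du.eval (K.cover v₀) ∈ K.currents ρ ℤ n := by
    refine ⟨fun γ c => ?_, fun q s j φ h => ?_⟩
    · have h := LinearMap.congr_fun (Du.deck_eval K γ) c
      rw [LinearMap.comp_apply, LinearMap.comp_apply] at h
      rw [LinearMap.comp_apply, ← h, hg.1, LinearMap.comp_apply]
    · rw [LinearMap.comp_apply]
      cases j with
      | zero => rw [Du.eval_of_zero, map_smul, hg.2 q s (by simpa using h), smul_zero]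
      | succ j => rw [Du.eval_of_succ, map_zero]
  exact comp_mem_currents (fun γ => Du.deck_contr_pow K γ m) (Du.shifts_contr_pow _ m)
    (fun l m h hm => by simp only [Int.cast_id] at *; omega) he

theorem HPsi_mk (n : ℤ) (z : Cocycles (K.currents ρ ℤ) (K.dCurrents v₀ 𝕜 E) n) :
    ∃ hz : K.psiStar v₀ 𝕜 E z.1 ∈ Cocycles (K.cochains ρ ℤ) (K.dCochains v₀ 𝕜 E) n,
      K.HPsi ρ n (Coh.mk _ _ n z) = Coh.mk _ _ n ⟨K.psiStar v₀ 𝕜 E z.1, hz⟩ :=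
  ⟨_, rfl⟩

theorem Coh.mk_eq_zero {𝕜 ι M : Type*} [Field 𝕜] [AddGroupWithOne ι] [AddCommGroup M] [Module 𝕜 M]
    {G : ι → Submodule 𝕜 M} {d : M →ₗ[𝕜] M} {n : ι} {z : Cocycles G d n} :
    Coh.mk G d n z = 0 ↔ ∃ y ∈ G (n - 1), d y = z.1 :=
  Submodule.Quotient.mk_eq_zero _

theorem Coh.mk_surjective {𝕜 ι M : Type*} [Field 𝕜] [AddGroupWithOne ι] [AddCommGroup M]
    [Module 𝕜 M] (G : ι → Submodule 𝕜 M) (d : M →ₗ[𝕜] M) (n : ι) :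
    Function.Surjective (Coh.mk G d n) :=
  Submodule.mkQ_surjective _

/-- Composition with `Du.retract` is inverse to `ψ^*` in cohomology: on chains the composite is the
identity, and on currents it is homotopic to the identity by `Du.homotopy`. -/
theorem HPsi_bijective [Finite V] (n : ℤ) : Function.Bijective (K.HPsi ρ n) := by
  -- The projection to `K` preserves the dimension of simplexes, so the covering has no simplex
  -- above `dim K`, and the exponent `dim K + 1` suffices.
  have hm : ∀ q, (K.cover v₀).Simplex q → q < K.dim + 1 := fun q s =>
    Nat.lt_succ_of_le s.proj.le_dim
  have hpr := Du.psi_retract hm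
  have hbr := Du.boundary_retract hm
  have hrp := Du.retract_psi (K.cover v₀) (K.dim + 1)
  have hh := Du.boundary_homotopy (K.cover v₀) (K.dim + 1)
  constructor
  · rw [injective_iff_map_eq_zero]
    intro γ hγ
    obtain ⟨z, rfl⟩ := Coh.mk_surjective _ _ _ γ
    obtain ⟨hz, he⟩ := HPsi_mk n z
    rw [he, Coh.mk_eq_zero] at hγ
    obtain ⟨g, hg, hgz⟩ := hγ
    have hz0 : z.1 ∘ₗ Du.boundary (K.cover v₀) = 0 := z.2.2
    have hgz' : g ∘ₗ Chain.boundary (K.cover v₀) = z.1 ∘ₗ (K.cover v₀).psi := hgz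
    -- As `z` is closed, the first summand has coboundary `z - z ∘ contr ^ m`; the second has
    -- coboundary `z ∘ ψ ∘ retract = z ∘ contr ^ m`, because `g` bounds `z ∘ ψ`.
    refine Coh.mk_eq_zero.2 ⟨z.1 ∘ₗ Du.homotopy _ (K.dim + 1) + g ∘ₗ Du.retract _ (K.dim + 1),
      Submodule.add_mem _ ?_ (comp_retract_mem _ hg), ?_⟩
    · exact comp_mem_currents (fun γ => Du.deck_homotopy K γ _) (Du.shifts_homotopy _ _)
        (fun l m h hm => by simp only [Int.cast_id] at *; omega) z.2.1
    · change (z.1 ∘ₗ Du.homotopy _ (K.dim + 1) + g ∘ₗ Du.retract _ (K.dim + 1)) ∘ₗ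
        Du.boundary (K.cover v₀) = z.1
      rw [LinearMap.add_comp, LinearMap.comp_assoc, LinearMap.comp_assoc, ← hbr,
        ← LinearMap.comp_assoc (Du.retract _ (K.dim + 1)) _ g, hgz', LinearMap.comp_assoc, hpr, ← LinearMap.comp_add]
      have h1 : Du.homotopy (K.cover v₀) (K.dim + 1) ∘ₗ Du.boundary (K.cover v₀) =
          LinearMap.id - Du.contr (K.cover v₀) ^ (K.dim + 1) -
            Du.boundary (K.cover v₀) ∘ₗ Du.homotopy (K.cover v₀) (K.dim + 1) := by
        rw [← hh, add_sub_cancel_left]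
      rw [h1, sub_right_comm, sub_add_cancel, LinearMap.comp_sub, ← LinearMap.comp_assoc, hz0,
        LinearMap.zero_comp, sub_zero, LinearMap.comp_id]
  · intro γ
    obtain ⟨g, rfl⟩ := Coh.mk_surjective _ _ _ γ
    have hg0 : g.1 ∘ₗ Chain.boundary (K.cover v₀) = 0 := g.2.2
    have hz : g.1 ∘ₗ Du.retract _ (K.dim + 1) ∈
        Cocycles (K.currents ρ ℤ) (K.dCurrents v₀ 𝕜 E) n := by
      refine ⟨comp_retract_mem _ g.2.1, ?_⟩
      change (g.1 ∘ₗ Du.retract _ (K.dim + 1)) ∘ₗ Du.boundary (K.cover v₀) = 0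
      rw [LinearMap.comp_assoc, ← hbr, ← LinearMap.comp_assoc, hg0, LinearMap.zero_comp]
    refine ⟨Coh.mk _ _ n ⟨_, hz⟩, ?_⟩
    obtain ⟨hz', he⟩ := HPsi_mk n ⟨_, hz⟩
    rw [he]
    congr 1
    refine Subtype.ext ?_
    change (g.1 ∘ₗ Du.retract _ (K.dim + 1)) ∘ₗ (K.cover v₀).psi = g.1
    rw [LinearMap.comp_assoc, hrp, LinearMap.comp_id]

end Hom
end OrderedComplex

/-! ### Finite dimensional filtered complexes -/

section Adapted

variable {𝕜 U J : Type*} [Field 𝕜] [AddCommGroup U] [Module 𝕜 U] [LinearOrder J] [Nonempty J]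

/-- Given a finite family of subsets `S j`, linearly independent vectors can be chosen from them such
that, for all `j`, the vectors chosen from the `S l`, `j ≤ l`, have the same span as these sets. -/
theorem exists_adapted (S : J → Set U) (s : Finset J) :
    ∃ (B : Set U) (lev : U → J), LinearIndepOn 𝕜 id B ∧
      (∀ b ∈ B, lev b ∈ s ∧ b ∈ S (lev b)) ∧
      ∀ j ∈ s, S j ⊆ Submodule.span 𝕜 {b ∈ B | j ≤ lev b} := by
  classical
  -- The largest indices are treated first. A new smallest index `a` only adds vectors of `S a`,
  -- which receive the level `a`, so the spans for the larger indices are kept.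
  induction s using Finset.induction_on_min with
  | empty => exact ⟨∅, fun _ => Classical.arbitrary J, by simp, by simp, by simp⟩
  | insert a s ha ih =>
    obtain ⟨B, lev, hB, hlev, hS⟩ := ih
    obtain ⟨B', hB't, hBB', hspan, hli⟩ :=
      exists_linearIndepOn_id_extension hB (Set.subset_union_left (t := S a))
    refine ⟨B', fun b => if b ∈ B then lev b else a, hli, fun b hb => ?_, fun j hj => ?_⟩
    · by_cases hbB : b ∈ B
      · simp only [hbB, if_true]
        exact ⟨Finset.mem_insert_of_mem (hlev b hbB).1, (hlev b hbB).2⟩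
      · simp only [hbB, if_false]
        exact ⟨Finset.mem_insert_self _ _, (hB't hb).resolve_left hbB⟩
    · rcases Finset.mem_insert.1 hj with rfl | hj
      · intro y hy
        refine Submodule.span_mono ?_ (hspan (Or.inr hy))
        intro b hb
        refine ⟨hb, ?_⟩
        by_cases hbB : b ∈ B
        · simpa only [hbB, if_true] using (ha _ (hlev b hbB).1).le
        · simp only [hbB, if_false, le_refl]
      · intro y hy
        refine Submodule.span_mono ?_ (hS j hj hy)
        intro b hb
        refine ⟨hBB' hb.1, ?_⟩
        simpa only [hb.1, if_true] using hb.2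

end Adapted

theorem mem_span_sep_of_imp {𝕜 U : Type*} [Field 𝕜] [AddCommGroup U] [Module 𝕜 U]
    {B : Set U} {P Q : U → Prop} (h : ∀ b ∈ B, P b → Q b) {y : U}
    (hy : y ∈ Submodule.span 𝕜 {b ∈ B | P b}) : y ∈ Submodule.span 𝕜 {b ∈ B | Q b} := by
  have hs : {b ∈ B | P b} ⊆ {b ∈ B | Q b} := fun b hb => ⟨hb.1, h b hb.1 hb.2⟩
  exact Submodule.span_mono hs hy

/-- A nondecreasing list is determined by the multiplicities of its entries. -/
theorem eq_of_monotone_of_card {L : Type*} [LinearOrder L] {n m : ℕ} {f : Fin n → L}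
    {g : Fin m → L} (hf : Monotone f) (hg : Monotone g)
    (h : ∀ l, Fintype.card {a // f a = l} = Fintype.card {a // g a = l}) :
    (⟨n, f⟩ : Σ n, Fin n → L) = ⟨m, g⟩ := by
  rw [← List.ofFn_inj']
  refine List.Perm.eq_of_sortedLE hf.sortedLE_ofFn hg.sortedLE_ofFn ?_
  have hc : ∀ {n : ℕ} (f : Fin n → L) (l : L),
      (List.ofFn f).count l = Fintype.card {a // f a = l} := by
    intro n f l
    rw [Fintype.card_subtype, ← Multiset.coe_count, ← Fin.univ_val_map, Multiset.count_map]
    rw [Finset.card_def, Finset.filter_val]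
    simp only [eq_comm]
  rw [List.perm_iff_count]
  intro l
  rw [hc, hc, h]

/-- A vector space `W` with a decreasing filtration `W = F 0 ⊇ ⋯ ⊇ F (N + 1) = 0`, a compatible
`ℤ/2`-grading, and an odd operator `D` with `D² = 0`. The quotients `F i / F (i + 1)` are identified
with spaces `V i`, and they are homogeneous of parity `i`. -/
structure FilteredComplex (𝕜 : Type*) [Field 𝕜] (N : ℕ) (W : Type*) [AddCommGroup W] [Module 𝕜 W]
    (V : Fin (N + 1) → Type*) [∀ i, AddCommGroup (V i)] [∀ i, Module 𝕜 (V i)] where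
  /-- The filtration. -/
  F : ℕ → Submodule 𝕜 W
  /-- The even and the odd part. -/
  par : ZMod 2 → Submodule 𝕜 W
  /-- The differential. -/
  D : W →ₗ[𝕜] W
  /-- The leading term of elements of `F i`. -/
  lead : ∀ i, W →ₗ[𝕜] V i
  D_D : ∀ x, D (D x) = 0
  F_zero : F 0 = ⊤
  F_last : F (N + 1) = ⊥
  F_anti : Antitone F
  lead_eq_zero : ∀ (i : Fin (N + 1)), ∀ x ∈ F i, lead i x = 0 ↔ x ∈ F (i + 1)
  lead_surjective : ∀ (i : Fin (N + 1)) v, ∃ x ∈ F i, lead i x = v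
  split : ∀ i (e : ZMod 2), ∀ x ∈ F i,
    ∃ y ∈ F i ⊓ par e, ∃ z ∈ F i ⊓ par (e + 1), x = y + z
  disjoint : ∀ e, Disjoint (par e) (par (e + 1))
  F_par : ∀ (i : Fin (N + 1)) (e : ZMod 2), ((i : ℕ) : ZMod 2) ≠ e → F i ⊓ par e ≤ F (i + 1)
  D_par : ∀ e, ∀ x ∈ par e, D x ∈ par (e + 1)

namespace FilteredComplex

universe u

variable {𝕜 : Type*} [Field 𝕜] {N : ℕ} {W : Type u} [AddCommGroup W] [Module 𝕜 W]
  {V : Fin (N + 1) → Type*} [∀ i, AddCommGroup (V i)] [∀ i, Module 𝕜 (V i)]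
  (X : FilteredComplex 𝕜 N W V)

include X in
theorem finiteDimensional (hV : ∀ i, FiniteDimensional 𝕜 (V i)) : FiniteDimensional 𝕜 W := by
  have h : ∀ n ≤ N + 1, (X.F (N + 1 - n)).FG := by
    intro n hn
    induction n with
    | zero => rw [Nat.sub_zero, X.F_last]; exact Submodule.fg_bot
    | succ n ih =>
      let i : Fin (N + 1) := ⟨N - n, by omega⟩
      have e1 : N + 1 - (n + 1) = (i : ℕ) := by simp only [i]; omega
      have e2 : N + 1 - n = (i : ℕ) + 1 := by simp only [i]; omega
      rw [e1]
      refine Submodule.fg_of_fg_map_of_fg_inf_ker (X.lead i) (IsNoetherian.noetherian _) ?_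
      have : X.F i ⊓ LinearMap.ker (X.lead i) = X.F (i + 1) := by
        refine le_antisymm (fun x hx => (X.lead_eq_zero i x hx.1).1 hx.2) fun x hx => ?_
        have hx' := X.F_anti (Nat.le_succ _) hx
        exact ⟨hx', (X.lead_eq_zero i x hx').2 hx⟩
      rw [this, ← e2]
      exact ih (by omega)
  have := h (N + 1) le_rfl
  rw [Nat.sub_self, X.F_zero] at this
  exact ⟨this⟩

section Families

variable {A C : Type*}

/-- The combined family of the targets, the survivors and the sources. -/
def family (x : A → W) (h : C → W) : A ⊕ (C ⊕ A) → W :=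
  Sum.elim (fun a => X.D (x a)) (Sum.elim h x)

/-- The degrees of the members of the combined family. -/
def level {L : Type*} (src tgt : A → L) (deg : C → L) : A ⊕ (C ⊕ A) → L :=
  Sum.elim tgt (Sum.elim deg src)

/-- A basis of `W` which is adapted to the filtration and in which `D` has normal form: it consists of
pairs `x a`, `D (x a)` and of elements `h c` with `D (h c) = 0`. -/
structure NormalForm (src tgt : A → Fin (N + 1)) (deg : C → Fin (N + 1)) where
  /-- The sources. -/
  x : A → W
  /-- The survivors. -/
  h : C → W
  x_mem : ∀ a, x a ∈ X.F (src a) ⊓ X.par (src a : ℕ)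
  D_mem : ∀ a, X.D (x a) ∈ X.F (tgt a)
  h_mem : ∀ c, h c ∈ X.F (deg c) ⊓ X.par (deg c : ℕ)
  h_closed : ∀ c, X.D (h c) = 0
  linearIndependent : LinearIndependent 𝕜 (X.family x h)
  le_span : ∀ i, X.F i ≤
    Submodule.span 𝕜 (X.family x h '' {k | i ≤ ((level src tgt deg k : Fin (N + 1)) : ℕ)})


variable {X} {src tgt : A → Fin (N + 1)} {deg : C → Fin (N + 1)}

/-- In a relation, applying `D` isolates the sources, reduction modulo the image of `D` isolates the
survivors, and then the targets are left. -/
theorem linearIndependent_family [Fintype A] [Fintype C] {x : A → W} {h : C → W}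
    (hx : LinearIndependent 𝕜 fun a => X.D (x a)) (hh : ∀ c, X.D (h c) = 0)
    (hli : LinearIndependent 𝕜 fun c => (LinearMap.range X.D).mkQ (h c)) :
    LinearIndependent 𝕜 (X.family x h) := by
  rw [Fintype.linearIndependent_iff] at *
  intro g hg
  simp only [Fintype.sum_sum_type, family, Sum.elim_inl, Sum.elim_inr] at hg
  have h1 : ∀ a, g (Sum.inr (Sum.inr a)) = 0 := by
    refine hx (fun a => g (Sum.inr (Sum.inr a))) ?_
    have := congrArg X.D hg
    simpa only [map_add, map_sum, map_smul, X.D_D, hh, smul_zero, Finset.sum_const_zero, zero_add,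
      map_zero] using this
  simp only [h1, zero_smul, Finset.sum_const_zero, add_zero] at hg
  have h2 : ∀ c, g (Sum.inr (Sum.inl c)) = 0 := by
    refine hli (fun c => g (Sum.inr (Sum.inl c))) ?_
    have := congrArg (LinearMap.range X.D).mkQ hg
    have h3 : ∀ x, (LinearMap.range X.D).mkQ (X.D x) = 0 := fun x =>
      (Submodule.Quotient.mk_eq_zero _).2 (LinearMap.mem_range_self _ _)
    simpa only [map_add, map_sum, map_smul, h3, smul_zero, Finset.sum_const_zero, zero_add,
      map_zero] using this
  simp only [h2, zero_smul, Finset.sum_const_zero, add_zero] at hg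
  have h3 := hx _ hg
  rintro (a | c | a)
  exacts [h3 a, h2 c, h1 a]

/-- Renumbering of the members of a normal form. -/
def NormalForm.reindex (Y : X.NormalForm src tgt deg) {A' C' : Type*} (e : A' ≃ A) (f : C' ≃ C) :
    X.NormalForm (src ∘ e) (tgt ∘ e) (deg ∘ f) where
  x := Y.x ∘ e
  h := Y.h ∘ f
  x_mem a := Y.x_mem (e a)
  D_mem a := Y.D_mem (e a)
  h_mem c := Y.h_mem (f c)
  h_closed c := Y.h_closed (f c)
  linearIndependent := by
    have := Y.linearIndependent.comp _ (Equiv.sumCongr e (Equiv.sumCongr f e)).injective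
    convert this using 1
    ext (a | c | a) <;> rfl
  le_span i := by
    refine (Y.le_span i).trans (Submodule.span_mono ?_)
    rintro _ ⟨a | c | a, hk, rfl⟩
    · exact ⟨Sum.inl (e.symm a), by simpa [level] using hk, by simp [family]⟩
    · exact ⟨Sum.inr (Sum.inl (f.symm c)), by simpa [level] using hk, by simp [family]⟩
    · exact ⟨Sum.inr (Sum.inr (e.symm a)), by simpa [level] using hk, by simp [family]⟩

theorem exists_equiv_monotone {L : Type*} [LinearOrder L] [Finite A] (f : A → L) :
    ∃ (n : ℕ) (e : Fin n ≃ A), Monotone (f ∘ e) := by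
  obtain ⟨n, ⟨e⟩⟩ := Finite.exists_equiv_fin A
  exact ⟨n, (Tuple.sort (f ∘ e.symm)).trans e.symm, Tuple.monotone_sort (f ∘ e.symm)⟩

end Families


/-! ### Existence of normal forms -/

section Existence

variable {X}

theorem eq_zero_of_lt {i : ℕ} (hi : N < i) {x : W} (hx : x ∈ X.F i) : x = 0 := by
  have := X.F_anti (Nat.succ_le_of_lt hi) hx
  rwa [Nat.succ_eq_add_one, X.F_last, Submodule.mem_bot] at this

/-- Descending induction on the filtration. -/
theorem descending {P : ℕ → W → Prop} (zero : ∀ i, N < i → P i 0)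
    (step : ∀ i : Fin (N + 1), (∀ x ∈ X.F (i + 1), P (i + 1) x) → ∀ x ∈ X.F i, P i x) :
    ∀ i, ∀ x ∈ X.F i, P i x := by
  have h : ∀ n i, N + 1 ≤ i + n → ∀ x ∈ X.F i, P i x := by
    intro n
    induction n with
    | zero =>
      intro i hi x hx
      rw [eq_zero_of_lt hi hx]
      exact zero i hi
    | succ n ih =>
      intro i hi x hx
      rcases Nat.lt_or_ge N i with h | h
      · rw [eq_zero_of_lt h hx]
        exact zero i h
      · exact step ⟨i, by omega⟩ (ih (i + 1) (by omega)) x hx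
  exact fun i => h (N + 1) i (by omega)

/-- The homogeneous splitting at a step of the filtration. -/
theorem exists_split (i : Fin (N + 1)) {x : W} (hx : x ∈ X.F i) :
    ∃ y ∈ X.F i ⊓ X.par (i : ℕ), ∃ z ∈ X.F (i + 1) ⊓ X.par ((i : ℕ) + 1), x = y + z := by
  obtain ⟨y, hy, z, hz, rfl⟩ := X.split i (i : ℕ) x hx
  exact ⟨y, hy, z, ⟨X.F_par i _ (by simp) hz, hz.2⟩, rfl⟩

theorem eq_of_add_eq {e : ZMod 2} {y y' z z' : W} (hy : y ∈ X.par e) (hy' : y' ∈ X.par e)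
    (hz : z ∈ X.par (e + 1)) (hz' : z' ∈ X.par (e + 1)) (h : y + z = y' + z') :
    y = y' ∧ z = z' := by
  have h1 : y - y' = z' - z := by
    rw [sub_eq_sub_iff_add_eq_add, h, add_comm]
  have h2 : y - y' = 0 := Submodule.disjoint_def.1 (X.disjoint e) _ (Submodule.sub_mem _ hy hy')
    (h1 ▸ Submodule.sub_mem _ hz' hz)
  exact ⟨sub_eq_zero.1 h2, (sub_eq_zero.1 (h1 ▸ h2)).symm⟩

/-- The pairs are chosen so that their differentials are adapted at once to the filtration of the
image of `D` by the `D (F i)` and to the one induced by the `F j`; this is the statement of the last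
two clauses. The choice is made in lexicographic order, with large source degrees first. -/
theorem exists_pairs [FiniteDimensional 𝕜 W] :
    ∃ (A : Type u) (_ : Finite A) (src tgt : A → Fin (N + 1)) (x : A → W),
      (∀ a, x a ∈ X.F (src a) ⊓ X.par (src a : ℕ)) ∧ (∀ a, X.D (x a) ∈ X.F (tgt a)) ∧
      LinearIndependent 𝕜 (fun a => X.D (x a)) ∧
      (∀ i : ℕ, ∀ w ∈ X.F i,
        X.D w ∈ Submodule.span 𝕜 ((fun a => X.D (x a)) '' {a | i ≤ (src a : ℕ)})) ∧
      ∀ (j : ℕ) w, X.D w ∈ X.F j →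
        X.D w ∈ Submodule.span 𝕜 ((fun a => X.D (x a)) '' {a | j ≤ (tgt a : ℕ)}) := by
  classical
  -- Only sources of the parity of their degree are admitted, so that the chosen `x` are
  -- homogeneous; general elements are reached by splitting off their part of the wrong parity,
  -- which lies deeper in the filtration.
  let S : Fin (N + 1) ×ₗ Fin (N + 1) → Set W := fun p =>
    {y | y ∈ X.F (ofLex p).2 ∧ ∃ x ∈ X.F (ofLex p).1 ⊓ X.par ((ofLex p).1 : ℕ), X.D x = y}
  obtain ⟨B, lev, hB, hlev, hS⟩ := exists_adapted (𝕜 := 𝕜) S Finset.univ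
  have hS' : ∀ (i j : Fin (N + 1)), ∀ x ∈ X.F i ⊓ X.par (i : ℕ), X.D x ∈ X.F j →
      X.D x ∈ Submodule.span 𝕜 {b ∈ B | toLex (i, j) ≤ lev b} := fun i j x hx hj =>
    hS (toLex (i, j)) (Finset.mem_univ _) ⟨hj, x, hx, rfl⟩
  choose x hx hxD using fun b : B => (hlev b.1 b.2).2.2
  have himg : ∀ P : W → Prop, (fun b : B => X.D (x b)) '' {b | P b.1} = {b ∈ B | P b} := by
    intro P
    ext b
    constructor
    · rintro ⟨a, ha, rfl⟩
      simp only [hxD]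
      exact ⟨a.2, ha⟩
    · rintro ⟨hb, hP⟩
      exact ⟨⟨b, hb⟩, hP, hxD _⟩
  refine ⟨B, hB.linearIndependent.finite, fun b => (ofLex (lev b)).1, fun b => (ofLex (lev b)).2, x,
    hx, fun b => ?_, ?_, ?_, ?_⟩
  · rw [hxD]; exact (hlev b.1 b.2).2.1
  · simp only [hxD]; exact hB.linearIndependent
  · intro i w hw
    rw [himg fun b => i ≤ ((ofLex (lev b)).1 : ℕ)]
    revert w
    refine fun w hw => descending (P := fun i w => X.D w ∈
      Submodule.span 𝕜 {b ∈ B | i ≤ ((ofLex (lev b)).1 : ℕ)}) (fun i _ => ?_) (fun i ih w hw => ?_)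
      i w hw
    · rw [map_zero]; exact Submodule.zero_mem _
    · obtain ⟨y, hy, z, hz, rfl⟩ := exists_split i hw
      rw [map_add]
      -- With target degree `0` the condition on `D y` is void, and only the source degree is
      -- controlled.
      refine Submodule.add_mem _ (mem_span_sep_of_imp (fun b _ hb => ?_)
        (hS' i 0 y hy (by rw [Fin.val_zero, X.F_zero]; trivial)))
        (mem_span_sep_of_imp (fun b _ hb => ?_) (ih z hz.1))
      · have := (Prod.Lex.le_iff.1 hb)
        rcases this with h | h
        · exact (Fin.lt_def.1 h).le
        · exact (congrArg Fin.val h.1).le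
      · exact (Nat.le_succ _).trans hb
  · intro j w hw
    rw [himg fun b => j ≤ ((ofLex (lev b)).2 : ℕ)]
    rcases Nat.lt_or_ge N j with hj | hj
    · rw [eq_zero_of_lt hj hw]; exact Submodule.zero_mem _
    refine descending (P := fun _ w => X.D w ∈ X.F j → X.D w ∈
      Submodule.span 𝕜 {b ∈ B | j ≤ ((ofLex (lev b)).2 : ℕ)}) (fun i _ _ => ?_)
      (fun i ih w _ hw => ?_) 0 w (by rw [X.F_zero]; trivial) hw
    · rw [map_zero]; exact Submodule.zero_mem _
    · rename_i hwi
      obtain ⟨y, hy, z, hz, rfl⟩ := exists_split i hwi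
      obtain ⟨u, hu, v, hv, huv⟩ := X.split j ((i : ℕ) + 1) _ hw
      rw [map_add] at huv
      obtain ⟨rfl, rfl⟩ := eq_of_add_eq (X.D_par _ _ hy.2) hu.2 (X.D_par _ _ hz.2) hv.2 huv
      rw [map_add]
      refine Submodule.add_mem _ ?_ (ih z hz.1 hv.1)
      have h1 := hS' i ⟨j, by omega⟩ y hy hu.1
      -- A lexicographically larger index has either the same source degree and a target degree at
      -- least `j`, or a larger source degree. The part `p` of the first kind lies in `F j`; the
      -- rest is then the differential of an element of `F (i + 1)` and lies in `F j` as well, so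
      -- the induction hypothesis applies to it.
      have h2 : {b ∈ B | toLex (i, (⟨j, by omega⟩ : Fin (N + 1))) ≤ lev b} ⊆
          {b ∈ B | (ofLex (lev b)).1 = i ∧ j ≤ ((ofLex (lev b)).2 : ℕ)} ∪
            {b ∈ B | i < (ofLex (lev b)).1} := by
        rintro b ⟨hb, hb'⟩
        rcases Prod.Lex.le_iff.1 hb' with h | h
        · exact Or.inr ⟨hb, h⟩
        · exact Or.inl ⟨hb, h.1.symm, h.2⟩
      have h3 := Submodule.span_mono h2 h1
      rw [Submodule.span_union] at h3
      obtain ⟨p, hp, r, hr, hpr⟩ := Submodule.mem_sup.1 h3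
      have hpF : p ∈ X.F j := by
        refine Submodule.span_le.2 ?_ hp
        rintro b ⟨hb, -, hb'⟩
        exact X.F_anti hb' (hlev b hb).2.1
      have hrD : r ∈ (X.F (i + 1)).map X.D := by
        refine Submodule.span_le.2 ?_ hr
        rintro b ⟨hb, hb'⟩
        exact ⟨x ⟨b, hb⟩, X.F_anti (Nat.succ_le_of_lt (Fin.lt_def.1 hb')) (hx ⟨b, hb⟩).1,
          hxD ⟨b, hb⟩⟩
      obtain ⟨w, hw, rfl⟩ := hrD
      rw [← hpr]
      refine Submodule.add_mem _ (mem_span_sep_of_imp (fun b _ hb => hb.2) hp) (ih w hw ?_)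
      have : X.D w = X.D y - p := by rw [← hpr, add_sub_cancel_left]
      rw [this]
      exact Submodule.sub_mem _ hu.1 hpF

/-- The same selection in the quotient by the image of `D`, for the classes of closed homogeneous
elements of each `F i`. -/
theorem exists_survivors [FiniteDimensional 𝕜 W] :
    ∃ (C : Type u) (_ : Finite C) (deg : C → Fin (N + 1)) (h : C → W),
      (∀ c, h c ∈ X.F (deg c) ⊓ X.par (deg c : ℕ)) ∧ (∀ c, X.D (h c) = 0) ∧
      LinearIndependent 𝕜 (fun c => (LinearMap.range X.D).mkQ (h c)) ∧
      ∀ i : ℕ, ∀ w ∈ X.F i, X.D w = 0 → (LinearMap.range X.D).mkQ w ∈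
        Submodule.span 𝕜 ((fun c => (LinearMap.range X.D).mkQ (h c)) '' {c | i ≤ (deg c : ℕ)}) := by
  classical
  let S : Fin (N + 1) → Set (W ⧸ LinearMap.range X.D) := fun i =>
    {y | ∃ z ∈ X.F i ⊓ X.par (i : ℕ), X.D z = 0 ∧ (LinearMap.range X.D).mkQ z = y}
  obtain ⟨B, lev, hB, hlev, hS⟩ := exists_adapted (𝕜 := 𝕜) S Finset.univ
  choose h hh hh0 hhq using fun b : B => (hlev b.1 b.2).2
  have himg : ∀ P : W ⧸ LinearMap.range X.D → Prop,
      (fun b : B => (LinearMap.range X.D).mkQ (h b)) '' {b | P b.1} = {b ∈ B | P b} := by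
    intro P
    ext b
    constructor
    · rintro ⟨a, ha, rfl⟩
      simp only [hhq]
      exact ⟨a.2, ha⟩
    · rintro ⟨hb, hP⟩
      exact ⟨⟨b, hb⟩, hP, hhq _⟩
  refine ⟨B, hB.linearIndependent.finite, fun b => lev b, h, hh, hh0, ?_, ?_⟩
  · simp only [hhq]; exact hB.linearIndependent
  · intro i w hw hw0
    rw [himg fun b => i ≤ (lev b : ℕ)]
    refine descending (P := fun i w => X.D w = 0 → (LinearMap.range X.D).mkQ w ∈
      Submodule.span 𝕜 {b ∈ B | i ≤ (lev b : ℕ)}) (fun i _ _ => ?_) (fun i ih w hw hw0 => ?_)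
      i w hw hw0
    · rw [map_zero]; exact Submodule.zero_mem _
    · obtain ⟨y, hy, z, hz, rfl⟩ := exists_split i hw
      -- The two differentials have opposite parities, so each of them vanishes.
      have h0 : X.D y + X.D z = 0 + 0 := by rw [← map_add, hw0, add_zero]
      obtain ⟨hy0, hz0⟩ := eq_of_add_eq (X.D_par _ _ hy.2) (Submodule.zero_mem _)
        (X.D_par _ _ hz.2) (Submodule.zero_mem _) h0
      rw [map_add]
      exact Submodule.add_mem _ (hS i (Finset.mem_univ _) ⟨y, hy, hy0, rfl⟩)
        (mem_span_sep_of_imp (fun b _ hb => (Nat.le_succ _).trans hb) (ih z hz.1 hz0))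

/-- An element of `F i` is reduced in three stages inside `F i`: sources are subtracted until it is
closed, survivors until it is a boundary, and the boundary is a combination of targets. -/
theorem exists_normalForm [FiniteDimensional 𝕜 W] :
    ∃ (n m : ℕ) (src tgt : Fin n → Fin (N + 1)) (deg : Fin m → Fin (N + 1)),
      Monotone (fun a => toLex (src a, tgt a)) ∧ Monotone deg ∧
      Nonempty (X.NormalForm src tgt deg) := by
  obtain ⟨A, _, src, tgt, x, hx, hD, hli, hsrc, htgt⟩ := X.exists_pairs
  obtain ⟨C, _, deg, h, hh, hh0, hhli, hspan⟩ := X.exists_survivors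
  have := Fintype.ofFinite A
  have := Fintype.ofFinite C
  have hle : ∀ i, X.F i ≤
      Submodule.span 𝕜 (X.family x h '' {k | i ≤ ((level src tgt deg k : Fin (N + 1)) : ℕ)}) := by
    intro i w hw
    -- This yields a combination `u` of sources in `F i` with the same differential as `w`, so that
    -- `w - u` is closed.
    have h1 := hsrc i w hw
    rw [← Function.comp_def X.D x, Set.image_comp, ← Submodule.map_span] at h1
    obtain ⟨u, hu, huw⟩ := h1
    have huF : u ∈ X.F i := by
      refine Submodule.span_le.2 ?_ hu
      rintro _ ⟨a, ha, rfl⟩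
      exact X.F_anti ha (hx a).1
    have h2 := hspan i (w - u) (Submodule.sub_mem _ hw huF) (by rw [map_sub, huw, sub_self])
    rw [← Function.comp_def (LinearMap.range X.D).mkQ h, Set.image_comp, ← Submodule.map_span] at h2
    obtain ⟨v, hv, hvw⟩ := h2
    have hvF : v ∈ X.F i := by
      refine Submodule.span_le.2 ?_ hv
      rintro _ ⟨c, hc, rfl⟩
      exact X.F_anti hc (hh c).1
    obtain ⟨y, hy⟩ := (Submodule.Quotient.eq _).1 hvw.symm
    have h3 := htgt i y (by
      rw [hy]; exact Submodule.sub_mem _ (Submodule.sub_mem _ hw huF) hvF)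
    have hw' : w = X.D y + v + u := by rw [hy]; abel
    rw [hw']
    refine Submodule.add_mem _ (Submodule.add_mem _ ?_ ?_) ?_
    · refine Submodule.span_mono ?_ h3
      rintro _ ⟨a, ha, rfl⟩
      exact ⟨Sum.inl a, ha, rfl⟩
    · refine Submodule.span_mono ?_ hv
      rintro _ ⟨c, hc, rfl⟩
      exact ⟨Sum.inr (Sum.inl c), hc, rfl⟩
    · refine Submodule.span_mono ?_ hu
      rintro _ ⟨a, ha, rfl⟩
      exact ⟨Sum.inr (Sum.inr a), ha, rfl⟩
  have Y : X.NormalForm src tgt deg :=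
    ⟨x, h, hx, hD, hh, hh0, linearIndependent_family hli hh0 hhli, hle⟩
  obtain ⟨n, e, he⟩ := exists_equiv_monotone fun a => toLex (src a, tgt a)
  obtain ⟨m, f, hf⟩ := exists_equiv_monotone deg
  exact ⟨n, m, src ∘ e, tgt ∘ e, deg ∘ f, he, hf, ⟨Y.reindex e f⟩⟩

end Existence

end FilteredComplex

/-! ### Invariants of normal forms -/

theorem finrank_span_basis_image {𝕜 W κ : Type*} [Field 𝕜] [AddCommGroup W] [Module 𝕜 W]
    (b : Module.Basis κ 𝕜 W) (P : κ → Prop) [Fintype {k // P k}] :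
    Module.finrank 𝕜 (Submodule.span 𝕜 (b '' {k | P k})) = Fintype.card {k // P k} := by
  have h := finrank_span_eq_card (R := 𝕜) (b := fun k : {k // P k} => b k)
    (b.linearIndependent.comp _ Subtype.val_injective)
  rw [← h, Set.image_eq_range]
  rfl

namespace FilteredComplex


variable {𝕜 : Type*} [Field 𝕜] {N : ℕ} {W : Type u} [AddCommGroup W] [Module 𝕜 W]
  {V : Fin (N + 1) → Type*} [∀ i, AddCommGroup (V i)] [∀ i, Module 𝕜 (V i)]
  {X : FilteredComplex 𝕜 N W V} {A C : Type*} {src tgt : A → Fin (N + 1)} {deg : C → Fin (N + 1)}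

theorem family_mem {x : A → W} {h : C → W} (hx : ∀ a, x a ∈ X.F (src a))
    (hD : ∀ a, X.D (x a) ∈ X.F (tgt a)) (hh : ∀ c, h c ∈ X.F (deg c)) (k : A ⊕ (C ⊕ A)) :
    X.family x h k ∈ X.F (level src tgt deg k : Fin (N + 1)) := by
  rcases k with a | c | a
  exacts [hD a, hh c, hx a]

/-- A normal form can be recognized by the leading terms. -/
def NormalForm.ofLead [Fintype A] [Fintype C] {x : A → W} {h : C → W}
    (hx : ∀ a, x a ∈ X.F (src a) ⊓ X.par (src a : ℕ)) (hD : ∀ a, X.D (x a) ∈ X.F (tgt a))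
    (hh : ∀ c, h c ∈ X.F (deg c) ⊓ X.par (deg c : ℕ)) (hh0 : ∀ c, X.D (h c) = 0)
    (b : ∀ i, Module.Basis {k // level src tgt deg k = i} 𝕜 (V i))
    (hb : ∀ i k, b i k = X.lead i (X.family x h k.1)) : X.NormalForm src tgt deg where
  x := x
  h := h
  x_mem := hx
  D_mem := hD
  h_mem := hh
  h_closed := hh0
  linearIndependent := by
    have hmem : ∀ k, X.family x h k ∈ X.F (level src tgt deg k : Fin (N + 1)) :=
      family_mem (fun a => (hx a).1) hD fun c => (hh c).1
    rw [Fintype.linearIndependent_iff]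
    intro g hg
    -- Induction on the level: at level `n` the lower coefficients are already zero and the members
    -- of higher level have no leading term, so a relation of the leading terms in `V i` remains.
    have key : ∀ (n : ℕ) k, ((level src tgt deg k : Fin (N + 1)) : ℕ) = n → g k = 0 := by
      intro n
      induction n using Nat.strong_induction_on with
      | _ n ih =>
        intro k hk
        have hterm : ∀ l, X.lead (level src tgt deg k) (g l • X.family x h l) =
            if level src tgt deg l = level src tgt deg k then
              g l • X.lead (level src tgt deg k) (X.family x h l) else 0 := by
          intro l
          split_ifs with hl
          · rw [map_smul]
          · rcases lt_or_gt_of_ne hl with h | h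
            · rw [ih _ (hk ▸ Fin.lt_def.1 h) l rfl, zero_smul, map_zero]
            · have h1 := X.F_anti (Nat.succ_le_of_lt (Fin.lt_def.1 h)) (hmem l)
              rw [map_smul, (X.lead_eq_zero _ _ (X.F_anti (Nat.le_succ _) h1)).2 h1, smul_zero]
        have h0 := congrArg (X.lead (level src tgt deg k)) hg
        rw [map_zero, map_sum, Finset.sum_congr rfl fun l _ => hterm l, ← Finset.sum_filter,
          ← Finset.sum_subtype_of_mem (p := fun l => level src tgt deg l = level src tgt deg k)
            (fun l => g l • X.lead (level src tgt deg k) (X.family x h l))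
            (fun l hl => (Finset.mem_filter.1 hl).2)] at h0
        have h1 := (Fintype.linearIndependent_iff.1 (b (level src tgt deg k)).linearIndependent)
          (fun l => g l.1) (by
            rw [← h0]
            refine Finset.sum_congr ?_ fun l _ => by rw [hb]
            ext l
            simp [l.2])
        exact h1 ⟨k, rfl⟩
    exact fun k => key _ k rfl
  le_span := by
    have hmem : ∀ k, X.family x h k ∈ X.F (level src tgt deg k : Fin (N + 1)) :=
      family_mem (fun a => (hx a).1) hD fun c => (hh c).1
    refine descending (P := fun i w => w ∈ Submodule.span 𝕜 (X.family x h ''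
      {k | i ≤ ((level src tgt deg k : Fin (N + 1)) : ℕ)})) (fun i _ => Submodule.zero_mem _)
      fun i ih w hw => ?_
    -- The combination with the same leading term as `w`; the difference lies one step deeper in the
    -- filtration.
    set y := ∑ k : {k // level src tgt deg k = i},
      (b i).repr (X.lead i w) k • X.family x h k.1 with hy
    have hyF : y ∈ X.F i := Submodule.sum_mem _ fun k _ => Submodule.smul_mem _ _ <| by
      have := hmem k.1
      rwa [k.2] at this
    have hwy : w - y ∈ X.F (i + 1) := by
      rw [← X.lead_eq_zero i _ (Submodule.sub_mem _ hw hyF), map_sub, sub_eq_zero, hy, map_sum]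
      simp only [map_smul, ← hb]
      exact ((b i).sum_repr _).symm
    rw [← sub_add_cancel w y]
    refine Submodule.add_mem _ (Submodule.span_mono (Set.image_mono ?_) (ih _ hwy))
      (Submodule.sum_mem _ fun k _ => Submodule.smul_mem _ _ (Submodule.subset_span ?_))
    · intro k hk
      exact (Nat.le_succ _).trans hk
    · exact ⟨k.1, (Fin.val_eq_of_eq k.2).ge, rfl⟩

namespace NormalForm

variable (Y : X.NormalForm src tgt deg)

/-- The members of a normal form as a basis of `W`. -/
def basis : Module.Basis (A ⊕ (C ⊕ A)) 𝕜 W :=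
  Module.Basis.mk Y.linearIndependent <| by
    have := Y.le_span 0
    rw [X.F_zero] at this
    exact this.trans (Submodule.span_mono (Set.image_subset_range _ _))

theorem coe_basis : ⇑Y.basis = X.family Y.x Y.h := Module.Basis.coe_mk _ _

theorem basis_inl (a : A) : Y.basis (Sum.inl a) = X.D (Y.x a) := by rw [coe_basis]; rfl

theorem basis_inr_inl (c : C) : Y.basis (Sum.inr (Sum.inl c)) = Y.h c := by rw [coe_basis]; rfl

theorem basis_inr_inr (a : A) : Y.basis (Sum.inr (Sum.inr a)) = Y.x a := by rw [coe_basis]; rfl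

theorem basis_mem (k : A ⊕ (C ⊕ A)) : Y.basis k ∈ X.F (level src tgt deg k : Fin (N + 1)) := by
  rw [coe_basis]
  exact family_mem (fun a => (Y.x_mem a).1) Y.D_mem (fun c => (Y.h_mem c).1) k

theorem F_eq (i : ℕ) :
    X.F i = Submodule.span 𝕜 (Y.basis '' {k | i ≤ ((level src tgt deg k : Fin (N + 1)) : ℕ)}) := by
  refine le_antisymm ?_ (Submodule.span_le.2 ?_)
  · rw [coe_basis]; exact Y.le_span i
  · rintro _ ⟨k, hk, rfl⟩
    exact X.F_anti hk (Y.basis_mem k)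

theorem repr_eq_zero_of_lt {i : ℕ} {w : W} (hw : w ∈ X.F i) {k : A ⊕ (C ⊕ A)}
    (hk : ((level src tgt deg k : Fin (N + 1)) : ℕ) < i) : Y.basis.repr w k = 0 := by
  rw [Y.F_eq, Module.Basis.mem_span_image] at hw
  by_contra h
  exact absurd (hw (Finsupp.mem_support_iff.2 h)) (not_le.2 hk)

-- If the parity were different, `D (x a)` would lie in `F (tgt a + 1)`; but it is itself a basis
-- vector of level `tgt a`.
include Y in
theorem parity_tgt (a : A) : ((tgt a : ℕ) : ZMod 2) = (src a : ℕ) + 1 := by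
  by_contra h
  have h1 := X.F_par _ _ h ⟨Y.D_mem a, X.D_par _ _ (Y.x_mem a).2⟩
  have h2 := Y.repr_eq_zero_of_lt (k := Sum.inl a) h1 (Nat.lt_succ_self _)
  rw [← Y.basis_inl, Module.Basis.repr_self, Finsupp.single_eq_same] at h2
  exact one_ne_zero h2

theorem basis_mem_par (k : A ⊕ (C ⊕ A)) :
    Y.basis k ∈ X.par (((level src tgt deg k : Fin (N + 1)) : ℕ) : ZMod 2) := by
  rcases k with a | c | a
  · rw [basis_inl]
    change _ ∈ X.par ((tgt a : ℕ) : ZMod 2)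
    rw [Y.parity_tgt]
    exact X.D_par _ _ (Y.x_mem a).2
  · rw [basis_inr_inl]; exact (Y.h_mem c).2
  · rw [basis_inr_inr]; exact (Y.x_mem a).2

/-- Both subspaces are spanned by parts of the same basis, so the intersection is spanned by the
common part. The left side does not mention the normal form, which makes the count of pairs an
invariant. -/
theorem map_D_inf (i j : ℕ) : (X.F i).map X.D ⊓ X.F j = Submodule.span 𝕜 (Y.basis ''
    {k | ∃ a, k = Sum.inl a ∧ i ≤ (src a : ℕ) ∧ j ≤ (tgt a : ℕ)}) := by
  have h1 : (X.F i).map X.D =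
      Submodule.span 𝕜 (Y.basis '' {k | ∃ a, k = Sum.inl a ∧ i ≤ (src a : ℕ)}) := by
    rw [Y.F_eq i, Submodule.map_span]
    refine le_antisymm (Submodule.span_le.2 ?_) (Submodule.span_le.2 ?_)
    · rintro _ ⟨_, ⟨a | c | a, hk, rfl⟩, rfl⟩
      · rw [basis_inl, X.D_D]; exact Submodule.zero_mem _
      · rw [basis_inr_inl, Y.h_closed]; exact Submodule.zero_mem _
      · rw [basis_inr_inr, ← basis_inl]
        exact Submodule.subset_span ⟨_, ⟨a, rfl, hk⟩, rfl⟩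
    · rintro _ ⟨_, ⟨a, rfl, ha⟩, rfl⟩
      rw [basis_inl, ← basis_inr_inr]
      exact Submodule.subset_span ⟨_, ⟨Sum.inr (Sum.inr a), ha, rfl⟩, rfl⟩
  ext w
  rw [h1, Y.F_eq j, Submodule.mem_inf, Module.Basis.mem_span_image, Module.Basis.mem_span_image,
    Module.Basis.mem_span_image, ← Set.subset_inter_iff]
  have : {k : A ⊕ (C ⊕ A) | ∃ a, k = Sum.inl a ∧ i ≤ (src a : ℕ)} ∩
      {k | j ≤ ((level src tgt deg k : Fin (N + 1)) : ℕ)} =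
      {k | ∃ a, k = Sum.inl a ∧ i ≤ (src a : ℕ) ∧ j ≤ (tgt a : ℕ)} := by
    ext k
    constructor
    · rintro ⟨⟨a, rfl, ha⟩, hk⟩
      exact ⟨a, rfl, ha, hk⟩
    · rintro ⟨a, rfl, ha, hk⟩
      exact ⟨⟨a, rfl, ha⟩, hk⟩
  rw [this]

variable [Fintype A] [Fintype C]

include Y in
theorem card_pairs_ge (i j : ℕ) :
    Fintype.card {a // i ≤ (src a : ℕ) ∧ j ≤ (tgt a : ℕ)} =
      Module.finrank 𝕜 ((X.F i).map X.D ⊓ X.F j : Submodule 𝕜 W) := by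
  classical
  rw [Y.map_D_inf, finrank_span_basis_image]
  refine Fintype.card_of_bijective
    (f := fun a => ⟨Sum.inl a.1, a.1, rfl, a.2⟩) ⟨fun a b h => ?_, ?_⟩
  · exact Subtype.ext (Sum.inl_injective (congrArg Subtype.val h))
  · rintro ⟨_, a, rfl, ha⟩
    exact ⟨⟨a, ha⟩, rfl⟩

include Y in
theorem card_level_ge (i : ℕ) :
    Fintype.card {a // i ≤ (tgt a : ℕ)} + (Fintype.card {c // i ≤ (deg c : ℕ)} +
      Fintype.card {a // i ≤ (src a : ℕ)}) = Module.finrank 𝕜 (X.F i) := by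
  classical
  rw [Y.F_eq i, finrank_span_basis_image Y.basis fun k =>
    i ≤ ((level src tgt deg k : Fin (N + 1)) : ℕ)]
  rw [Fintype.card_congr Equiv.subtypeSum, Fintype.card_sum, Fintype.card_congr Equiv.subtypeSum,
    Fintype.card_sum]
  rfl

end NormalForm

theorem card_ge_eq_add {A : Type*} [Fintype A] (f : A → Fin (N + 1)) (P : A → Prop)
    [DecidablePred P] (i : ℕ) :
    Fintype.card {a // i ≤ (f a : ℕ) ∧ P a} =
      Fintype.card {a // (f a : ℕ) = i ∧ P a} + Fintype.card {a // i + 1 ≤ (f a : ℕ) ∧ P a} := by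
  classical
  rw [Fintype.card_subtype, Fintype.card_subtype, Fintype.card_subtype,
    ← Finset.card_union_of_disjoint]
  · congr 1
    ext a
    simp only [Finset.mem_union, Finset.mem_filter, Finset.mem_univ, true_and]
    rw [← or_and_right]
    refine and_congr_left fun _ => ?_
    omega
  · refine Finset.disjoint_filter.2 fun a _ h h' => ?_
    omega

/-- Exact counts are differences of consecutive cumulative counts. -/
theorem card_eq_of_card_ge {A A' : Type*} [Fintype A] [Fintype A'] {f : A → Fin (N + 1)}
    {f' : A' → Fin (N + 1)} {P : A → Prop} [DecidablePred P] {P' : A' → Prop} [DecidablePred P']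
    (h : ∀ i : ℕ, Fintype.card {a // i ≤ (f a : ℕ) ∧ P a} =
      Fintype.card {a // i ≤ (f' a : ℕ) ∧ P' a}) (i : ℕ) :
    Fintype.card {a // (f a : ℕ) = i ∧ P a} = Fintype.card {a // (f' a : ℕ) = i ∧ P' a} := by
  have h1 := card_ge_eq_add f P i
  have h2 := card_ge_eq_add f' P' i
  have h3 := h i
  have h4 := h (i + 1)
  omega

namespace NormalForm

/-- The degrees of the pairs and of the survivors do not depend on the normal form. -/
theorem degrees_eq {n m n' m' : ℕ} {src tgt : Fin n → Fin (N + 1)} {deg : Fin m → Fin (N + 1)}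
    {src' tgt' : Fin n' → Fin (N + 1)} {deg' : Fin m' → Fin (N + 1)}
    (Y : X.NormalForm src tgt deg) (Y' : X.NormalForm src' tgt' deg')
    (hp : Monotone fun a => toLex (src a, tgt a)) (hp' : Monotone fun a => toLex (src' a, tgt' a))
    (hs : Monotone deg) (hs' : Monotone deg') :
    (⟨n, fun a => toLex (src a, tgt a)⟩ : Σ n, Fin n → Fin (N + 1) ×ₗ Fin (N + 1)) =
        ⟨n', fun a => toLex (src' a, tgt' a)⟩ ∧
      (⟨m, deg⟩ : Σ m, Fin m → Fin (N + 1)) = ⟨m', deg'⟩ := by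
  have h0 : ∀ i j : ℕ, Fintype.card {a // i ≤ (src a : ℕ) ∧ j ≤ (tgt a : ℕ)} =
      Fintype.card {a // i ≤ (src' a : ℕ) ∧ j ≤ (tgt' a : ℕ)} := fun i j => by
    rw [Y.card_pairs_ge, Y'.card_pairs_ge]
  constructor
  · refine eq_of_monotone_of_card hp hp' fun l => ?_
    obtain ⟨⟨i, j⟩, rfl⟩ := toLex.surjective l
    -- The cumulative counts in two indices are differenced first in the source degree, then in the
    -- target degree.
    have h1 : ∀ j : ℕ, Fintype.card {a // j ≤ (tgt a : ℕ) ∧ (src a : ℕ) = i} =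
        Fintype.card {a // j ≤ (tgt' a : ℕ) ∧ (src' a : ℕ) = i} := fun j => by
      simpa only [and_comm] using card_eq_of_card_ge (fun i => h0 i j) i
    have h2 := card_eq_of_card_ge h1 j
    simpa only [toLex_inj, Prod.mk.injEq, Fin.ext_iff, and_comm] using h2
  · refine eq_of_monotone_of_card hs hs' fun l => ?_
    -- The survivors of degree at least `i` account for the dimension of `F i` minus the sources and
    -- the targets of degree at least `i`; the latter are the pair counts with one of the bounds
    -- equal to `0`.
    have h1 : ∀ i : ℕ, Fintype.card {c // i ≤ (deg c : ℕ) ∧ True} =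
        Fintype.card {c // i ≤ (deg' c : ℕ) ∧ True} := fun i => by
      have e1 := Y.card_level_ge i
      have e2 := Y'.card_level_ge i
      have e3 := h0 i 0
      have e4 := h0 0 i
      simp only [Nat.zero_le, and_true, true_and] at e3 e4 ⊢
      omega
    simpa only [and_true, Fin.ext_iff] using card_eq_of_card_ge h1 l

variable [Fintype A] [Fintype C] (Y : X.NormalForm src tgt deg)

/-- The leading terms of a normal form as bases of the `V i`. -/
def leadBasis (i : Fin (N + 1)) : Module.Basis {k // level src tgt deg k = i} 𝕜 (V i) :=
  Module.Basis.mk (v := fun k => X.lead i (Y.basis k.1))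
    (by
      rw [Fintype.linearIndependent_iff]
      intro g hg k
      have hF : ∑ k, g k • Y.basis k.1 ∈ X.F i := Submodule.sum_mem _ fun k _ =>
        Submodule.smul_mem _ _ (by have := Y.basis_mem k.1; rwa [k.2] at this)
      -- A combination without leading term lies in `F (i + 1)`, where all coordinates of level `i`
      -- vanish.
      have h1 : ∑ k, g k • Y.basis k.1 ∈ X.F (i + 1) := by
        rw [← X.lead_eq_zero i _ hF, map_sum]
        simpa only [map_smul] using hg
      have h2 := Y.repr_eq_zero_of_lt (k := k.1) h1 (by rw [k.2]; exact Nat.lt_succ_self _)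
      rw [map_sum, Finsupp.finsetSum_apply, Finset.sum_eq_single k] at h2
      · simpa using h2
      · intro l _ hl
        have : l.1 ≠ k.1 := fun h => hl (Subtype.ext h)
        simp [this]
      · exact fun h => absurd (Finset.mem_univ k) h)
    (by
      intro v _
      obtain ⟨w, hw, rfl⟩ := X.lead_surjective i v
      rw [← Y.basis.sum_repr w, map_sum]
      refine Submodule.sum_mem _ fun k _ => ?_
      rw [map_smul]
      rcases lt_trichotomy (level src tgt deg k) i with h | h | h
      · rw [Y.repr_eq_zero_of_lt hw (Fin.lt_def.1 h), zero_smul]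
        exact Submodule.zero_mem _
      · exact Submodule.smul_mem _ _ (Submodule.subset_span ⟨⟨k, h⟩, rfl⟩)
      · have h1 := X.F_anti (Nat.succ_le_of_lt (Fin.lt_def.1 h)) (Y.basis_mem k)
        rw [(X.lead_eq_zero i _ (X.F_anti (Nat.le_succ _) h1)).2 h1, smul_zero]
        exact Submodule.zero_mem _)

theorem leadBasis_apply (i : Fin (N + 1)) (k : {k // level src tgt deg k = i}) :
    Y.leadBasis i k = X.lead i (Y.basis k.1) := by
  rw [leadBasis, Module.Basis.mk_apply]

/-! ### Comparison of two normal forms -/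

variable (Y' : X.NormalForm src tgt deg)

omit [Fintype A] [Fintype C] in
theorem toMatrix_eq_zero_of_lt {k l : A ⊕ (C ⊕ A)}
    (h : level src tgt deg k < level src tgt deg l) : Y.basis.toMatrix Y'.basis k l = 0 :=
  Y.repr_eq_zero_of_lt (Y'.basis_mem l) (Fin.lt_def.1 h)

/-- Expanding a vector of level `i` of one normal form in the other, lower levels do not occur and
higher ones have no leading term. So the diagonal blocks of the transition matrix are the base
changes of the `V i`. -/
theorem toMatrix_lead (i : Fin (N + 1)) (k l : {k // level src tgt deg k = i}) :
    (Y.leadBasis i).toMatrix (Y'.leadBasis i) k l = Y.basis.toMatrix Y'.basis k.1 l.1 := by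
  classical
  have h : Y'.leadBasis i l =
      ∑ k : {k // level src tgt deg k = i}, Y.basis.toMatrix Y'.basis k.1 l.1 • Y.leadBasis i k := by
    rw [leadBasis_apply, ← Y.basis.sum_toMatrix_smul_self Y'.basis l.1, map_sum]
    have hterm : ∀ k, X.lead i (Y.basis.toMatrix Y'.basis k l.1 • Y.basis k) =
        if level src tgt deg k = i then
          X.lead i (Y.basis.toMatrix Y'.basis k l.1 • Y.basis k) else 0 := by
      intro k
      split_ifs with hk
      · rfl
      · rcases lt_or_gt_of_ne hk with h | h
        · rw [toMatrix_eq_zero_of_lt Y Y' (l.2.symm ▸ h), zero_smul, map_zero]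
        · have h1 := X.F_anti (Nat.succ_le_of_lt (Fin.lt_def.1 h)) (Y.basis_mem k)
          rw [map_smul, (X.lead_eq_zero i _ (X.F_anti (Nat.le_succ _) h1)).2 h1, smul_zero]
    rw [Finset.sum_congr rfl fun k _ => hterm k, ← Finset.sum_filter,
      ← Finset.sum_subtype_of_mem (p := fun k => level src tgt deg k = i)
        (fun k => X.lead i (Y.basis.toMatrix Y'.basis k l.1 • Y.basis k))
        (fun k hk => (Finset.mem_filter.1 hk).2)]
    refine Finset.sum_congr ?_ fun k _ => by rw [map_smul, leadBasis_apply]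
    ext k
    simp [k.2]
  rw [Module.Basis.toMatrix_apply, h, map_sum, Finsupp.finsetSum_apply, Finset.sum_eq_single k]
  · simp
  · intro j _ hj
    simp [hj]
  · exact fun h => absurd (Finset.mem_univ k) h

theorem repr_eq_zero_of_parity {e : ZMod 2} {w : W} (hw : w ∈ X.par e) {k : A ⊕ (C ⊕ A)}
    (hk : (((level src tgt deg k : Fin (N + 1)) : ℕ) : ZMod 2) ≠ e) : Y.basis.repr w k = 0 := by
  classical
  have hadd : ∀ e a : ZMod 2, a ≠ e → a = e + 1 := by decide
  -- The coordinates are sorted by parity; uniqueness of the decomposition into parities forces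
  -- those of the wrong parity to give zero.
  have hdec : w + 0 =
      ∑ k, (if (((level src tgt deg k : Fin (N + 1)) : ℕ) : ZMod 2) = e
        then Y.basis.repr w k else 0) • Y.basis k +
      ∑ k, (if (((level src tgt deg k : Fin (N + 1)) : ℕ) : ZMod 2) = e
        then 0 else Y.basis.repr w k) • Y.basis k := by
    rw [← Finset.sum_add_distrib, add_zero]
    conv_lhs => rw [← Y.basis.sum_repr w]
    refine Finset.sum_congr rfl fun k _ => ?_
    rw [← add_smul]
    split_ifs <;> simp
  have h1 := (eq_of_add_eq hw (Submodule.sum_mem _ fun k _ => ?_) (Submodule.zero_mem _)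
    (Submodule.sum_mem _ fun k _ => ?_) hdec).2
  · have h2 := Fintype.linearIndependent_iff.1 Y.basis.linearIndependent _ h1.symm k
    simpa only [hk, if_false] using h2
  · split_ifs with h
    · have := Y.basis_mem_par k
      rw [h] at this
      exact Submodule.smul_mem _ _ this
    · rw [zero_smul]; exact Submodule.zero_mem _
  · split_ifs with h
    · rw [zero_smul]; exact Submodule.zero_mem _
    · have := Y.basis_mem_par k
      rw [hadd _ _ h] at this
      exact Submodule.smul_mem _ _ this

-- In a normal form `D` carries source coordinates to target coordinates unchanged. Hence the target
-- block of a transition matrix coincides with a source block of the opposite parity.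
omit [Fintype A] [Fintype C] in
theorem repr_D_inl (w : W) (b : A) :
    Y.basis.repr (X.D w) (Sum.inl b) = Y.basis.repr w (Sum.inr (Sum.inr b)) := by
  classical
  have h : Finsupp.lapply (Sum.inl b) ∘ₗ Y.basis.repr.toLinearMap ∘ₗ X.D =
      Finsupp.lapply (Sum.inr (Sum.inr b)) ∘ₗ Y.basis.repr.toLinearMap := by
    refine Y.basis.ext fun k => ?_
    simp only [LinearMap.comp_apply, LinearEquiv.coe_coe, Finsupp.lapply_apply,
      Module.Basis.repr_self]
    rcases k with a | c | a
    · rw [basis_inl, X.D_D]; simp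
    · rw [basis_inr_inl, Y.h_closed]; simp
    · rw [basis_inr_inr, ← basis_inl, Module.Basis.repr_self]
      simp [Finsupp.single_apply]
  exact LinearMap.congr_fun h w

omit [Fintype A] [Fintype C] in
theorem repr_D_inr (w : W) (k : C ⊕ A) : Y.basis.repr (X.D w) (Sum.inr k) = 0 := by
  have h : Finsupp.lapply (Sum.inr k) ∘ₗ Y.basis.repr.toLinearMap ∘ₗ X.D = 0 := by
    refine Y.basis.ext fun k => ?_
    simp only [LinearMap.comp_apply, LinearEquiv.coe_coe, Finsupp.lapply_apply,
      LinearMap.zero_apply]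
    rcases k with a | c | a
    · rw [basis_inl, X.D_D]; simp
    · rw [basis_inr_inl, Y.h_closed]; simp
    · rw [basis_inr_inr, ← basis_inl, Module.Basis.repr_self]
      simp
  exact LinearMap.congr_fun h w

variable [DecidableEq A] [DecidableEq C]

/-- The parity of a member of a normal form. -/
abbrev parity (src tgt : A → Fin (N + 1)) (deg : C → Fin (N + 1)) (k : A ⊕ (C ⊕ A)) : ZMod 2 :=
  (((level src tgt deg k : Fin (N + 1)) : ℕ) : ZMod 2)

/-- The matrix which expresses the even or odd part of one normal form by that of another. -/
def parityMatrix (e : ZMod 2) :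
    Matrix {k // parity src tgt deg k = e} {k // parity src tgt deg k = e} 𝕜 :=
  (Y.basis.toMatrix Y'.basis).submatrix Subtype.val Subtype.val

/-- The part of this matrix which describes the survivors. -/
def survivorMatrix (e : ZMod 2) :
    Matrix {c // ((deg c : ℕ) : ZMod 2) = e} {c // ((deg c : ℕ) : ZMod 2) = e} 𝕜 :=
  Matrix.of fun c c' =>
    Y.basis.toMatrix Y'.basis (Sum.inr (Sum.inl c.1)) (Sum.inr (Sum.inl c'.1))

/-- The part of this matrix which describes the sources. -/
def sourceMatrix (e : ZMod 2) :
    Matrix {a // ((src a : ℕ) : ZMod 2) = e} {a // ((src a : ℕ) : ZMod 2) = e} 𝕜 :=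
  Matrix.of fun a a' =>
    Y.basis.toMatrix Y'.basis (Sum.inr (Sum.inr a.1)) (Sum.inr (Sum.inr a'.1))

/-- Block triangularity for the filtration. The order on levels is reversed since the entries with
row level below the column level vanish. -/
theorem det_parityMatrix_eq_prod (e : ZMod 2) : (parityMatrix Y Y' e).det =
    ∏ i : {i : Fin (N + 1) // ((i : ℕ) : ZMod 2) = e},
      ((Y.leadBasis i.1).toMatrix (Y'.leadBasis i.1)).det := by
  let b : {k // parity src tgt deg k = e} → {i : Fin (N + 1) // ((i : ℕ) : ZMod 2) = e}ᵒᵈ :=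
    fun k => OrderDual.toDual ⟨level src tgt deg k.1, k.2⟩
  have hb : (parityMatrix Y Y' e).BlockTriangular b := fun k l h =>
    toMatrix_eq_zero_of_lt Y Y' (Subtype.mk_lt_mk.1 (OrderDual.toDual_lt_toDual.1 h))
  rw [hb.det_fintype, ← Equiv.prod_comp OrderDual.toDual]
  refine Finset.prod_congr rfl fun i _ => ?_
  let ε : {k // level src tgt deg k = i.1} ≃ {k // b k = OrderDual.toDual i} :=
    { toFun := fun k => ⟨⟨k.1, by rw [parity, k.2, i.2]⟩, congrArg OrderDual.toDual
        (Subtype.ext k.2)⟩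
      invFun := fun k => ⟨k.1.1, congrArg Subtype.val (OrderDual.toDual_inj.1 k.2)⟩
      left_inv := fun _ => rfl
      right_inv := fun _ => rfl }
  rw [← Matrix.det_submatrix_equiv_self ε]
  congr 1
  ext k l
  exact (toMatrix_lead Y Y' i.1 k l).symm

/-- Block triangularity for the order targets, survivors, sources: boundaries involve only targets,
closed elements have no source coordinates, and the target block is the source block of parity `e +
1`. -/
theorem det_parityMatrix_eq_mul (e : ZMod 2) : (parityMatrix Y Y' e).det =
    (sourceMatrix Y Y' (e + 1)).det *
      ((survivorMatrix Y Y' e).det * (sourceMatrix Y Y' e).det) := by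
  let ε : {a // ((src a : ℕ) : ZMod 2) = e + 1} ⊕
      ({c // ((deg c : ℕ) : ZMod 2) = e} ⊕ {a // ((src a : ℕ) : ZMod 2) = e}) ≃
      {k // parity src tgt deg k = e} :=
    (Equiv.sumCongr (Equiv.subtypeEquivRight fun a => by
      change _ ↔ ((tgt a : ℕ) : ZMod 2) = e
      rw [Y.parity_tgt]
      generalize ((src a : ℕ) : ZMod 2) = s
      revert s e
      decide) (Equiv.subtypeSum (p := fun k : C ⊕ A => parity src tgt deg (Sum.inr k) = e)).symm).trans
      (Equiv.subtypeSum (p := fun k : A ⊕ (C ⊕ A) => parity src tgt deg k = e)).symm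
  rw [← Matrix.det_submatrix_equiv_self ε]
  have h : (parityMatrix Y Y' e).submatrix ε ε = Matrix.fromBlocks (sourceMatrix Y Y' (e + 1))
      (((parityMatrix Y Y' e).submatrix ε ε).toBlocks₁₂) 0
      (Matrix.fromBlocks (survivorMatrix Y Y' e)
        (((parityMatrix Y Y' e).submatrix ε ε).toBlocks₂₂.toBlocks₁₂) 0
        (sourceMatrix Y Y' e)) := by
    ext (a | c | a) (a' | c' | a')
    · change Y.basis.repr (Y'.basis (Sum.inl a'.1)) (Sum.inl a.1) = _
      rw [basis_inl, repr_D_inl, ← basis_inr_inr]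
      rfl
    · rfl
    · rfl
    · change Y.basis.repr (Y'.basis (Sum.inl a'.1)) (Sum.inr (Sum.inl c.1)) = 0
      rw [basis_inl, repr_D_inr]
    · rfl
    · rfl
    · change Y.basis.repr (Y'.basis (Sum.inl a'.1)) (Sum.inr (Sum.inr a.1)) = 0
      rw [basis_inl, repr_D_inr]
    · change Y.basis.repr (Y'.basis (Sum.inr (Sum.inl c'.1))) (Sum.inr (Sum.inr a.1)) = 0
      rw [basis_inr_inl, ← repr_D_inl, Y'.h_closed]
      simp
    · rfl
  rw [h, Matrix.det_fromBlocks_zero₂₁, Matrix.det_fromBlocks_zero₂₁]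

/-- Each of the two source determinants occurs once in the even and once in the odd determinant, so
both cancel in the quotient. -/
theorem prod_det_leadBasis :
    (∏ i : {i : Fin (N + 1) // Even (i : ℕ)},
        ((Y.leadBasis i.1).toMatrix (Y'.leadBasis i.1)).det) *
      ∏ i : {i : Fin (N + 1) // ¬ Even (i : ℕ)},
        ((Y.leadBasis i.1).toMatrix (Y'.leadBasis i.1)).det⁻¹ =
      (survivorMatrix Y Y' 0).det * (survivorMatrix Y Y' 1).det⁻¹ := by
  have hne : ∀ e, (parityMatrix Y Y' e).det ≠ 0 := by
    intro e
    rw [det_parityMatrix_eq_prod]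
    refine Finset.prod_ne_zero_iff.2 fun i _ => ?_
    have := Module.Basis.isUnit_det (Y.leadBasis i.1) (Y'.leadBasis i.1)
    exact this.ne_zero
  have h0 := det_parityMatrix_eq_mul Y Y' 0
  have h1 := det_parityMatrix_eq_mul Y Y' 1
  have n0 := hne 0
  have n1 := hne 1
  rw [h0] at n0
  rw [h1] at n1
  rw [det_parityMatrix_eq_prod] at h0 h1
  have e0 : ∏ i : {i : Fin (N + 1) // Even (i : ℕ)},
      ((Y.leadBasis i.1).toMatrix (Y'.leadBasis i.1)).det =
      ∏ i : {i : Fin (N + 1) // ((i : ℕ) : ZMod 2) = 0},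
        ((Y.leadBasis i.1).toMatrix (Y'.leadBasis i.1)).det :=
    Fintype.prod_equiv (Equiv.subtypeEquivRight fun i => ZMod.natCast_eq_zero_iff_even.symm) _ _
      fun _ => rfl
  have e1 : ∏ i : {i : Fin (N + 1) // ¬ Even (i : ℕ)},
      ((Y.leadBasis i.1).toMatrix (Y'.leadBasis i.1)).det⁻¹ =
      ∏ i : {i : Fin (N + 1) // ((i : ℕ) : ZMod 2) = 1},
        ((Y.leadBasis i.1).toMatrix (Y'.leadBasis i.1)).det⁻¹ :=
    Fintype.prod_equiv (Equiv.subtypeEquivRight fun i => by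
      rw [Nat.not_even_iff_odd, ZMod.natCast_eq_one_iff_odd]) _ _ fun _ => rfl
  rw [e0, e1, Finset.prod_inv_distrib, h0, h1]
  have e2 : (0 : ZMod 2) + 1 = 1 := rfl
  have e3 : (1 : ZMod 2) + 1 = 0 := rfl
  rw [e2] at n0 ⊢
  rw [e3] at n1 ⊢
  have m1 := left_ne_zero_of_mul n0
  have m2 := left_ne_zero_of_mul n1
  have m3 := left_ne_zero_of_mul (right_ne_zero_of_mul n1)
  field_simp

omit [DecidableEq A] [DecidableEq C] in
/-- Closed elements are combinations of survivors modulo the image of `D`. -/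
theorem exists_eq_sum_add_D {e : ZMod 2} {y : W} (hy : y ∈ X.par e) (hy0 : X.D y = 0) :
    ∃ w ∈ X.par (e + 1), y = ∑ c : {c // ((deg c : ℕ) : ZMod 2) = e},
      Y.basis.repr y (Sum.inr (Sum.inl c.1)) • Y.h c.1 + X.D w := by
  refine ⟨∑ a : {a // ((src a : ℕ) : ZMod 2) = e + 1},
    Y.basis.repr y (Sum.inl a.1) • Y.x a.1, Submodule.sum_mem _ fun a _ =>
      Submodule.smul_mem _ _ ?_, ?_⟩
  · have := (Y.x_mem a.1).2
    rwa [a.2] at this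
  · have hee : ∀ e s : ZMod 2, s ≠ e + 1 → s + 1 ≠ e := by decide
    conv_lhs => rw [← Y.basis.sum_repr y]
    rw [Fintype.sum_sum_type, Fintype.sum_sum_type, map_sum, add_comm]
    simp only [basis_inl, basis_inr_inl, basis_inr_inr, map_smul]
    have h1 : ∀ a, Y.basis.repr y (Sum.inr (Sum.inr a)) = 0 := fun a => by
      rw [← repr_D_inl, hy0]; simp
    simp only [h1, zero_smul, Finset.sum_const_zero, add_zero]
    congr 1
    · rw [← Finset.sum_subset (Finset.subset_univ
        (Finset.univ.filter fun c => ((deg c : ℕ) : ZMod 2) = e)), Finset.sum_subtype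
          (p := fun c => ((deg c : ℕ) : ZMod 2) = e) _ (by simp)]
      intro c _ hc
      rw [repr_eq_zero_of_parity Y hy (k := Sum.inr (Sum.inl c)) (by simpa [level] using hc),
        zero_smul]
    · rw [← Finset.sum_subset (Finset.subset_univ
        (Finset.univ.filter fun a => ((src a : ℕ) : ZMod 2) = e + 1)), Finset.sum_subtype
          (p := fun a => ((src a : ℕ) : ZMod 2) = e + 1) _ (by simp)]
      intro a _ ha
      rw [repr_eq_zero_of_parity Y hy (k := Sum.inl a) ?_, zero_smul]
      change ((tgt a : ℕ) : ZMod 2) ≠ e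
      rw [Y.parity_tgt]
      exact hee _ _ (by simpa using ha)

end NormalForm
end FilteredComplex

/-! ### Perturbation of a graded complex -/

/-- The projections of a vector space to its homogeneous components in the degrees `0, …, N`. -/
structure FiniteGrading (𝕜 : Type*) [Field 𝕜] (N : ℕ) (M : Type*) [AddCommGroup M]
    [Module 𝕜 M] where
  /-- The projection to the component of degree `n`. -/
  proj : ℕ → Module.End 𝕜 M
  proj_mul : ∀ m n, proj m * proj n = if m = n then proj m else 0
  sum_proj : ∑ n ∈ Finset.range (N + 1), proj n = 1

namespace FiniteGrading

variable {𝕜 : Type*} [Field 𝕜] {N : ℕ} {M : Type*} [AddCommGroup M] [Module 𝕜 M]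
  (G : FiniteGrading 𝕜 N M)

theorem proj_proj (m n : ℕ) (x : M) : G.proj m (G.proj n x) = if m = n then G.proj m x else 0 := by
  have h := LinearMap.congr_fun (G.proj_mul m n) x
  rw [Module.End.mul_apply] at h
  rw [h]
  split_ifs <;> rfl

theorem sum_proj_apply (x : M) : ∑ n ∈ Finset.range (N + 1), G.proj n x = x := by
  have h := LinearMap.congr_fun G.sum_proj x
  rwa [LinearMap.sum_apply] at h

theorem mul_eq_sum (A B : Module.End 𝕜 M) :
    A * B = ∑ l ∈ Finset.range (N + 1), A * G.proj l * B := by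
  rw [← Finset.sum_mul, ← Finset.mul_sum, G.sum_proj, mul_one]

theorem proj_eq_zero {n : ℕ} (hn : N < n) : G.proj n = 0 := by
  rw [← mul_one (G.proj n), ← G.sum_proj, Finset.mul_sum]
  refine Finset.sum_eq_zero fun l hl => ?_
  rw [G.proj_mul, if_neg]
  have := Finset.mem_range.1 hl
  omega

theorem ext_end {A B : Module.End 𝕜 M}
    (h : ∀ m n, G.proj m * A * G.proj n = G.proj m * B * G.proj n) : A = B := by
  have key : ∀ A : Module.End 𝕜 M, A = ∑ m ∈ Finset.range (N + 1), ∑ n ∈ Finset.range (N + 1),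
      G.proj m * A * G.proj n := by
    intro A
    simp only [← Finset.mul_sum, G.sum_proj, mul_one, ← Finset.sum_mul, one_mul]
  rw [key A, key B]
  simp only [h]

theorem proj_apply_eq_sum (A : Module.End 𝕜 M) (m : ℕ) (x : M) :
    G.proj m (A x) = ∑ l ∈ Finset.range (N + 1), G.proj m (A (G.proj l x)) := by
  conv_lhs => rw [← G.sum_proj_apply x]
  rw [map_sum, map_sum]

/-- The operator `A` raises degrees by elements of `S`. -/
def Raises (S : Set ℤ) (A : Module.End 𝕜 M) : Prop :=
  ∀ m n : ℕ, (m : ℤ) - n ∉ S → G.proj m * A * G.proj n = 0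

namespace Raises

variable {G} {S T R : Set ℤ} {A B : Module.End 𝕜 M}

theorem mono (h : G.Raises S A) (hST : ∀ s ∈ S, s ∈ T) : G.Raises T A := fun m n hmn =>
  h m n fun h' => hmn (hST _ h')

theorem add (hA : G.Raises S A) (hB : G.Raises S B) : G.Raises S (A + B) := fun m n hmn => by
  rw [mul_add, add_mul, hA m n hmn, hB m n hmn, add_zero]

theorem neg (hA : G.Raises S A) : G.Raises S (-A) := fun m n hmn => by
  rw [mul_neg, neg_mul, hA m n hmn, neg_zero]

theorem sub (hA : G.Raises S A) (hB : G.Raises S B) : G.Raises S (A - B) := by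
  rw [sub_eq_add_neg]; exact hA.add hB.neg

theorem sum {ι : Type*} {s : Finset ι} {A : ι → Module.End 𝕜 M}
    (hA : ∀ i ∈ s, G.Raises S (A i)) : G.Raises S (∑ i ∈ s, A i) := fun m n hmn => by
  rw [Finset.mul_sum, Finset.sum_mul]
  exact Finset.sum_eq_zero fun i hi => hA i hi m n hmn

/-- Insert the sum of all projections between `A` and `B`; a nonzero term needs a degree shift from
`T` followed by one from `S`. -/
theorem mul (hA : G.Raises S A) (hB : G.Raises T B) (h : ∀ s ∈ S, ∀ t ∈ T, s + t ∈ R) :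
    G.Raises R (A * B) := fun m n hmn => by
  rw [G.mul_eq_sum A B, Finset.mul_sum, Finset.sum_mul]
  refine Finset.sum_eq_zero fun l _ => ?_
  have e : G.proj m * (A * G.proj l * B) * G.proj n =
      (G.proj m * A * G.proj l) * (G.proj l * B * G.proj n) := by
    conv_lhs => rw [← if_pos (c := l = l) rfl (t := G.proj l) (e := 0), ← G.proj_mul]
    simp only [mul_assoc]
  rw [e]
  by_cases h1 : (m : ℤ) - l ∈ S
  · by_cases h2 : (l : ℤ) - n ∈ T
    · refine absurd ?_ hmn
      have := h _ h1 _ h2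
      rwa [sub_add_sub_cancel] at this
    · rw [hB l n h2, mul_zero]
  · rw [hA m l h1, zero_mul]

variable (G) in
theorem one : G.Raises {0} (1 : Module.End 𝕜 M) := fun m n hmn => by
  rw [mul_one, G.proj_mul, if_neg]
  rintro rfl
  simp at hmn

theorem proj_apply_proj (hA : G.Raises S A) {m l : ℕ} (h : (m : ℤ) - l ∉ S) (x : M) :
    G.proj m (A (G.proj l x)) = 0 :=
  LinearMap.congr_fun (hA m l h) x

/-- An operator of degree `r` commutes with the projections, up to a shift. -/
theorem proj_apply_of_singleton {r : ℤ} (hA : G.Raises {r} A) {m n : ℕ} (h : (m : ℤ) = n + r)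
    (x : M) : G.proj m (A x) = A (G.proj n x) := by
  have h1 : G.proj m (A x) = G.proj m (A (G.proj n x)) := by
    rw [G.proj_apply_eq_sum]
    by_cases hn : n ∈ Finset.range (N + 1)
    · refine Finset.sum_eq_single n (fun l _ hl => hA.proj_apply_proj ?_ x) (absurd hn)
      simp only [Set.mem_singleton_iff]
      omega
    · have hn' : N < n := by simpa using hn
      rw [G.proj_eq_zero hn', LinearMap.zero_apply, map_zero, map_zero]
      refine Finset.sum_eq_zero fun l hl => hA.proj_apply_proj ?_ x
      have := Finset.mem_range.1 hl
      simp only [Set.mem_singleton_iff]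
      omega
  have h2 : A (G.proj n x) = G.proj m (A (G.proj n x)) := by
    conv_lhs => rw [← G.sum_proj_apply (A (G.proj n x))]
    by_cases hm : m ∈ Finset.range (N + 1)
    · refine Finset.sum_eq_single m (fun l _ hl => hA.proj_apply_proj ?_ x) (absurd hm)
      simp only [Set.mem_singleton_iff]
      omega
    · have hm' : N < m := by simpa using hm
      rw [G.proj_eq_zero hm', LinearMap.zero_apply]
      refine Finset.sum_eq_zero fun l hl => hA.proj_apply_proj ?_ x
      have := Finset.mem_range.1 hl
      simp only [Set.mem_singleton_iff]
      omega
  rw [h1, ← h2]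

end Raises

/-- The filtration by degree. -/
def F (p : ℕ) : Submodule 𝕜 M where
  carrier := {x | ∀ n < p, G.proj n x = 0}
  add_mem' hx hy n hn := by rw [map_add, hx n hn, hy n hn, add_zero]
  zero_mem' n _ := map_zero _
  smul_mem' a x hx n hn := by rw [map_smul, hx n hn, smul_zero]

/-- The even and the odd part. -/
def par (e : ZMod 2) : Submodule 𝕜 M where
  carrier := {x | ∀ n : ℕ, (n : ZMod 2) ≠ e → G.proj n x = 0}
  add_mem' hx hy n hn := by rw [map_add, hx n hn, hy n hn, add_zero]
  zero_mem' n _ := map_zero _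
  smul_mem' a x hx n hn := by rw [map_smul, hx n hn, smul_zero]

variable {G}

theorem Raises.mem_F {S : Set ℤ} {A : Module.End 𝕜 M} (hA : G.Raises S A) {p q : ℕ}
    (h : ∀ s ∈ S, (q : ℤ) ≤ p + s) {x : M} (hx : x ∈ G.F p) : A x ∈ G.F q := by
  intro n hn
  rw [G.proj_apply_eq_sum]
  refine Finset.sum_eq_zero fun l _ => ?_
  by_cases hl : l < p
  · rw [hx l hl, map_zero, map_zero]
  · refine hA.proj_apply_proj (fun hs => ?_) x
    have := h _ hs
    omega

theorem Raises.mem_par {S : Set ℤ} {A : Module.End 𝕜 M} (hA : G.Raises S A) {e e' : ZMod 2}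
    (h : ∀ s ∈ S, e' = e + (s : ZMod 2)) {x : M} (hx : x ∈ G.par e) : A x ∈ G.par e' := by
  intro n hn
  rw [G.proj_apply_eq_sum]
  refine Finset.sum_eq_zero fun l _ => ?_
  by_cases hl : (l : ZMod 2) = e
  · refine hA.proj_apply_proj (fun hs => hn ?_) x
    rw [h _ hs, ← hl]
    push_cast
    ring
  · rw [hx l hl, map_zero, map_zero]

theorem F_anti : Antitone G.F := fun _ _ h _ hx n hn => hx n (hn.trans_le h)

theorem F_zero : G.F 0 = ⊤ := eq_top_iff.2 fun _ _ n hn => absurd hn (Nat.not_lt_zero n)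

theorem F_last : G.F (N + 1) = ⊥ := by
  rw [eq_bot_iff]
  intro x hx
  rw [Submodule.mem_bot, ← G.sum_proj_apply x]
  exact Finset.sum_eq_zero fun n hn => hx n (Finset.mem_range.1 hn)

theorem mem_F_succ {p : ℕ} {x : M} (hx : x ∈ G.F p) : x ∈ G.F (p + 1) ↔ G.proj p x = 0 := by
  refine ⟨fun h => h p (Nat.lt_succ_self p), fun h n hn => ?_⟩
  rcases Nat.lt_succ_iff_lt_or_eq.1 hn with hn | rfl
  exacts [hx n hn, h]

theorem disjoint_par (e : ZMod 2) : Disjoint (G.par e) (G.par (e + 1)) := by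
  rw [Submodule.disjoint_def]
  intro x hx hx'
  rw [← G.sum_proj_apply x]
  refine Finset.sum_eq_zero fun n _ => ?_
  by_cases hn : (n : ZMod 2) = e
  · refine hx' n ?_
    rw [hn]
    have h : ∀ e : ZMod 2, e ≠ e + 1 := by decide
    exact h e
  · exact hx n hn

theorem F_inf_par (p : ℕ) {e : ZMod 2} (h : (p : ZMod 2) ≠ e) : G.F p ⊓ G.par e ≤ G.F (p + 1) :=
  fun _ hx => (mem_F_succ hx.1).2 (hx.2 p h)

variable (G) in
/-- The projection to the even or the odd part. -/
def parProj (e : ZMod 2) : Module.End 𝕜 M :=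
  ∑ n ∈ (Finset.range (N + 1)).filter (fun n : ℕ => (n : ZMod 2) = e), G.proj n

theorem proj_parProj (e : ZMod 2) (n : ℕ) (x : M) :
    G.proj n (G.parProj e x) = if (n : ZMod 2) = e then G.proj n x else 0 := by
  rw [parProj, LinearMap.sum_apply, map_sum]
  simp only [G.proj_proj]
  rw [Finset.sum_ite_eq]
  by_cases hn : n ≤ N
  · simp [Nat.lt_succ_of_le hn]
  · rw [G.proj_eq_zero (not_le.1 hn)]
    simp

theorem parProj_mem (e : ZMod 2) (x : M) : G.parProj e x ∈ G.par e := fun n hn => by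
  rw [proj_parProj, if_neg hn]

theorem parProj_mem_F (e : ZMod 2) {p : ℕ} {x : M} (hx : x ∈ G.F p) : G.parProj e x ∈ G.F p :=
  fun n hn => by
    rw [proj_parProj, hx n hn, ite_self]

theorem parProj_add (e : ZMod 2) (x : M) : G.parProj e x + G.parProj (e + 1) x = x := by
  have h : ∀ e n : ZMod 2, n = e + 1 ↔ ¬ n = e := by decide
  conv_rhs => rw [← G.sum_proj_apply x]
  rw [parProj, parProj, LinearMap.sum_apply, LinearMap.sum_apply]
  simp only [h]
  exact Finset.sum_filter_add_sum_filter_not _ _ _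

theorem Raises.parProj_comm {S : Set ℤ} {A : Module.End 𝕜 M} (hA : G.Raises S A)
    (hS : ∀ s ∈ S, Even s) (e : ZMod 2) (x : M) : A (G.parProj e x) = G.parProj e (A x) := by
  have h : A * G.parProj e = G.parProj e * A := by
    refine G.ext_end fun m n => ?_
    ext y
    simp only [Module.End.mul_apply]
    rw [proj_parProj]
    have h1 : G.parProj e (G.proj n y) = if (n : ZMod 2) = e then G.proj n y else 0 := by
      have h2 : G.parProj e (G.proj n y) =
          ∑ l ∈ (Finset.range (N + 1)).filter (fun l : ℕ => (l : ZMod 2) = e),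
            if n = l then G.proj n y else 0 := by
        rw [parProj, LinearMap.sum_apply]
        refine Finset.sum_congr rfl fun l _ => ?_
        rw [G.proj_proj]
        split_ifs with h h' h'
        · rw [h]
        · exact absurd h.symm h'
        · exact absurd h'.symm h
        · rfl
      rw [h2, Finset.sum_ite_eq]
      by_cases hn : n ≤ N
      · simp [Nat.lt_succ_of_le hn]
      · rw [G.proj_eq_zero (not_le.1 hn)]
        simp
    rw [h1]
    by_cases hmn : (m : ℤ) - n ∈ S
    · have : (m : ZMod 2) = n := by
        have := (ZMod.intCast_eq_zero_iff_even).2 (hS _ hmn)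
        push_cast at this
        exact sub_eq_zero.1 this
      rw [this]
      split_ifs
      · rfl
      · rw [map_zero, map_zero]
    · have := hA.proj_apply_proj hmn y
      split_ifs
      · rfl
      · exact this
      · rw [map_zero, map_zero, this]
      · rw [map_zero, map_zero]
  exact LinearMap.congr_fun h x

end FiniteGrading


/-- Compose a projection to the image of `d` with a section of `d` over its image. -/
theorem exists_generalized_inverse {𝕜 M : Type*} [Field 𝕜] [AddCommGroup M] [Module 𝕜 M]
    (d : Module.End 𝕜 M) : ∃ s : Module.End 𝕜 M, d * s * d = d := by
  obtain ⟨σ, hσ⟩ := LinearMap.exists_rightInverse_of_surjective d.rangeRestrict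
    d.range_rangeRestrict
  obtain ⟨p, hp⟩ := LinearMap.exists_leftInverse_of_injective (LinearMap.range d).subtype
    (Submodule.ker_subtype _)
  refine ⟨σ ∘ₗ p, LinearMap.ext fun x => ?_⟩
  have h1 : p (d x) = d.rangeRestrict x := LinearMap.congr_fun hp (d.rangeRestrict x)
  have h2 := congrArg Subtype.val (LinearMap.congr_fun hσ (d.rangeRestrict x))
  rw [Module.End.mul_apply, Module.End.mul_apply, LinearMap.comp_apply, h1]
  exact h2

/-- A generalized inverse of `d` is corrected three times, once for the degree and once for each of
the identities `kdk = k` and `k² = 0`, and `dkd = d` persists throughout. -/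
theorem FiniteGrading.exists_contraction {𝕜 : Type*} [Field 𝕜] {N : ℕ} {M : Type*} [AddCommGroup M]
    [Module 𝕜 M] (G : FiniteGrading 𝕜 N M) {d : Module.End 𝕜 M} (hd : d * d = 0)
    (hG : G.Raises {1} d) :
    ∃ k : Module.End 𝕜 M, G.Raises {-1} k ∧ d * k * d = d ∧ k * d * k = k ∧ k * k = 0 := by
  obtain ⟨s, hs⟩ := exists_generalized_inverse d
  have hc : ∀ n, G.proj (n + 1) * d = d * G.proj n := fun n => LinearMap.ext fun x =>
    hG.proj_apply_of_singleton (by push_cast; ring) x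
  -- The part of degree `-1` of the generalized inverse.
  set k0 := ∑ n ∈ Finset.range (N + 1), G.proj n * s * G.proj (n + 1) with hk0
  have h0 : d * k0 * d = d := by
    have h1 : ∀ n, d * (G.proj n * s * G.proj (n + 1)) * d = d * G.proj n := by
      intro n
      calc d * (G.proj n * s * G.proj (n + 1)) * d
          = (d * G.proj n) * s * (G.proj (n + 1) * d) := by simp only [mul_assoc]
        _ = (G.proj (n + 1) * d) * s * (d * G.proj n) := by rw [hc]
        _ = G.proj (n + 1) * (d * s * d) * G.proj n := by simp only [mul_assoc]
        _ = d * (G.proj n * G.proj n) := by rw [hs, hc, mul_assoc]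
        _ = d * G.proj n := by rw [G.proj_mul, if_pos rfl]
    rw [hk0, Finset.mul_sum, Finset.sum_mul, Finset.sum_congr rfl fun n _ => h1 n, ← Finset.mul_sum,
      G.sum_proj, mul_one]
  have hk0R : G.Raises {-1} k0 := by
    refine FiniteGrading.Raises.sum fun n _ => fun m l hml => ?_
    have e : G.proj m * (G.proj n * s * G.proj (n + 1)) * G.proj l =
        (G.proj m * G.proj n) * s * (G.proj (n + 1) * G.proj l) := by simp only [mul_assoc]
    rw [e, G.proj_mul, G.proj_mul]
    split_ifs with h1 h2
    · refine absurd ?_ hml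
      simp only [Set.mem_singleton_iff]
      omega
    all_goals simp only [zero_mul, mul_zero]
  -- This enforces `k1 * d * k1 = k1`.
  set k1 := k0 * d * k0 with hk1
  have h1 : d * k1 * d = d := by
    calc d * (k0 * d * k0) * d = (d * k0 * d) * k0 * d := by simp only [mul_assoc]
      _ = d := by rw [h0, h0]
  have h1' : k1 * d * k1 = k1 := by
    calc k0 * d * k0 * d * (k0 * d * k0) = k0 * ((d * k0 * d) * k0 * d) * k0 := by
          simp only [mul_assoc]
      _ = k0 * d * k0 := by rw [h0, h0]
  have hk1R : G.Raises {-1} k1 :=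
    (hk0R.mul hG (R := {0}) (by simp)).mul hk0R (by simp)
  -- The last correction, by `1 - d * k1`, makes the square zero and is invisible after
  -- multiplication by `d` on the left.
  have hdk : d * ((1 - d * k1) * k1) = d * k1 := by
    calc d * ((1 - d * k1) * k1) = d * k1 - (d * d) * k1 * k1 := by noncomm_ring
      _ = d * k1 := by rw [hd, zero_mul, zero_mul, sub_zero]
  refine ⟨(1 - d * k1) * k1, ?_, ?_, ?_, ?_⟩
  · refine FiniteGrading.Raises.mul (S := {0}) ?_ hk1R (by simp)
    exact (FiniteGrading.Raises.one G).sub (hG.mul hk1R (by simp))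
  · rw [hdk, h1]
  · rw [mul_assoc, hdk, mul_assoc, ← mul_assoc k1, h1']
  · calc (1 - d * k1) * k1 * ((1 - d * k1) * k1)
        = (1 - d * k1) * (k1 * k1 - (k1 * d * k1) * k1) := by noncomm_ring
      _ = 0 := by rw [h1', sub_self, mul_zero]

/-- A graded complex `(M, d)` with identifications of its cohomology groups with spaces `V i`, and a
perturbation `d + τ` of the differential, where `τ` raises degrees by odd integers `≥ 3`. -/
structure PerturbedComplex (𝕜 : Type*) [Field 𝕜] (N : ℕ) (M : Type*) [AddCommGroup M] [Module 𝕜 M]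
    (V : Fin (N + 1) → Type*) [∀ i, AddCommGroup (V i)] [∀ i, Module 𝕜 (V i)] extends
    FiniteGrading 𝕜 N M where
  /-- The unperturbed differential. -/
  d : Module.End 𝕜 M
  /-- The perturbation. -/
  τ : Module.End 𝕜 M
  d_mul_d : d * d = 0
  total_mul_total : (d + τ) * (d + τ) = 0
  raises_d : toFiniteGrading.Raises {1} d
  raises_τ : toFiniteGrading.Raises {s | 3 ≤ s ∧ Odd s} τ
  /-- The class of a homogeneous cocycle. -/
  cls : ∀ i : Fin (N + 1), ↥(LinearMap.ker (1 - proj i) ⊓ LinearMap.ker d) →ₗ[𝕜] V i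
  cls_surjective : ∀ i, Function.Surjective (cls i)
  cls_eq_zero : ∀ i z, cls i z = 0 ↔ ∃ y, d y = z.1

namespace PerturbedComplex

variable {𝕜 : Type*} [Field 𝕜] {N : ℕ} {M : Type*} [AddCommGroup M] [Module 𝕜 M]
  {V : Fin (N + 1) → Type*} [∀ i, AddCommGroup (V i)] [∀ i, Module 𝕜 (V i)]
  (P : PerturbedComplex 𝕜 N M V)

/-- The perturbed differential. -/
def total : Module.End 𝕜 M := P.d + P.τ

/-- A contraction of the unperturbed complex. -/
def contraction : Module.End 𝕜 M :=
  (P.exists_contraction P.d_mul_d P.raises_d).choose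

theorem raises_contraction : P.Raises {-1} P.contraction :=
  (P.exists_contraction P.d_mul_d P.raises_d).choose_spec.1

theorem d_contraction_d : P.d * P.contraction * P.d = P.d :=
  (P.exists_contraction P.d_mul_d P.raises_d).choose_spec.2.1

theorem contraction_d_contraction : P.contraction * P.d * P.contraction = P.contraction :=
  (P.exists_contraction P.d_mul_d P.raises_d).choose_spec.2.2.1

theorem contraction_mul_self : P.contraction * P.contraction = 0 :=
  (P.exists_contraction P.d_mul_d P.raises_d).choose_spec.2.2.2

/-- A step of `τ` raises the degree by at least `3` and the contraction lowers it by `1`, so each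
factor gains at least `2`. -/
theorem raises_τ_contraction_pow (r : ℕ) :
    P.Raises {s | 2 * (r : ℤ) ≤ s ∧ Even s} ((-(P.τ * P.contraction)) ^ r) := by
  have h1 : P.Raises {s | 2 ≤ s ∧ Even s} (-(P.τ * P.contraction)) := by
    refine (P.raises_τ.mul P.raises_contraction ?_).neg
    rintro s ⟨hs, hs'⟩ _ rfl
    exact ⟨by omega, by rw [Int.odd_iff] at hs'; rw [Int.even_iff]; omega⟩
  induction r with
  | zero =>
    rw [pow_zero]
    refine (FiniteGrading.Raises.one _).mono ?_
    rintro _ rfl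
    simp
  | succ r ih =>
    rw [pow_succ]
    refine ih.mul h1 ?_
    rintro s ⟨hs, hs'⟩ t ⟨ht, ht'⟩
    exact ⟨by push_cast; omega, hs'.add ht'⟩

/-- The inverse of `1 + τ k`. -/
def perturbation : Module.End 𝕜 M := ∑ r ∈ Finset.range (N + 1), (-(P.τ * P.contraction)) ^ r

/-- A gain of `2 * (N + 1)` exceeds the range of degrees, so the Neumann series for the inverse of
`1 + τ k` is a finite sum. -/
theorem τ_contraction_pow : (-(P.τ * P.contraction)) ^ (N + 1) = 0 := by
  refine P.ext_end fun m n => ?_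
  rw [mul_zero, zero_mul]
  by_cases hm : N < m
  · rw [P.proj_eq_zero hm, zero_mul, zero_mul]
  · refine P.raises_τ_contraction_pow (N + 1) m n fun h => ?_
    have := h.1
    push_cast at this
    omega

theorem perturbation_mul : P.perturbation * (1 + P.τ * P.contraction) = 1 := by
  have h := geom_sum_mul_neg (-(P.τ * P.contraction)) (N + 1)
  rwa [P.τ_contraction_pow, sub_neg_eq_add, sub_zero] at h

theorem mul_perturbation : (1 + P.τ * P.contraction) * P.perturbation = 1 := by
  have h := mul_neg_geom_sum (-(P.τ * P.contraction)) (N + 1)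
  rwa [P.τ_contraction_pow, sub_neg_eq_add, sub_zero] at h

theorem raises_perturbation : P.Raises {s | 0 ≤ s ∧ Even s} P.perturbation :=
  FiniteGrading.Raises.sum fun r _ => (P.raises_τ_contraction_pow r).mono fun s hs =>
    ⟨by have := hs.1; omega, hs.2⟩

theorem perturbation_eq_sub :
    P.perturbation = 1 - P.perturbation * (P.τ * P.contraction) := by
  have h := P.perturbation_mul
  rw [mul_add, mul_one] at h
  exact eq_sub_of_add_eq h

theorem raises_perturbation_sub_one :
    P.Raises {s | 2 ≤ s ∧ Even s} (P.perturbation - 1) := by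
  have h : P.perturbation - 1 = P.perturbation * (-(P.τ * P.contraction)) ^ 1 := by
    rw [pow_one, mul_neg, sub_eq_iff_eq_add, neg_add_eq_sub]
    exact P.perturbation_eq_sub
  rw [h]
  refine P.raises_perturbation.mul (P.raises_τ_contraction_pow 1) ?_
  rintro s ⟨hs, hs'⟩ t ⟨ht, ht'⟩
  exact ⟨by push_cast at ht; omega, hs'.add ht'⟩

/-- The perturbed contraction. -/
def totalContraction : Module.End 𝕜 M := P.contraction * P.perturbation

theorem totalContraction_mul_self : P.totalContraction * P.totalContraction = 0 := by
  have h : P.contraction * P.perturbation * P.contraction = 0 := by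
    rw [P.perturbation_eq_sub]
    calc P.contraction * (1 - P.perturbation * (P.τ * P.contraction)) * P.contraction
        = P.contraction * P.contraction - P.contraction * P.perturbation * P.τ *
          (P.contraction * P.contraction) := by noncomm_ring
      _ = 0 := by rw [P.contraction_mul_self, mul_zero, sub_zero]
  rw [totalContraction, ← mul_assoc, h, zero_mul]

/-- The side condition `kdk = k` is inherited by the perturbed contraction because the perturbation
inverts `1 + τ k`. -/
theorem totalContraction_total_totalContraction :
    P.totalContraction * P.total * P.totalContraction = P.totalContraction := by
  have h1 : P.contraction * P.perturbation * P.d * P.contraction =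
      P.contraction * P.perturbation := by
    conv_rhs => rw [P.perturbation_eq_sub]
    conv_lhs => rw [P.perturbation_eq_sub]
    calc P.contraction * (1 - P.perturbation * (P.τ * P.contraction)) * P.d * P.contraction
        = P.contraction * P.d * P.contraction - P.contraction * P.perturbation * P.τ *
          (P.contraction * P.d * P.contraction) := by noncomm_ring
      _ = _ := by rw [P.contraction_d_contraction]; noncomm_ring
  calc P.contraction * P.perturbation * (P.d + P.τ) * (P.contraction * P.perturbation)
      = (P.contraction * P.perturbation * P.d * P.contraction) * P.perturbation +
        P.contraction * P.perturbation * (P.τ * P.contraction) * P.perturbation := by noncomm_ring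
    _ = P.contraction * P.perturbation * ((1 + P.τ * P.contraction) * P.perturbation) := by
      rw [h1]; noncomm_ring
    _ = P.contraction * P.perturbation := by rw [P.mul_perturbation, mul_one]

/-- The projection to the perturbed harmonic space. -/
def harmonic : Module.End 𝕜 M := 1 - P.total * P.totalContraction - P.totalContraction * P.total

/-- The projection to the unperturbed harmonic space. -/
def harmonic₀ : Module.End 𝕜 M := 1 - P.d * P.contraction - P.contraction * P.d

theorem total_mul : P.total * P.total = 0 := P.total_mul_total

theorem total_harmonic : P.total * P.harmonic = P.total - P.total * P.totalContraction * P.total := by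
  rw [harmonic]
  calc P.total * (1 - P.total * P.totalContraction - P.totalContraction * P.total)
      = P.total - (P.total * P.total) * P.totalContraction -
        P.total * P.totalContraction * P.total := by noncomm_ring
    _ = _ := by rw [P.total_mul, zero_mul, sub_zero]

theorem harmonic_total : P.harmonic * P.total = P.total - P.total * P.totalContraction * P.total := by
  rw [harmonic]
  calc (1 - P.total * P.totalContraction - P.totalContraction * P.total) * P.total
      = P.total - P.total * P.totalContraction * P.total -
        P.totalContraction * (P.total * P.total) := by noncomm_ring
    _ = _ := by rw [P.total_mul, mul_zero, sub_zero]

/-- Only `D² = 0` and the relations `κ² = 0`, `κDκ = κ` for the perturbed contraction `κ` are used.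
The relation `DκD = D` is not available: `D` may act nontrivially on the harmonic space, and this
action is what the spectral sequence records. -/
theorem harmonic_mul_self : P.harmonic * P.harmonic = P.harmonic := by
  have h1 : P.harmonic * P.totalContraction = 0 := by
    rw [harmonic]
    calc (1 - P.total * P.totalContraction - P.totalContraction * P.total) * P.totalContraction
        = P.totalContraction - P.total * (P.totalContraction * P.totalContraction) -
          P.totalContraction * P.total * P.totalContraction := by noncomm_ring
      _ = 0 := by
        rw [P.totalContraction_mul_self, P.totalContraction_total_totalContraction]
        simp
  conv_lhs => rhs; rw [harmonic]
  calc P.harmonic * (1 - P.total * P.totalContraction - P.totalContraction * P.total)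
      = P.harmonic - (P.harmonic * P.total) * P.totalContraction -
        (P.harmonic * P.totalContraction) * P.total := by noncomm_ring
    _ = P.harmonic - (P.total * P.harmonic) * P.totalContraction := by
      rw [h1, zero_mul, sub_zero, P.harmonic_total, P.total_harmonic]
    _ = P.harmonic := by rw [mul_assoc, h1, mul_zero, sub_zero]

theorem harmonic₀_mul_self : P.harmonic₀ * P.harmonic₀ = P.harmonic₀ := by
  have h1 : P.harmonic₀ * P.contraction = 0 := by
    rw [harmonic₀]
    calc (1 - P.d * P.contraction - P.contraction * P.d) * P.contraction
        = P.contraction - P.d * (P.contraction * P.contraction) -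
          P.contraction * P.d * P.contraction := by noncomm_ring
      _ = 0 := by rw [P.contraction_mul_self, P.contraction_d_contraction]; simp
  have h2 : P.harmonic₀ * P.d = 0 := by
    rw [harmonic₀]
    calc (1 - P.d * P.contraction - P.contraction * P.d) * P.d
        = P.d - P.d * P.contraction * P.d - P.contraction * (P.d * P.d) := by noncomm_ring
      _ = 0 := by rw [P.d_mul_d, P.d_contraction_d]; simp
  conv_lhs => rhs; rw [harmonic₀]
  calc P.harmonic₀ * (1 - P.d * P.contraction - P.contraction * P.d)
      = P.harmonic₀ - (P.harmonic₀ * P.d) * P.contraction -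
        (P.harmonic₀ * P.contraction) * P.d := by noncomm_ring
    _ = P.harmonic₀ := by rw [h1, h2]; simp

/-- For the unperturbed complex `dkd = d` does hold, so coboundaries have no harmonic part. -/
theorem harmonic₀_d : P.harmonic₀ * P.d = 0 := by
  rw [harmonic₀]
  calc (1 - P.d * P.contraction - P.contraction * P.d) * P.d
      = P.d - P.d * P.contraction * P.d - P.contraction * (P.d * P.d) := by noncomm_ring
    _ = 0 := by rw [P.d_mul_d, P.d_contraction_d]; simp

theorem d_harmonic₀ : P.d * P.harmonic₀ = 0 := by
  rw [harmonic₀]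
  calc P.d * (1 - P.d * P.contraction - P.contraction * P.d)
      = P.d - (P.d * P.d) * P.contraction - P.d * P.contraction * P.d := by noncomm_ring
    _ = 0 := by rw [P.d_mul_d, P.d_contraction_d]; simp

theorem raises_total : P.Raises {s | 1 ≤ s ∧ Odd s} P.total :=
  (P.raises_d.mono (by rintro _ rfl; exact ⟨le_rfl, odd_one⟩)).add
    (P.raises_τ.mono fun s hs => ⟨by have := hs.1; omega, hs.2⟩)

theorem raises_harmonic₀ : P.Raises {0} P.harmonic₀ :=
  ((FiniteGrading.Raises.one _).sub (P.raises_d.mul P.raises_contraction (by simp))).sub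
    (P.raises_contraction.mul P.raises_d (by simp))

/-- Every term of the difference contains `τ` or a positive power of `τ k`. Thus the perturbed and
unperturbed projections have the same effect on leading terms. -/
theorem raises_harmonic_sub : P.Raises {s | 2 ≤ s ∧ Even s} (P.harmonic - P.harmonic₀) := by
  have h : P.harmonic - P.harmonic₀ = -(P.d * P.contraction * (P.perturbation - 1)) -
      P.τ * P.contraction * P.perturbation - P.contraction * (P.perturbation - 1) * P.d -
        P.contraction * P.perturbation * P.τ := by
    rw [harmonic, harmonic₀, totalContraction, total]
    noncomm_ring
  have h1 : P.Raises {0} (P.d * P.contraction) := P.raises_d.mul P.raises_contraction (by simp)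
  have h2 : P.Raises {s | 2 ≤ s ∧ Even s} (P.τ * P.contraction) :=
    P.raises_τ.mul P.raises_contraction (by
      rintro s ⟨hs, hs'⟩ _ rfl
      exact ⟨by omega, by rw [Int.odd_iff] at hs'; rw [Int.even_iff]; omega⟩)
  rw [h]
  refine ((FiniteGrading.Raises.neg ?_).sub ?_).sub ?_ |>.sub ?_
  · exact h1.mul P.raises_perturbation_sub_one (by rintro _ rfl t ht; simpa using ht)
  · exact h2.mul P.raises_perturbation (by
      rintro s ⟨hs, hs'⟩ t ⟨ht, ht'⟩
      exact ⟨by omega, hs'.add ht'⟩)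
  · refine (P.raises_contraction.mul P.raises_perturbation_sub_one
      (R := {s | 1 ≤ s ∧ Odd s}) ?_).mul P.raises_d ?_
    · rintro _ rfl t ⟨ht, ht'⟩
      exact ⟨by omega, by rw [Int.even_iff] at ht'; rw [Int.odd_iff]; omega⟩
    · rintro s ⟨hs, hs'⟩ _ rfl
      exact ⟨by omega, by rw [Int.odd_iff] at hs'; rw [Int.even_iff]; omega⟩
  · refine (P.raises_contraction.mul P.raises_perturbation
      (R := {s | -1 ≤ s ∧ Odd s}) ?_).mul P.raises_τ ?_
    · rintro _ rfl t ⟨ht, ht'⟩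
      exact ⟨by omega, by rw [Int.even_iff] at ht'; rw [Int.odd_iff]; omega⟩
    · rintro s ⟨hs, hs'⟩ t ⟨ht, ht'⟩
      exact ⟨by omega, by rw [Int.odd_iff] at hs' ht'; rw [Int.even_iff]; omega⟩

theorem raises_harmonic : P.Raises {s | 0 ≤ s ∧ Even s} P.harmonic := by
  rw [← sub_add_cancel P.harmonic P.harmonic₀]
  exact (P.raises_harmonic_sub.mono (by rintro s ⟨hs, hs'⟩; exact ⟨by omega, hs'⟩)).add
    (P.raises_harmonic₀.mono (by rintro _ rfl; simp))

theorem raises_totalContraction : P.Raises {s | -1 ≤ s ∧ Odd s} P.totalContraction := by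
  refine P.raises_contraction.mul P.raises_perturbation ?_
  rintro _ rfl t ⟨ht, ht'⟩
  exact ⟨by omega, by rw [Int.even_iff] at ht'; rw [Int.odd_iff]; omega⟩

end PerturbedComplex

namespace PerturbedComplex

variable {𝕜 : Type*} [Field 𝕜] {N : ℕ} {M : Type*} [AddCommGroup M] [Module 𝕜 M]
  {V : Fin (N + 1) → Type*} [∀ i, AddCommGroup (V i)] [∀ i, Module 𝕜 (V i)]
  (P : PerturbedComplex 𝕜 N M V)

/-! ### The perturbed harmonic space -/

/-- The homogeneous cocycles of degree `i`. -/
abbrev cocycles (i : Fin (N + 1)) : Submodule 𝕜 M :=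
  LinearMap.ker (1 - P.proj i) ⊓ LinearMap.ker P.d

theorem proj_cocycle {i : Fin (N + 1)} (z : P.cocycles i) : P.proj i z.1 = z.1 :=
  (sub_eq_zero.1 (LinearMap.mem_ker.1 z.2.1)).symm

theorem harmonic₀_proj_mem (i : Fin (N + 1)) (x : M) :
    P.harmonic₀ (P.proj i x) ∈ P.cocycles i := by
  refine ⟨?_, LinearMap.congr_fun P.d_harmonic₀ (P.proj i x)⟩
  have h := P.raises_harmonic₀.proj_apply_of_singleton (m := i) (n := i) (by simp) (P.proj i x)
  rw [P.proj_proj, if_pos rfl] at h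
  exact sub_eq_zero.2 h.symm

/-- The class of the leading term of degree `i`. -/
def leading (i : Fin (N + 1)) : M →ₗ[𝕜] V i :=
  P.cls i ∘ₗ (P.harmonic₀ ∘ₗ P.proj i).codRestrict (P.cocycles i) fun x => P.harmonic₀_proj_mem i x

theorem leading_apply (i : Fin (N + 1)) (x : M) :
    P.leading i x = P.cls i ⟨_, P.harmonic₀_proj_mem i x⟩ := rfl

theorem harmonic₀_cocycle {i : Fin (N + 1)} (z : P.cocycles i) :
    P.harmonic₀ z.1 = z.1 - P.d (P.contraction z.1) := by
  rw [harmonic₀, LinearMap.sub_apply, LinearMap.sub_apply, Module.End.mul_apply,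
    Module.End.mul_apply, LinearMap.mem_ker.1 z.2.2, map_zero, sub_zero]
  rfl

/-- A cocycle and its harmonic part are cohomologous, so `cls` does not distinguish them. -/
theorem leading_of_proj_eq {i : Fin (N + 1)} {x : M} {z : P.cocycles i}
    (h : P.proj i x = P.harmonic₀ z.1) : P.leading i x = P.cls i z := by
  rw [leading_apply, ← sub_eq_zero, ← map_sub, P.cls_eq_zero]
  refine ⟨-P.contraction z.1, ?_⟩
  have h1 : P.harmonic₀ (P.harmonic₀ z.1) = P.harmonic₀ z.1 :=
    LinearMap.congr_fun P.harmonic₀_mul_self z.1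
  have h2 := P.harmonic₀_cocycle z
  rw [map_neg]
  change _ = P.harmonic₀ (P.proj i x) - z.1
  rw [h, h1, h2]
  abel

theorem harmonic_mem_F {p : ℕ} {x : M} (hx : x ∈ P.F p) : P.harmonic x ∈ P.F p :=
  P.raises_harmonic.mem_F (by rintro s ⟨hs, -⟩; omega) hx

theorem harmonic_mem_par {e : ZMod 2} {x : M} (hx : x ∈ P.par e) : P.harmonic x ∈ P.par e :=
  P.raises_harmonic.mem_par (by
    rintro s ⟨-, hs⟩
    rw [(ZMod.intCast_eq_zero_iff_even).2 hs, add_zero]) hx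

theorem total_mem_par {e : ZMod 2} {x : M} (hx : x ∈ P.par e) : P.total x ∈ P.par (e + 1) :=
  P.raises_total.mem_par (by
    rintro s ⟨-, hs⟩
    rw [(ZMod.intCast_eq_one_iff_odd).2 hs]) hx

theorem totalContraction_mem_par {e : ZMod 2} {x : M} (hx : x ∈ P.par e) :
    P.totalContraction x ∈ P.par (e + 1) :=
  P.raises_totalContraction.mem_par (by
    rintro s ⟨-, hs⟩
    rw [(ZMod.intCast_eq_one_iff_odd).2 hs]) hx

theorem proj_harmonic {p : ℕ} {x : M} (hx : x ∈ P.F p) :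
    P.proj p (P.harmonic x) = P.harmonic₀ (P.proj p x) := by
  have h1 : (P.harmonic - P.harmonic₀) x ∈ P.F (p + 1) :=
    P.raises_harmonic_sub.mem_F (by rintro s ⟨hs, -⟩; push_cast; omega) hx
  have h2 := h1 p (Nat.lt_succ_self p)
  rw [LinearMap.sub_apply, map_sub, sub_eq_zero] at h2
  rw [h2]
  exact P.raises_harmonic₀.proj_apply_of_singleton (by simp) x

theorem harmonic_harmonic (x : M) : P.harmonic (P.harmonic x) = P.harmonic x :=
  LinearMap.congr_fun P.harmonic_mul_self x

theorem total_harmonic_apply (x : M) : P.total (P.harmonic x) = P.harmonic (P.total x) :=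
  LinearMap.congr_fun (P.total_harmonic.trans P.harmonic_total.symm) x

theorem total_total (x : M) : P.total (P.total x) = 0 := LinearMap.congr_fun P.total_mul x

/-- The perturbed harmonic space. -/
abbrev Harm : Submodule 𝕜 M := LinearMap.range P.harmonic

theorem harmonic_eq {x : M} (hx : x ∈ P.Harm) : P.harmonic x = x := by
  obtain ⟨y, rfl⟩ := hx
  exact P.harmonic_harmonic y

theorem total_mem_harm {x : M} (hx : x ∈ P.Harm) : P.total x ∈ P.Harm :=
  ⟨P.total x, by rw [← P.total_harmonic_apply, P.harmonic_eq hx]⟩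

theorem parProj_mem_harm (e : ZMod 2) {x : M} (hx : x ∈ P.Harm) : P.parProj e x ∈ P.Harm :=
  ⟨P.parProj e x, by
    rw [P.raises_harmonic.parProj_comm (fun s hs => hs.2), P.harmonic_eq hx]⟩

/-- The perturbed harmonic space as a filtered complex. -/
def harmonicComplex : FilteredComplex 𝕜 N P.Harm V where
  F p := (P.F p).comap P.Harm.subtype
  par e := (P.par e).comap P.Harm.subtype
  D := P.total.restrict fun _ => P.total_mem_harm
  lead i := P.leading i ∘ₗ P.Harm.subtype
  D_D x := Subtype.ext (P.total_total x.1)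
  F_zero := by rw [FiniteGrading.F_zero, Submodule.comap_top]
  F_last := by rw [FiniteGrading.F_last, Submodule.comap_bot, Submodule.ker_subtype]
  F_anti _ _ h := Submodule.comap_mono (FiniteGrading.F_anti h)
  -- The leading component of a perturbed harmonic element is fixed by `harmonic₀`, which kills
  -- coboundaries; so it vanishes as soon as its class does.
  lead_eq_zero i x hx := by
    have hx' : x.1 ∈ P.F i := hx
    have h1 := P.proj_harmonic hx'
    rw [P.harmonic_eq x.2] at h1
    change P.leading i x.1 = 0 ↔ x.1 ∈ P.F (i + 1)
    rw [FiniteGrading.mem_F_succ hx', leading_apply, P.cls_eq_zero]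
    constructor
    · rintro ⟨y, hy⟩
      have h2 : P.harmonic₀ (P.d y) = 0 := LinearMap.congr_fun P.harmonic₀_d y
      have h3 : P.harmonic₀ (P.harmonic₀ (P.proj i x.1)) = P.harmonic₀ (P.proj i x.1) :=
        LinearMap.congr_fun P.harmonic₀_mul_self _
      change P.d y = P.harmonic₀ (P.proj i x.1) at hy
      rw [h1, ← h3, ← hy, h2]
    · intro h
      refine ⟨0, ?_⟩
      change P.d 0 = P.harmonic₀ (P.proj i x.1)
      rw [h, map_zero, map_zero]
  -- The perturbed harmonic part of a cocycle in the given class has the unperturbed harmonic part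
  -- as leading component.
  lead_surjective i v := by
    obtain ⟨z, rfl⟩ := P.cls_surjective i v
    have hz : z.1 ∈ P.F i := fun n hn => by
      rw [← P.proj_cocycle z, P.proj_proj, if_neg hn.ne]
    refine ⟨⟨P.harmonic z.1, z.1, rfl⟩, P.harmonic_mem_F hz, P.leading_of_proj_eq ?_⟩
    change P.proj i (P.harmonic z.1) = _
    rw [P.proj_harmonic hz, P.proj_cocycle]
  split i e x hx := by
    refine ⟨⟨P.parProj e x.1, P.parProj_mem_harm e x.2⟩,
      ⟨FiniteGrading.parProj_mem_F e hx, FiniteGrading.parProj_mem e x.1⟩,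
      ⟨P.parProj (e + 1) x.1, P.parProj_mem_harm _ x.2⟩,
      ⟨FiniteGrading.parProj_mem_F _ hx, FiniteGrading.parProj_mem _ x.1⟩,
      Subtype.ext (FiniteGrading.parProj_add e x.1).symm⟩
  disjoint e := by
    rw [Submodule.disjoint_def]
    intro x hx hx'
    exact Subtype.ext (Submodule.disjoint_def.1 (FiniteGrading.disjoint_par e) x.1 hx hx')
  F_par i e h x hx := FiniteGrading.F_inf_par (i : ℕ) h ⟨hx.1, hx.2⟩
  D_par e x hx := P.total_mem_par hx

/-- The projection to the perturbed harmonic space. -/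
def toHarm : M →ₗ[𝕜] P.Harm := P.harmonic.rangeRestrict

theorem toHarm_coe (x : P.Harm) : P.toHarm x.1 = x := Subtype.ext (P.harmonic_eq x.2)

theorem toHarm_total (x : M) : P.toHarm (P.total x) = P.harmonicComplex.D (P.toHarm x) :=
  Subtype.ext (P.total_harmonic_apply x).symm

theorem toHarm_mem_F {p : ℕ} {x : M} (hx : x ∈ P.F p) : P.toHarm x ∈ P.harmonicComplex.F p :=
  P.harmonic_mem_F hx

theorem toHarm_mem_par {e : ZMod 2} {x : M} (hx : x ∈ P.par e) :
    P.toHarm x ∈ P.harmonicComplex.par e :=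
  P.harmonic_mem_par hx

/-- Representatives may be replaced by their harmonic parts without changing the class of the
leading term; arbitrary spectral bases are brought into the harmonic space in this way. -/
theorem lead_toHarm {i : Fin (N + 1)} {x : M} {z : P.cocycles i}
    (hx : x - z.1 ∈ P.F (i + 1)) :
    P.toHarm x ∈ P.harmonicComplex.F i ∧ P.harmonicComplex.lead i (P.toHarm x) = P.cls i z := by
  have hz : z.1 ∈ P.F i := fun n hn => by
    rw [← P.proj_cocycle z, P.proj_proj, if_neg hn.ne]
  have hx' : x ∈ P.F i := by
    rw [← sub_add_cancel x z.1]
    exact Submodule.add_mem _ (FiniteGrading.F_anti (Nat.le_succ _) hx) hz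
  refine ⟨P.toHarm_mem_F hx', P.leading_of_proj_eq ?_⟩
  change P.proj i (P.harmonic x) = _
  rw [P.proj_harmonic hx']
  have h := hx i (Nat.lt_succ_self _)
  rw [map_sub, sub_eq_zero, P.proj_cocycle] at h
  rw [h]

theorem exists_cocycle {i : Fin (N + 1)} {x : P.Harm} (hx : x ∈ P.harmonicComplex.F i) :
    ∃ z : P.cocycles i, x.1 - z.1 ∈ P.F (i + 1) ∧ P.cls i z = P.harmonicComplex.lead i x := by
  refine ⟨⟨_, P.harmonic₀_proj_mem i x.1⟩, ?_, rfl⟩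
  have hx' : x.1 ∈ P.F i := hx
  have h1 := P.proj_harmonic hx'
  rw [P.harmonic_eq x.2] at h1
  change x.1 - P.harmonic₀ (P.proj i x.1) ∈ _
  rw [← h1, FiniteGrading.mem_F_succ (Submodule.sub_mem _ hx' ?_), map_sub, P.proj_proj,
    if_pos rfl, sub_self]
  intro n hn
  rw [P.proj_proj, if_neg hn.ne]

/-- A cocycle of the perturbed complex is cohomologous to its harmonic part. -/
theorem sub_toHarm {x : M} (hx : P.total x = 0) :
    x - (P.toHarm x).1 = P.total (P.totalContraction x) := by
  change x - P.harmonic x = _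
  rw [harmonic, LinearMap.sub_apply, LinearMap.sub_apply, Module.End.mul_apply,
    Module.End.mul_apply, hx, map_zero, sub_zero, Module.End.one_apply, sub_sub_cancel]

end PerturbedComplex

/-! ### Generators of determinant lines -/

section Lines

variable {𝕜 : Type*} [Field 𝕜]

/-- A generator of a line as a basis. -/
def lineBasis {L : Type*} [AddCommGroup L] [Module 𝕜 L] (v : L) (φ : L →ₗ[𝕜] 𝕜)
    (hφ : φ v = 1) (h : ∀ w, φ w • v = w) : Module.Basis Unit 𝕜 L :=
  Module.Basis.mk (v := fun _ => v)
    (linearIndependent_unique_iff.2 fun h0 => by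
      change v = 0 at h0
      rw [h0, map_zero] at hφ
      exact zero_ne_one hφ)
    (fun w _ => by
      rw [← h w]
      exact Submodule.smul_mem _ _ (Submodule.subset_span ⟨(), rfl⟩))

theorem lineBasis_apply {L : Type*} [AddCommGroup L] [Module 𝕜 L] (v : L) (φ : L →ₗ[𝕜] 𝕜)
    (hφ : φ v = 1) (h : ∀ w, φ w • v = w) (i : Unit) : lineBasis v φ hφ h i = v := by
  rw [lineBasis, Module.Basis.mk_apply]

variable {W : Type*} [AddCommGroup W] [Module 𝕜 W] {I : Type*} [LinearOrder I] [Fintype I]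

/-- The top exterior power is a line and `Det.vol b` is a nonzero vector in it. -/
theorem Det.dualVol_smul_vol (b : Module.Basis I 𝕜 W) (w : Det 𝕜 W) :
    Det.dualVol b w • Det.vol b = w := by
  have : FiniteDimensional 𝕜 W := Module.Finite.of_basis b
  have h1 : Module.finrank 𝕜 (Det 𝕜 W) = 1 := by
    rw [exteriorPower.finrank_eq, Nat.choose_self]
  have h0 : Det.vol b ≠ 0 := fun h => by
    have := Det.dualVol_vol b
    rw [h, map_zero] at this
    exact zero_ne_one this
  obtain ⟨c, rfl⟩ := (finrank_eq_one_iff_of_nonzero' _ h0).1 h1 w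
  rw [map_smul, Det.dualVol_vol, smul_eq_mul, mul_one]

theorem Det.vol_apply_smul_dualVol (b : Module.Basis I 𝕜 W) (f : Module.Dual 𝕜 (Det 𝕜 W)) :
    f (Det.vol b) • Det.dualVol b = f := by
  refine LinearMap.ext fun w => ?_
  conv_rhs => rw [← Det.dualVol_smul_vol b w]
  rw [LinearMap.smul_apply, map_smul, smul_eq_mul, smul_eq_mul, mul_comm]

/-- Both bases have the same ordered index set, so both are renumbered in the same way and no sign
of a permutation enters. -/
theorem Det.vol_eq_smul (b b' : Module.Basis I 𝕜 W) :
    Det.vol b' = (b.toMatrix b').det • Det.vol b := by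
  have h : Det.dualVol b (Det.vol b') = (b.toMatrix b').det := by
    rw [Det.dualVol, Det.vol, exteriorPower.alternatingMapLinearEquiv_apply_ιMulti, finBasis,
      finBasis, Module.Basis.det_reindex, Module.Basis.det_apply]
    congr 2
    ext i
    simp
  rw [← h, Det.dualVol_smul_vol]

theorem Det.dualVol_eq_smul (b b' : Module.Basis I 𝕜 W) :
    Det.dualVol b' = (b.toMatrix b').det⁻¹ • Det.dualVol b := by
  have h0 : (b.toMatrix b').det ≠ 0 := (Module.Basis.isUnit_det b b').ne_zero
  have h := Det.vol_apply_smul_dualVol b' ((b.toMatrix b').det⁻¹ • Det.dualVol b)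
  rw [LinearMap.smul_apply, Det.vol_eq_smul b b', map_smul, Det.dualVol_vol, smul_eq_mul,
    smul_eq_mul, mul_one, inv_mul_cancel₀ h0, one_smul] at h
  exact h

/-- The basis of the line `det W` given by a basis of `W`. -/
def Det.basis (b : Module.Basis I 𝕜 W) : Module.Basis Unit 𝕜 (Det 𝕜 W) :=
  lineBasis (Det.vol b) (Det.dualVol b) (Det.dualVol_vol b) (Det.dualVol_smul_vol b)

/-- The basis of the line `(det W)⁻¹` given by a basis of `W`. -/
def Det.dualBasis (b : Module.Basis I 𝕜 W) : Module.Basis Unit 𝕜 (Module.Dual 𝕜 (Det 𝕜 W)) :=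
  lineBasis (Det.dualVol b) (Module.Dual.eval 𝕜 _ (Det.vol b)) (Det.dualVol_vol b)
    (Det.vol_apply_smul_dualVol b)

theorem Det.basis_apply (b : Module.Basis I 𝕜 W) (i : Unit) : Det.basis b i = Det.vol b :=
  lineBasis_apply _ _ _ _ i

theorem Det.dualBasis_apply (b : Module.Basis I 𝕜 W) (i : Unit) :
    Det.dualBasis b i = Det.dualVol b :=
  lineBasis_apply _ _ _ _ i

section Graded

variable {N : ℕ} {H : ℕ → Type*} [∀ i, AddCommGroup (H i)] [∀ i, Module 𝕜 (H i)]
  {J : Fin (N + 1) → Type*} [∀ i, LinearOrder (J i)] [∀ i, Fintype (J i)]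

/-- The generator of the determinant line of a graded vector space given by bases. -/
def gradedVol (b : ∀ i : Fin (N + 1), Module.Basis (J i) 𝕜 (H i)) : DetGraded 𝕜 N H :=
  (PiTensorProduct.tprod 𝕜 fun i => Det.vol (b i.1)) ⊗ₜ[𝕜]
    (PiTensorProduct.tprod 𝕜 fun i => Det.dualVol (b i.1))

theorem exists_gradedBasis (b : ∀ i : Fin (N + 1), Module.Basis (J i) 𝕜 (H i)) :
    ∃ β : Module.Basis Unit 𝕜 (DetGraded 𝕜 N H), β () = gradedVol b := by
  refine ⟨((Basis.piTensorProduct fun i : {i : Fin (N + 1) // Even (i : ℕ)} =>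
    Det.basis (b i.1)).tensorProduct (Basis.piTensorProduct fun i :
      {i : Fin (N + 1) // ¬ Even (i : ℕ)} => Det.dualBasis (b i.1))).reindex
      ⟨fun _ => (), fun _ => (fun _ => (), fun _ => ()), fun _ => rfl, fun _ => rfl⟩, ?_⟩
  rw [Module.Basis.reindex_apply]
  change Module.Basis.tensorProduct _ _ (fun _ => (), fun _ => ()) = _
  rw [Module.Basis.tensorProduct_apply, Basis.piTensorProduct_apply, Basis.piTensorProduct_apply]
  simp only [Det.basis_apply, Det.dualBasis_apply]
  rfl

theorem gradedVol_eq_smul (b b' : ∀ i : Fin (N + 1), Module.Basis (J i) 𝕜 (H i)) :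
    gradedVol b' = ((∏ i : {i : Fin (N + 1) // Even (i : ℕ)}, ((b i.1).toMatrix (b' i.1)).det) *
      ∏ i : {i : Fin (N + 1) // ¬ Even (i : ℕ)}, ((b i.1).toMatrix (b' i.1)).det⁻¹) •
        gradedVol b := by
  have h1 : ∀ i, Det.vol (b' i) = ((b i).toMatrix (b' i)).det • Det.vol (b i) := fun i =>
    Det.vol_eq_smul _ _
  have h2 : ∀ i, Det.dualVol (b' i) = ((b i).toMatrix (b' i)).det⁻¹ • Det.dualVol (b i) := fun i =>
    Det.dualVol_eq_smul _ _
  rw [gradedVol, gradedVol]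
  simp only [h1, h2]
  rw [MultilinearMap.map_smul_univ, MultilinearMap.map_smul_univ, TensorProduct.smul_tmul_smul]

end Graded

section Mod2

variable {H : ZMod 2 → Type*} [∀ i, AddCommGroup (H i)] [∀ i, Module 𝕜 (H i)]
  {J : ZMod 2 → Type*} [∀ i, LinearOrder (J i)] [∀ i, Fintype (J i)]

/-- The generator of the determinant line of a `ℤ/2`-graded vector space given by bases. -/
def mod2Vol (b : ∀ e, Module.Basis (J e) 𝕜 (H e)) : DetMod2 𝕜 H :=
  Det.vol (b 0) ⊗ₜ[𝕜] Det.dualVol (b 1)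

theorem exists_mod2Basis (b : ∀ e, Module.Basis (J e) 𝕜 (H e)) :
    ∃ β : Module.Basis Unit 𝕜 (DetMod2 𝕜 H), β () = mod2Vol b := by
  refine ⟨((Det.basis (b 0)).tensorProduct (Det.dualBasis (b 1))).reindex
    ⟨fun _ => (), fun _ => ((), ()), fun _ => rfl, fun _ => rfl⟩, ?_⟩
  rw [Module.Basis.reindex_apply]
  change Module.Basis.tensorProduct _ _ ((), ()) = _
  rw [Module.Basis.tensorProduct_apply]
  simp only [Det.basis_apply, Det.dualBasis_apply]
  rfl

theorem mod2Vol_eq_smul (b b' : ∀ e, Module.Basis (J e) 𝕜 (H e)) :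
    mod2Vol b' = (((b 0).toMatrix (b' 0)).det * ((b 1).toMatrix (b' 1)).det⁻¹) • mod2Vol b := by
  rw [mod2Vol, mod2Vol, Det.vol_eq_smul (b 0) (b' 0), Det.dualVol_eq_smul (b 1) (b' 1),
    TensorProduct.smul_tmul_smul]

end Mod2

end Lines

namespace OrderedComplex

section Deck

variable {V : Type*} [PartialOrder V] {K : OrderedComplex V} {v₀ : V}

/-! ### Covering transformations -/

theorem edge_comp_edge {u v w : V} (h : ∃ s ∈ K.faces, u ∈ s ∧ v ∈ s ∧ w ∈ s)
    (a : ∃ s ∈ K.faces, u ∈ s ∧ v ∈ s) (b : ∃ s ∈ K.faces, v ∈ s ∧ w ∈ s)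
    (c : ∃ s ∈ K.faces, u ∈ s ∧ w ∈ s) : K.edge a ≫ K.edge b = K.edge c :=
  ((Quotient.functor K.EdgeRel).map_comp _ _).symm.trans
    (CategoryTheory.Quotient.sound _ (EdgeRel.triangle (K := K) u v w h ⟨a⟩ ⟨b⟩ ⟨c⟩))

theorem isIso_edge {v w : V} (h : ∃ s ∈ K.faces, v ∈ s ∧ w ∈ s) : IsIso (K.edge h) := by
  obtain ⟨s, hs, hv, hw⟩ := h
  refine ⟨K.edge ⟨s, hs, hw, hv⟩, ?_, ?_⟩
  · rw [edge_comp_edge ⟨s, hs, hv, hw, hv⟩ _ _ ⟨s, hs, hv, hv⟩, edge_self]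
  · rw [edge_comp_edge ⟨s, hs, hw, hv, hw⟩ _ _ ⟨s, hs, hw, hw⟩, edge_self]

/-- Edge paths are invertible up to homotopy. -/
theorem isIso_edgePath {v w : V} (f : K.obj v ⟶ K.obj w) : IsIso f := by
  obtain ⟨p, rfl⟩ := (Quotient.functor K.EdgeRel).map_surjective f
  have key : ∀ {b : Paths K.Pt} (p : (Paths.of K.Pt).obj v ⟶ b),
      IsIso ((Quotient.functor K.EdgeRel).map p) := by
    intro b p
    refine Paths.induction_fixed_source (a := (Paths.of K.Pt).obj v)
      (P := fun {b} p => IsIso ((Quotient.functor K.EdgeRel).map p)) ?_ ?_ p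
    · rw [(Quotient.functor K.EdgeRel).map_id]
      infer_instance
    · intro u u' p q hp
      have hq : IsIso ((Quotient.functor K.EdgeRel).map ((Paths.of K.Pt).map q)) :=
        isIso_edge q.down
      rw [(Quotient.functor K.EdgeRel).map_comp]
      infer_instance
  exact key p

/-- The path to `y` is the path to `x` followed by the edge, and a covering transformation composes
at the beginning of paths; so what it does to `x` determines what it does to `y`. -/
theorem CoverVertex.deck_eq_of_edge {x x' y y' : K.CoverVertex v₀} {g : K.π₁ v₀}
    (hx : x.pt = x'.pt) (hy : y.pt = y'.pt)
    (h : ∃ h : ∃ t ∈ K.faces, x.pt ∈ t ∧ y.pt ∈ t, x.path ≫ K.edge h = y.path)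
    (h' : ∃ h : ∃ t ∈ K.faces, x'.pt ∈ t ∧ y'.pt ∈ t, x'.path ≫ K.edge h = y'.path)
    (hg : x.deck g = x') : y.deck g = y' := by
  obtain ⟨p, a⟩ := x
  obtain ⟨p', a'⟩ := x'
  obtain ⟨q, b⟩ := y
  obtain ⟨q', b'⟩ := y'
  obtain rfl : p = p' := hx
  obtain rfl : q = q' := hy
  obtain ⟨h, hb⟩ := h
  obtain ⟨h', hb'⟩ := h'
  have e : ∃ t ∈ K.faces, p ∈ t ∧ q ∈ t := h
  replace hb : a ≫ K.edge e = b := hb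
  replace hb' : a' ≫ K.edge e = b' := hb'
  clear h h'
  subst hb hb'
  have ha : g.inv ≫ a = a' := by simpa [CoverVertex.deck] using hg
  simp only [CoverVertex.deck, ← ha, Category.assoc]

theorem CoverVertex.exists_deck_eq {x x' : K.CoverVertex v₀} (hx : x.pt = x'.pt) :
    ∃ g : K.π₁ v₀, x.deck g = x' := by
  obtain ⟨p, a⟩ := x
  obtain ⟨p', a'⟩ := x'
  obtain rfl : p = p' := hx
  have := isIso_edgePath a
  have := isIso_edgePath a'
  -- The action composes with the inverse of `g`, hence the order of the two paths in `g`.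
  refine ⟨⟨a ≫ inv a', a' ≫ inv a, by simp, by simp⟩, ?_⟩
  simp [CoverVertex.deck]

/-- The group acts transitively on the lifts of a simplex: match the first vertices, and the
remaining ones follow along the edges. -/
theorem Simplex.exists_deck_eq {q : ℕ} {s s' : (K.cover v₀).Simplex q} (h : s.proj = s'.proj) :
    ∃ g : K.π₁ v₀, s.deck g = s' := by
  have hpt : ∀ i, (s.1 i).pt = (s'.1 i).pt := fun i =>
    DFunLike.congr_fun (congrArg Subtype.val h) i
  obtain ⟨g, hg⟩ := CoverVertex.exists_deck_eq (hpt 0)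
  refine ⟨g, Subtype.ext (DFunLike.ext _ _ fun i => ?_)⟩
  exact CoverVertex.deck_eq_of_edge (hpt 0) (hpt i) (s.2.2.2 _ (by simp) _ (by simp))
    (s'.2.2.2 _ (by simp) _ (by simp)) hg

end Deck

/-! ### Finite dimensionality of the cochain groups. -/

section Hom

variable {V : Type*} [PartialOrder V] {K : OrderedComplex V} {v₀ : V}
variable {𝕜 E : Type*} [RCLike 𝕜] [AddCommGroup E] [Module 𝕜 E] [Module ℝ E] [IsScalarTower ℝ 𝕜 E]
  {ρ : Representation 𝕜 (K.π₁ v₀) E}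

/-- Equivariance determines a cochain by its value on one lift of each simplex. -/
theorem cochains_ext {n : ℤ} {f : (K.cover v₀).Chain →ₗ[ℝ] E} (hf : f ∈ K.cochains ρ ℤ n)
    (h : ∀ q (s : K.Simplex q), ∀ s' : (K.cover v₀).Simplex q, s'.proj = s →
      ∃ s'' : (K.cover v₀).Simplex q, s''.proj = s ∧ f (Finsupp.single ⟨q, s''⟩ 1) = 0) :
    f = 0 := by
  refine Finsupp.lhom_ext' fun x => LinearMap.ext_ring ?_
  obtain ⟨q, s⟩ := x
  obtain ⟨s'', hs, hf0⟩ := h q s.proj s rfl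
  obtain ⟨g, rfl⟩ := Simplex.exists_deck_eq hs
  have h1 := hf.1 g (Finsupp.single ⟨q, s''⟩ 1)
  rw [hf0, map_zero, Chain.deck, Finsupp.lmapDomain_apply, Finsupp.mapDomain_single] at h1
  exact h1

instance finite_simplex [Finite V] (q : ℕ) : Finite (K.Simplex q) :=
  Finite.of_injective (fun s : K.Simplex q => (s.1 : Fin (q + 1) → V)) fun _ _ h =>
    Subtype.ext (DFunLike.coe_injective h)

theorem finiteDimensional_cochains [Finite V] [FiniteDimensional 𝕜 E] (n : ℤ) :
    FiniteDimensional 𝕜 (K.cochains ρ ℤ n) := by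
  classical
  let ev : K.cochains ρ ℤ n →ₗ[𝕜] ((Σ q : Fin (K.dim + 1), K.Simplex q) → E) :=
    -- Evaluation on a chosen lift of each simplex of `K`, with default `0` if there is none; such a
    -- simplex carries no simplex of the covering, so injectivity is not affected.
    { toFun := fun f s => if h : ∃ s' : (K.cover v₀).Simplex s.1, s'.proj = s.2 then
        f.1 (Finsupp.single ⟨s.1, h.choose⟩ 1) else 0
      map_add' := fun f f' => by
        funext s
        simp only [Pi.add_apply]
        split_ifs
        · rfl
        · rw [add_zero]
      map_smul' := fun a f => by
        funext s
        simp only [Pi.smul_apply, RingHom.id_apply]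
        split_ifs
        · rfl
        · rw [smul_zero] }
  refine FiniteDimensional.of_injective ev ?_
  rw [injective_iff_map_eq_zero]
  intro f hf
  refine Subtype.ext (cochains_ext f.2 fun q s s' hs => ?_)
  have h : ∃ s' : (K.cover v₀).Simplex q, s'.proj = s := ⟨s', hs⟩
  have h1 := congrFun hf ⟨⟨q, Nat.lt_succ_of_le s.le_dim⟩, s⟩
  refine ⟨h.choose, h.choose_spec, ?_⟩
  have h2 : ev f ⟨⟨q, Nat.lt_succ_of_le s.le_dim⟩, s⟩ =
      f.1 (Finsupp.single ⟨q, h.choose⟩ 1) := dif_pos h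
  rw [← h2, h1]
  rfl

theorem finiteDimensional_H [Finite V] [FiniteDimensional 𝕜 E] (n : ℤ) :
    FiniteDimensional 𝕜 (K.H ρ n) := by
  have := finiteDimensional_cochains (ρ := ρ) n
  have : FiniteDimensional 𝕜 (Cocycles (K.cochains ρ ℤ) (K.dCochains v₀ 𝕜 E) n) :=
    Submodule.finiteDimensional_of_le inf_le_left
  infer_instance

end Hom

/-! ### The grading of currents -/

section Grading

variable {V : Type*} [PartialOrder V] (K : OrderedComplex V)

/-- The projection of `Du_•(K)` to `Du_n(K)`. -/
def Du.proj (n : ℕ) : K.Du →ₗ[ℝ] K.Du :=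
  Du.lift K fun x j => if x.1 = n + j then Du.of K x.2 j else 0

variable {K}

theorem Du.proj_of (n : ℕ) {q : ℕ} (s : K.Simplex q) (j : ℕ) (φ : Form q j) :
    Du.proj K n (Du.of K s j φ) = if q = n + j then Du.of K s j φ else 0 := by
  rw [Du.proj, Du.lift_of]
  split_ifs <;> rfl

theorem Du.proj_comp_proj (m n : ℕ) :
    Du.proj K m ∘ₗ Du.proj K n = if m = n then Du.proj K m else 0 := by
  refine Du.hom_ext K fun q s j φ => ?_
  rw [LinearMap.comp_apply, Du.proj_of]
  by_cases h : q = n + j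
  · rw [if_pos h, Du.proj_of]
    by_cases hmn : m = n
    · rw [if_pos (hmn ▸ h), if_pos hmn, Du.proj_of, if_pos (hmn ▸ h)]
    · rw [if_neg (by omega), if_neg hmn, LinearMap.zero_apply]
  · rw [if_neg h, map_zero]
    split_ifs with hmn
    · rw [Du.proj_of, if_neg (hmn ▸ h)]
    · rfl

theorem Du.of_eq_zero_of_lt {q j : ℕ} (h : q < j) (s : K.Simplex q) (φ : Form q j) :
    Du.of K s j φ = 0 := by
  rw [Form.eq_zero_of_lt h φ, map_zero]

theorem Du.sum_proj {N : ℕ} (hN : ∀ q, K.Simplex q → q ≤ N) :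
    ∑ n ∈ Finset.range (N + 1), Du.proj K n = LinearMap.id := by
  refine Du.hom_ext K fun q s j φ => ?_
  rw [LinearMap.sum_apply, LinearMap.id_apply]
  rcases Nat.lt_or_ge q j with h | h
  · simp only [Du.of_eq_zero_of_lt h s φ, map_zero, Finset.sum_const_zero]
  · have := hN q s
    rw [Finset.sum_eq_single (q - j)]
    · rw [Du.proj_of, if_pos (by omega)]
    · intro n _ hn
      rw [Du.proj_of, if_neg (by omega)]
    · intro hn
      exact absurd (Finset.mem_range.2 (by omega)) hn

theorem Du.proj_eq_zero_of_supp {n : ℕ} {x : K.Du} (hx : x ∈ Du.supp K fun l => l ≠ n) :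
    Du.proj K n x = 0 := by
  have h : Du.supp K (fun l => l ≠ n) ≤ LinearMap.ker (Du.proj K n) :=
    Du.supp_le fun q s j φ hq => by
      rw [LinearMap.mem_ker, Du.proj_of, if_neg]
      omega
  exact h hx

theorem Du.proj_comp_comp_proj {A : K.Du →ₗ[ℝ] K.Du} {R : ℤ → ℤ → Prop} (hA : Du.Shifts A R)
    {m n : ℕ} (h : ¬ R m n) : Du.proj K n ∘ₗ A ∘ₗ Du.proj K m = 0 := by
  refine Du.hom_ext K fun q s j φ => ?_
  rw [LinearMap.comp_apply, LinearMap.comp_apply, LinearMap.zero_apply, Du.proj_of]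
  split_ifs with hq
  · refine Du.proj_eq_zero_of_supp ?_
    refine Du.supp_mono ?_ (hA q s j φ)
    rintro l hl rfl
    refine h ?_
    have : (q : ℤ) - j = m := by omega
    rwa [this] at hl
  · rw [map_zero, map_zero]

end Grading

section Complex

variable {V : Type*} [PartialOrder V] {K : OrderedComplex V} {v₀ : V}
variable {𝕜 E : Type*} [RCLike 𝕜] [AddCommGroup E] [Module 𝕜 E] [Module ℝ E] [IsScalarTower ℝ 𝕜 E]

theorem Du.equivariant_proj (n : ℕ) : Du.Equivariant (Du.proj (K.cover v₀) n) := fun g => by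
  refine Du.hom_ext _ fun q s j φ => ?_
  rw [LinearMap.comp_apply, LinearMap.comp_apply, Du.deck_of, Du.proj_of, Du.proj_of]
  split_ifs
  · rw [Du.deck_of]
  · rw [map_zero]

variable (ρ : Representation 𝕜 (K.π₁ v₀) E)

variable {ρ} in
-- There are no currents of negative degree, so `F_0` is the whole space of equivariant functionals.
theorem mem_filtration_zero {f : (K.cover v₀).Du →ₗ[ℝ] E}
    (hf : ∀ g c, f (Du.deck K g c) = ρ g (f c)) : f ∈ K.filtration ρ 0 :=
  ⟨hf, fun q s j φ h => by rw [Du.of_eq_zero_of_lt (by omega), map_zero]⟩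

/-- `𝔪^•(K, E)`, as a vector space. -/
abbrev Currents : Submodule 𝕜 ((K.cover v₀).Du →ₗ[ℝ] E) := K.filtration ρ 0

/-- The operator on `𝔪^•(K, E)` induced by an operator on `Du_•(K̃)`. -/
def compEnd {A : (K.cover v₀).Du →ₗ[ℝ] (K.cover v₀).Du} (hA : Du.Equivariant A) :
    Module.End 𝕜 (Currents ρ) :=
  (LinearMap.lcomp 𝕜 E A).restrict fun _ hf => mem_filtration_zero (comp_deck hA hf.1)

variable [Finite V]

/-- The grading of `𝔪^•(K, E)`. -/
def currentsGrading : FiniteGrading 𝕜 K.dim (Currents ρ) where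
  proj n := compEnd ρ (Du.equivariant_proj n)
  proj_mul m n := LinearMap.ext fun f => Subtype.ext <| by
    change (f.1 ∘ₗ Du.proj _ n) ∘ₗ Du.proj _ m = _
    rw [LinearMap.comp_assoc, Du.proj_comp_proj]
    split_ifs with h h' h'
    · rw [h]; rfl
    · exact absurd h.symm h'
    · exact absurd h'.symm h
    · rw [LinearMap.comp_zero]; rfl
  sum_proj := LinearMap.ext fun f => Subtype.ext <| by
    rw [LinearMap.sum_apply, Submodule.coe_sum]
    change ∑ n ∈ Finset.range (K.dim + 1), f.1 ∘ₗ Du.proj _ n = f.1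
    have h := Du.sum_proj (K := K.cover v₀) (N := K.dim) fun q s => s.proj.le_dim
    refine LinearMap.ext fun x => ?_
    rw [LinearMap.sum_apply]
    simp only [LinearMap.comp_apply]
    rw [← map_sum, ← LinearMap.sum_apply, h, LinearMap.id_apply]

theorem currentsGrading_proj (n : ℕ) (f : Currents ρ) :
    ((currentsGrading ρ).proj n f).1 = f.1 ∘ₗ Du.proj _ n := rfl

theorem raises_compEnd {A : (K.cover v₀).Du →ₗ[ℝ] (K.cover v₀).Du} (hA : Du.Equivariant A)
    {R : ℤ → ℤ → Prop} (hR : Du.Shifts A R) {S : Set ℤ} (h : ∀ m n, R m n → m - n ∈ S) :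
    (currentsGrading ρ).Raises S (compEnd ρ hA) := fun m n hmn =>
  LinearMap.ext fun f => Subtype.ext <| by
    change ((f.1 ∘ₗ Du.proj _ n) ∘ₗ A) ∘ₗ Du.proj _ m = 0
    rw [LinearMap.comp_assoc, LinearMap.comp_assoc,
      Du.proj_comp_comp_proj hR fun h' => hmn (h _ _ h'), LinearMap.comp_zero]

variable {ρ}

/-- The filtration is indexed by integer degrees, the grading by natural ones; they match because
the summands with `q < j` vanish. -/
theorem mem_F_iff {p : ℕ} {f : Currents ρ} :
    f ∈ (currentsGrading ρ).F p ↔ f.1 ∈ K.filtration ρ p := by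
  constructor
  · intro h
    refine ⟨f.2.1, fun q s j φ hq => ?_⟩
    rcases Nat.lt_or_ge q j with hqj | hqj
    · rw [Du.of_eq_zero_of_lt hqj, map_zero]
    · have h1 := LinearMap.congr_fun (congrArg Subtype.val (h (q - j) (by omega))) (Du.of _ s j φ)
      rw [currentsGrading_proj, LinearMap.comp_apply, Du.proj_of, if_pos (by omega)] at h1
      exact h1
  · intro h n hn
    refine Subtype.ext (Du.hom_ext _ fun q s j φ => ?_)
    rw [currentsGrading_proj, LinearMap.comp_apply, Du.proj_of]
    split_ifs with hq
    · rw [h.2 q s j φ (by omega)]; rfl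
    · rw [map_zero]; rfl

theorem mem_par_iff {e : ZMod 2} {f : Currents ρ} :
    f ∈ (currentsGrading ρ).par e ↔ f.1 ∈ K.currents ρ (ZMod 2) e := by
  constructor
  · intro h
    refine ⟨f.2.1, fun q s j φ hq => ?_⟩
    rcases Nat.lt_or_ge q j with hqj | hqj
    · rw [Du.of_eq_zero_of_lt hqj, map_zero]
    · have h1 := LinearMap.congr_fun (congrArg Subtype.val (h (q - j) (by
        rwa [Nat.cast_sub hqj]))) (Du.of _ s j φ)
      rw [currentsGrading_proj, LinearMap.comp_apply, Du.proj_of, if_pos (by omega)] at h1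
      exact h1
  · intro h n hn
    refine Subtype.ext (Du.hom_ext _ fun q s j φ => ?_)
    rw [currentsGrading_proj, LinearMap.comp_apply, Du.proj_of]
    split_ifs with hq
    · rw [h.2 q s j φ (by rw [hq]; push_cast; simpa using hn)]; rfl
    · rw [map_zero]; rfl

theorem proj_eq_self_iff {n : ℕ} {f : Currents ρ} :
    (currentsGrading ρ).proj n f = f ↔ f.1 ∈ K.currents ρ ℤ n := by
  constructor
  · intro h
    refine ⟨f.2.1, fun q s j φ hq => ?_⟩
    rw [← h, currentsGrading_proj, LinearMap.comp_apply, Du.proj_of, if_neg, map_zero]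
    simp only [ne_eq] at hq
    omega
  · intro h
    refine Subtype.ext (Du.hom_ext _ fun q s j φ => ?_)
    rw [currentsGrading_proj, LinearMap.comp_apply, Du.proj_of]
    split_ifs with hq
    · rfl
    · rw [map_zero, h.2 q s j φ (by simp only [ne_eq]; omega)]

end Complex

end OrderedComplex

/-! ### Graded complexes of subspaces of a vector space -/

section Restrict

variable {𝕜 : Type*} [Field 𝕜] {N : ℕ} {X : Type*} [AddCommGroup X] [Module 𝕜 X]
  {C : Submodule 𝕜 X} (G : FiniteGrading 𝕜 N C) {δ : X →ₗ[𝕜] X} {D : Module.End 𝕜 C}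

section Integral

variable {A : ℤ → Submodule 𝕜 X}

theorem mem_cocycles_of_mem_ker (hD : ∀ f, (D f).1 = δ f.1)
    (hA : ∀ (n : ℕ) (f : C), G.proj n f = f ↔ f.1 ∈ A n) {n : ℕ} {z : C}
    (hz : z ∈ LinearMap.ker (1 - G.proj n) ⊓ LinearMap.ker D) : z.1 ∈ Cocycles A δ n :=
  ⟨(hA n z).1 (sub_eq_zero.1 (LinearMap.mem_ker.1 hz.1)).symm,
    LinearMap.mem_ker.2 <| by rw [← hD, LinearMap.mem_ker.1 hz.2]; rfl⟩

theorem mem_ker_of_mem_cocycles (hD : ∀ f, (D f).1 = δ f.1)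
    (hA : ∀ (n : ℕ) (f : C), G.proj n f = f ↔ f.1 ∈ A n) {n : ℕ} {z : C}
    (hz : z.1 ∈ Cocycles A δ n) : z ∈ LinearMap.ker (1 - G.proj n) ⊓ LinearMap.ker D :=
  ⟨LinearMap.mem_ker.2 <| sub_eq_zero.2 ((hA n z).2 hz.1).symm,
    LinearMap.mem_ker.2 <| Subtype.ext <| by rw [hD]; exact LinearMap.mem_ker.1 hz.2⟩

variable {H : Type*} [AddCommGroup H] [Module 𝕜 H] (n : ℕ) (Ψ : Coh A δ (n : ℤ) →ₗ[𝕜] H)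

/-- The image under `Ψ` of the class of a homogeneous cocycle. -/
def gradedClass (hD : ∀ f, (D f).1 = δ f.1)
    (hA : ∀ (n : ℕ) (f : C), G.proj n f = f ↔ f.1 ∈ A n) :
    ↥(LinearMap.ker (1 - G.proj n) ⊓ LinearMap.ker D) →ₗ[𝕜] H :=
  Ψ ∘ₗ Coh.mk A δ (n : ℤ) ∘ₗ (C.subtype ∘ₗ Submodule.subtype _).codRestrict
    (Cocycles A δ (n : ℤ)) fun z => mem_cocycles_of_mem_ker G hD hA z.2

variable (hD : ∀ f, (D f).1 = δ f.1) (hA : ∀ (n : ℕ) (f : C), G.proj n f = f ↔ f.1 ∈ A n)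

theorem gradedClass_apply (z : ↥(LinearMap.ker (1 - G.proj n) ⊓ LinearMap.ker D)) :
    gradedClass G n Ψ hD hA z =
      Ψ (Coh.mk A δ (n : ℤ) ⟨z.1.1, mem_cocycles_of_mem_ker G hD hA z.2⟩) := rfl

theorem represents_iff_gradedClass (hC : ∀ n, A n ≤ C) (F : Submodule 𝕜 X) (f : C) (γ : H) :
    (∃ z : Cocycles A δ (n : ℤ), f.1 - z.1 ∈ F ∧ Ψ (Coh.mk A δ (n : ℤ) z) = γ) ↔
      ∃ z : ↥(LinearMap.ker (1 - G.proj n) ⊓ LinearMap.ker D),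
        (f - z.1).1 ∈ F ∧ gradedClass G n Ψ hD hA z = γ := by
  constructor
  · rintro ⟨z, hz, h⟩
    exact ⟨⟨⟨z.1, hC _ z.2.1⟩, mem_ker_of_mem_cocycles G hD hA z.2⟩, hz, h⟩
  · rintro ⟨z, hz, h⟩
    exact ⟨⟨z.1.1, mem_cocycles_of_mem_ker G hD hA z.2⟩, hz, h⟩

theorem gradedClass_surjective (hC : ∀ n, A n ≤ C) (hΨ : Function.Bijective Ψ) :
    Function.Surjective (gradedClass G n Ψ hD hA) := by
  intro γ
  obtain ⟨γ', rfl⟩ := hΨ.2 γ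
  obtain ⟨z, rfl⟩ := OrderedComplex.Coh.mk_surjective A δ (n : ℤ) γ'
  exact ⟨⟨⟨z.1, hC _ z.2.1⟩, mem_ker_of_mem_cocycles G hD hA z.2⟩, rfl⟩

theorem gradedClass_eq_zero (hC : ∀ n, A n ≤ C) (hR : G.Raises {1} D)
    (hΨ : Function.Bijective Ψ) (z : ↥(LinearMap.ker (1 - G.proj n) ⊓ LinearMap.ker D)) :
    gradedClass G n Ψ hD hA z = 0 ↔ ∃ y, D y = z.1 := by
  rw [gradedClass_apply, map_eq_zero_iff _ hΨ.1, OrderedComplex.Coh.mk_eq_zero]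
  constructor
  · rintro ⟨y, hy, hyz⟩
    exact ⟨⟨y, hC _ hy⟩, Subtype.ext ((hD _).trans hyz)⟩
  · rintro ⟨y, hy⟩
    have hz : G.proj n z.1 = z.1 := (sub_eq_zero.1 (LinearMap.mem_ker.1 z.2.1)).symm
    cases n with
    | zero =>
      -- In degree `0` there is nothing below: a coboundary has no component of degree `0`, so the
      -- cocycle itself is zero.
      refine ⟨0, Submodule.zero_mem _, ?_⟩
      rw [map_zero]
      change 0 = z.1.1
      rw [← hz, ← hy, FiniteGrading.proj_apply_eq_sum, Finset.sum_eq_zero]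
      · rfl
      · intro l _
        refine hR.proj_apply_proj ?_ y
        simp only [Set.mem_singleton_iff]
        omega
    | succ n =>
      -- An arbitrary primitive is replaced by its component in the right degree.
      refine ⟨(G.proj n y).1, ?_, ?_⟩
      · rw [show ((n + 1 : ℕ) : ℤ) - 1 = n by push_cast; ring]
        exact (hA n _).1 (by rw [FiniteGrading.proj_proj, if_pos rfl])
      · change δ (G.proj n y).1 = z.1.1
        rw [← hD, ← hR.proj_apply_of_singleton (m := n + 1) (by push_cast; ring), hy, hz]

end Integral

section Mod2

variable {A : ZMod 2 → Submodule 𝕜 X} (hD : ∀ f, (D f).1 = δ f.1)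
  (hA : ∀ (e : ZMod 2) (f : C), f ∈ G.par e ↔ f.1 ∈ A e)

/-- The class of an even or odd cocycle. -/
def parClass (e : ZMod 2) : ↥(G.par e ⊓ LinearMap.ker D) →ₗ[𝕜] Coh A δ e :=
  Coh.mk A δ e ∘ₗ (C.subtype ∘ₗ Submodule.subtype _).codRestrict (Cocycles A δ e) fun z =>
    ⟨(hA e _).1 z.2.1, LinearMap.mem_ker.2 <|
      (hD _).symm.trans (congrArg Subtype.val (LinearMap.mem_ker.1 z.2.2))⟩

theorem parClass_surjective (hC : ∀ e, A e ≤ C) (e : ZMod 2) :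
    Function.Surjective (parClass G hD hA e) := by
  intro γ
  obtain ⟨z, rfl⟩ := OrderedComplex.Coh.mk_surjective A δ e γ
  refine ⟨⟨⟨z.1, hC _ z.2.1⟩, (hA e _).2 z.2.1, LinearMap.mem_ker.2 <| Subtype.ext ?_⟩, rfl⟩
  rw [hD]
  exact LinearMap.mem_ker.1 z.2.2

theorem parClass_eq_zero (hC : ∀ e, A e ≤ C) (e : ZMod 2) (z : ↥(G.par e ⊓ LinearMap.ker D)) :
    parClass G hD hA e z = 0 ↔ ∃ y ∈ G.par (e + 1), D y = z.1 := by
  have he : ∀ e : ZMod 2, e - 1 = e + 1 := by decide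
  refine OrderedComplex.Coh.mk_eq_zero.trans ?_
  rw [he]
  constructor
  · rintro ⟨y, hy, hyz⟩
    exact ⟨⟨y, hC _ hy⟩, (hA _ _).2 hy, Subtype.ext ((hD _).trans hyz)⟩
  · rintro ⟨y, hy, hyz⟩
    exact ⟨y.1, (hA _ _).1 hy, (hD _).symm.trans (congrArg Subtype.val hyz)⟩

theorem eq_parClass_iff {e : ZMod 2} (f : C) (γ : Coh A δ e) :
    (∃ hf : f.1 ∈ Cocycles A δ e, γ = Coh.mk A δ e ⟨f.1, hf⟩) ↔
      ∃ hf : f ∈ G.par e ⊓ LinearMap.ker D, γ = parClass G hD hA e ⟨f, hf⟩ := by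
  constructor
  · rintro ⟨hf, h⟩
    exact ⟨⟨(hA e f).2 hf.1, LinearMap.mem_ker.2 <|
      Subtype.ext ((hD f).trans (LinearMap.mem_ker.1 hf.2))⟩, h⟩
  · rintro ⟨hf, h⟩
    exact ⟨⟨(hA e f).1 hf.1, LinearMap.mem_ker.2 <|
      (hD f).symm.trans (congrArg Subtype.val (LinearMap.mem_ker.1 hf.2))⟩, h⟩

end Mod2

end Restrict


/-- The members of degree `i` of a combined family. -/
def levelEquiv {A C L : Type*} (src tgt : A → L) (deg : C → L) (i : L) :
    {k // FilteredComplex.level src tgt deg k = i} ≃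
      {a // tgt a = i} ⊕ₗ ({c // deg c = i} ⊕ₗ {a // src a = i}) :=
  (Equiv.subtypeSum.trans (Equiv.sumCongr (Equiv.refl _) (Equiv.subtypeSum.trans toLex))).trans toLex

namespace PerturbedComplex

variable {𝕜 : Type*} [Field 𝕜] {N : ℕ} {M : Type u} [AddCommGroup M] [Module 𝕜 M]
  {V : Fin (N + 1) → Type*} [∀ i, AddCommGroup (V i)] [∀ i, Module 𝕜 (V i)]
  (P : PerturbedComplex 𝕜 N M V)

/-! ### Adapted bases -/

/-- The element `x` has the leading term `γ` in degree `i`. -/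
def Represents (i : Fin (N + 1)) (x : M) (γ : V i) : Prop :=
  ∃ z : P.cocycles i, x - z.1 ∈ P.F (i + 1) ∧ P.cls i z = γ

variable (T : ZMod 2 → Type*) [∀ e, AddCommGroup (T e)] [∀ e, Module 𝕜 (T e)]

/-- An identification of the cohomology of the perturbed differential with a given space. -/
structure TotalClass where
  /-- The class of a cocycle. -/
  cls : ∀ e : ZMod 2, ↥(P.par e ⊓ LinearMap.ker P.total) →ₗ[𝕜] T e
  cls_surjective : ∀ e, Function.Surjective (cls e)
  cls_eq_zero : ∀ e z, cls e z = 0 ↔ ∃ y ∈ P.par (e + 1), P.total y = z.1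

variable {P T}

/-- Bases of the cohomology of the unperturbed and of the perturbed differential which are adapted
to the spectral sequence. -/
structure AdaptedBasis (Q : P.TotalClass T) {n m : ℕ} (src tgt : Fin n → Fin (N + 1))
    (deg : Fin m → Fin (N + 1)) where
  /-- The sources. -/
  x : Fin n → M
  /-- The survivors. -/
  h : Fin m → M
  x_mem : ∀ a, x a ∈ P.par (src a : ℕ)
  h_mem : ∀ c, h c ∈ P.par (deg c : ℕ)
  h_closed : ∀ c, P.total (h c) = 0
  /-- The basis of the unperturbed cohomology. -/
  basis : ∀ i : Fin (N + 1), Module.Basis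
    ({a // tgt a = i} ⊕ₗ ({c // deg c = i} ⊕ₗ {a // src a = i})) 𝕜 (V i)
  src_rep : ∀ a, P.Represents (src a) (x a)
    (basis (src a) (toLex (Sum.inr (toLex (Sum.inr ⟨a, rfl⟩)))))
  tgt_rep : ∀ a, P.Represents (tgt a) (P.total (x a))
    (basis (tgt a) (toLex (Sum.inl ⟨a, rfl⟩)))
  h_rep : ∀ c, P.Represents (deg c) (h c)
    (basis (deg c) (toLex (Sum.inr (toLex (Sum.inl ⟨c, rfl⟩)))))
  /-- The basis of the perturbed cohomology. -/
  totalBasis : ∀ e : ZMod 2, Module.Basis {c // ((deg c : ℕ) : ZMod 2) = e} 𝕜 (T e)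
  totalBasis_eq : ∀ e c, ∃ hc : h c.1 ∈ P.par e ⊓ LinearMap.ker P.total,
    totalBasis e c = Q.cls e ⟨h c.1, hc⟩

theorem mem_of_harm {e : ZMod 2} {w : P.Harm} (hw : w ∈ P.harmonicComplex.par e)
    (hw0 : P.harmonicComplex.D w = 0) : w.1 ∈ P.par e ⊓ LinearMap.ker P.total :=
  ⟨hw, congrArg Subtype.val hw0⟩

variable {n m : ℕ} {src tgt : Fin n → Fin (N + 1)} {deg : Fin m → Fin (N + 1)}

theorem survivor_mem (Y : P.harmonicComplex.NormalForm src tgt deg) {e : ZMod 2}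
    (c : {c // ((deg c : ℕ) : ZMod 2) = e}) : (Y.h c.1).1 ∈ P.par e ⊓ LinearMap.ker P.total := by
  have h := (Y.h_mem c.1).2
  rw [c.2] at h
  exact mem_of_harm h (Y.h_closed c.1)

namespace TotalClass

variable (Q : P.TotalClass T)

theorem cls_eq_cls {e : ZMod 2} {z w : ↥(P.par e ⊓ LinearMap.ker P.total)}
    (h : ∃ y ∈ P.par (e + 1), z.1 - w.1 = P.total y) : Q.cls e z = Q.cls e w := by
  rw [← sub_eq_zero, ← map_sub, Q.cls_eq_zero]
  obtain ⟨y, hy, hyz⟩ := h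
  exact ⟨y, hy, hyz.symm⟩

/-- The class of a cocycle is a combination of the classes of the survivors of a normal form. -/
theorem cls_eq_sum (Y : P.harmonicComplex.NormalForm src tgt deg) {e : ZMod 2}
    (z : ↥(P.par e ⊓ LinearMap.ker P.total)) :
    Q.cls e z = ∑ c : {c // ((deg c : ℕ) : ZMod 2) = e},
      Y.basis.repr (P.toHarm z.1) (Sum.inr (Sum.inl c.1)) • Q.cls e ⟨_, survivor_mem Y c⟩ := by
  simp only [← map_smul]
  rw [← map_sum]
  refine Q.cls_eq_cls ?_
  have hz0 : P.total z.1 = 0 := LinearMap.mem_ker.1 z.2.2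
  have h0 : P.harmonicComplex.D (P.toHarm z.1) = 0 := by rw [← P.toHarm_total, hz0, map_zero]
  obtain ⟨w, hw, hzw⟩ := Y.exists_eq_sum_add_D (P.toHarm_mem_par z.2.1) h0
  refine ⟨P.totalContraction z.1 + w.1, Submodule.add_mem _ (P.totalContraction_mem_par z.2.1) hw,
    ?_⟩
  have h1 := P.sub_toHarm hz0
  have h2 := congrArg Subtype.val hzw
  rw [Submodule.coe_add, Submodule.coe_sum] at h2
  rw [map_add, ← h1, Submodule.coe_sum, sub_eq_iff_eq_add]
  change (P.toHarm z.1).1 = _ + P.total w.1 at h2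
  have h3 : ∀ a b c t : M, b = c + t → a = a - b + t + c := fun a b c t h => by rw [h]; abel
  exact h3 _ _ _ _ h2

/-- If a combination of survivors bounds, it also bounds inside the harmonic space, since projecting
fixes the survivors; but boundaries there have no survivor coordinates. -/
theorem linearIndependent_survivors (Y : P.harmonicComplex.NormalForm src tgt deg) (e : ZMod 2) :
    LinearIndependent 𝕜 fun c : {c // ((deg c : ℕ) : ZMod 2) = e} =>
      Q.cls e ⟨_, survivor_mem Y c⟩ := by
  classical
  rw [Fintype.linearIndependent_iff]
  intro g hg c
  simp only [← map_smul] at hg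
  rw [← map_sum, Q.cls_eq_zero] at hg
  obtain ⟨y, -, hyz⟩ := hg
  rw [Submodule.coe_sum] at hyz
  have h1 : P.harmonicComplex.D (P.toHarm y) =
      ∑ c : {c // ((deg c : ℕ) : ZMod 2) = e}, g c • Y.basis (Sum.inr (Sum.inl c.1)) := by
    rw [← P.toHarm_total, hyz, map_sum]
    refine Finset.sum_congr rfl fun c _ => ?_
    rw [Y.basis_inr_inl]
    exact P.toHarm_coe (g c • Y.h c.1)
  have h2 := Y.repr_D_inr (P.toHarm y) (Sum.inl c.1)
  rw [h1, map_sum, Finsupp.finsetSum_apply, Finset.sum_eq_single c] at h2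
  · simpa using h2
  · intro c' _ hc'
    have : c'.1 ≠ c.1 := fun h => hc' (Subtype.ext h)
    simp [this]
  · simp

/-- The classes of the survivors of a normal form as a basis. -/
def basis (Y : P.harmonicComplex.NormalForm src tgt deg) (e : ZMod 2) :
    Module.Basis {c // ((deg c : ℕ) : ZMod 2) = e} 𝕜 (T e) :=
  Module.Basis.mk (Q.linearIndependent_survivors Y e) fun v _ => by
    obtain ⟨z, rfl⟩ := Q.cls_surjective e v
    rw [Q.cls_eq_sum Y z]
    exact Submodule.sum_mem _ fun c _ => Submodule.smul_mem _ _ (Submodule.subset_span ⟨c, rfl⟩)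

theorem basis_apply (Y : P.harmonicComplex.NormalForm src tgt deg) (e : ZMod 2)
    (c : {c // ((deg c : ℕ) : ZMod 2) = e}) :
    Q.basis Y e c = Q.cls e ⟨_, survivor_mem Y c⟩ := by
  rw [basis, Module.Basis.mk_apply]

/-- Coordinates of a twisted class are the survivor coordinates of the harmonic part of a
representative, so base changes in twisted cohomology can be read off in the harmonic space. -/
theorem basis_repr (Y : P.harmonicComplex.NormalForm src tgt deg) {e : ZMod 2}
    (z : ↥(P.par e ⊓ LinearMap.ker P.total)) (c : {c // ((deg c : ℕ) : ZMod 2) = e}) :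
    (Q.basis Y e).repr (Q.cls e z) c =
      Y.basis.repr (P.toHarm z.1) (Sum.inr (Sum.inl c.1)) := by
  have h := Q.cls_eq_sum Y z
  simp only [← Q.basis_apply] at h
  rw [h, Module.Basis.repr_sum_self]

theorem cls_toHarm {e : ZMod 2} (z w : ↥(P.par e ⊓ LinearMap.ker P.total))
    (h : w.1 = (P.toHarm z.1).1) : Q.cls e z = Q.cls e w := by
  refine Q.cls_eq_cls ⟨P.totalContraction z.1, P.totalContraction_mem_par z.2.1, ?_⟩
  rw [h, P.sub_toHarm (LinearMap.mem_ker.1 z.2.2)]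

variable {Q}

/-- An adapted basis given by a normal form of the perturbed harmonic space. -/
def adaptedBasis (Q : P.TotalClass T) (Y : P.harmonicComplex.NormalForm src tgt deg) :
    AdaptedBasis Q src tgt deg where
  x a := (Y.x a).1
  h c := (Y.h c).1
  x_mem a := (Y.x_mem a).2
  h_mem c := (Y.h_mem c).2
  h_closed c := congrArg Subtype.val (Y.h_closed c)
  basis i := (Y.leadBasis i).reindex (levelEquiv src tgt deg i)
  src_rep a := by
    rw [Module.Basis.reindex_apply]
    change P.Represents _ _ (Y.leadBasis (src a) ⟨Sum.inr (Sum.inr a), rfl⟩)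
    rw [Y.leadBasis_apply, Y.basis_inr_inr]
    exact P.exists_cocycle (Y.x_mem a).1
  tgt_rep a := by
    rw [Module.Basis.reindex_apply]
    change P.Represents _ _ (Y.leadBasis (tgt a) ⟨Sum.inl a, rfl⟩)
    rw [Y.leadBasis_apply, Y.basis_inl]
    exact P.exists_cocycle (Y.D_mem a)
  h_rep c := by
    rw [Module.Basis.reindex_apply]
    change P.Represents _ _ (Y.leadBasis (deg c) ⟨Sum.inr (Sum.inl c), rfl⟩)
    rw [Y.leadBasis_apply, Y.basis_inr_inl]
    exact P.exists_cocycle (Y.h_mem c).1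
  totalBasis := Q.basis Y
  totalBasis_eq e c := ⟨survivor_mem Y c, Q.basis_apply Y e c⟩

end TotalClass

namespace AdaptedBasis

variable {Q : P.TotalClass T} (S : AdaptedBasis Q src tgt deg)

/-- Harmonic parts of the representatives keep their leading classes, and projection commutes with
the differential; this is what `NormalForm.ofLead` asks for. -/
theorem lead_eq (i : Fin (N + 1)) (k : {k // FilteredComplex.level src tgt deg k = i}) :
    P.harmonicComplex.family (fun a => P.toHarm (S.x a)) (fun c => P.toHarm (S.h c)) k.1 ∈
        P.harmonicComplex.F i ∧
      (S.basis i).reindex (levelEquiv src tgt deg i).symm k = P.harmonicComplex.lead i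
        (P.harmonicComplex.family (fun a => P.toHarm (S.x a)) (fun c => P.toHarm (S.h c)) k.1) := by
  rw [Module.Basis.reindex_apply, Equiv.symm_symm]
  obtain ⟨a | c | a, rfl⟩ := k
  · obtain ⟨z, hz, hγ⟩ := S.tgt_rep a
    have h := P.lead_toHarm hz
    rw [hγ, P.toHarm_total] at h
    exact ⟨h.1, h.2.symm⟩
  · obtain ⟨z, hz, hγ⟩ := S.h_rep c
    have h := P.lead_toHarm hz
    rw [hγ] at h
    exact ⟨h.1, h.2.symm⟩
  · obtain ⟨z, hz, hγ⟩ := S.src_rep a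
    have h := P.lead_toHarm hz
    rw [hγ] at h
    exact ⟨h.1, h.2.symm⟩

/-- The normal form of the perturbed harmonic space given by an adapted basis. -/
def normalForm : P.harmonicComplex.NormalForm src tgt deg :=
  FilteredComplex.NormalForm.ofLead (x := fun a => P.toHarm (S.x a)) (h := fun c => P.toHarm (S.h c))
    (fun a => ⟨(S.lead_eq _ ⟨Sum.inr (Sum.inr a), rfl⟩).1, P.toHarm_mem_par (S.x_mem a)⟩)
    (fun a => (S.lead_eq _ ⟨Sum.inl a, rfl⟩).1)
    (fun c => ⟨(S.lead_eq _ ⟨Sum.inr (Sum.inl c), rfl⟩).1, P.toHarm_mem_par (S.h_mem c)⟩)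
    (fun c => by rw [← P.toHarm_total, S.h_closed, map_zero])
    (fun i => (S.basis i).reindex (levelEquiv src tgt deg i).symm) fun i k => (S.lead_eq i k).2

theorem basis_eq (i : Fin (N + 1)) :
    S.basis i = (S.normalForm.leadBasis i).reindex (levelEquiv src tgt deg i) := by
  refine Module.Basis.eq_of_apply_eq fun k => ?_
  rw [Module.Basis.reindex_apply, FilteredComplex.NormalForm.leadBasis_apply,
    FilteredComplex.NormalForm.coe_basis]
  have h := (S.lead_eq i ((levelEquiv src tgt deg i).symm k)).2
  rw [Module.Basis.reindex_apply, Equiv.symm_symm, Equiv.apply_symm_apply] at h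
  exact h

theorem totalBasis_eq_basis (e : ZMod 2) : S.totalBasis e = Q.basis S.normalForm e := by
  refine Module.Basis.eq_of_apply_eq fun c => ?_
  obtain ⟨hc, h⟩ := S.totalBasis_eq e c
  rw [h, Q.basis_apply]
  exact Q.cls_toHarm _ _ rfl

/-- The harmonic part of a survivor represents the same twisted class, so the base change in twisted
cohomology is the survivor block of the comparison of normal forms. -/
theorem toMatrix_totalBasis (S' : AdaptedBasis Q src tgt deg) (e : ZMod 2) :
    (S.totalBasis e).toMatrix (S'.totalBasis e) =
      FilteredComplex.NormalForm.survivorMatrix S.normalForm S'.normalForm e := by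
  ext c c'
  rw [totalBasis_eq_basis, totalBasis_eq_basis, Module.Basis.toMatrix_apply, Q.basis_apply,
    Q.basis_repr, P.toHarm_coe]
  rw [FilteredComplex.NormalForm.survivorMatrix, Matrix.of_apply, Module.Basis.toMatrix_apply,
    FilteredComplex.NormalForm.basis_inr_inl]

theorem det_toMatrix_basis (S' : AdaptedBasis Q src tgt deg) (i : Fin (N + 1)) :
    ((S.basis i).toMatrix (S'.basis i)).det =
      ((S.normalForm.leadBasis i).toMatrix (S'.normalForm.leadBasis i)).det := by
  rw [basis_eq, basis_eq, ← Matrix.det_reindex_self (levelEquiv src tgt deg i)]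
  congr 1
  ext k l
  simp [Module.Basis.toMatrix_apply]

include S in
theorem euler : ∑ i : Fin (N + 1), (-1 : ℤ) ^ (i : ℕ) * Module.finrank 𝕜 (V i) =
    (Module.finrank 𝕜 (T 0) : ℤ) - Module.finrank 𝕜 (T 1) := by
  have h1 : ∀ {ι : Type} [Fintype ι] (f : ι → Fin (N + 1)),
      ∑ i : Fin (N + 1), (-1 : ℤ) ^ (i : ℕ) * Fintype.card {a // f a = i} =
        ∑ a, (-1 : ℤ) ^ (f a : ℕ) := by
    intro ι _ f
    rw [← Finset.sum_fiberwise Finset.univ f]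
    refine Finset.sum_congr rfl fun i _ => ?_
    rw [Finset.sum_congr rfl fun a ha => by rw [(Finset.mem_filter.1 ha).2], Finset.sum_const,
      Fintype.card_subtype, nsmul_eq_mul, mul_comm]
  have h2 : ∀ k : ℕ, (-1 : ℤ) ^ k =
      (if (k : ZMod 2) = 0 then 1 else 0) - (if (k : ZMod 2) = 1 then 1 else 0) := by
    intro k
    rcases Nat.even_or_odd k with hk | hk
    · rw [(ZMod.natCast_eq_zero_iff_even).2 hk, hk.neg_one_pow]; rfl
    · rw [(ZMod.natCast_eq_one_iff_odd).2 hk, hk.neg_one_pow]; rfl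
  -- Source and target of a pair have opposite parity and cancel in the Euler characteristic.
  have h3 : ∀ a, (-1 : ℤ) ^ (tgt a : ℕ) + (-1 : ℤ) ^ (src a : ℕ) = 0 := by
    intro a
    have h4 : ∀ s : ZMod 2, ((if s + 1 = 0 then 1 else 0) - (if s + 1 = 1 then 1 else 0) : ℤ) +
      ((if s = 0 then 1 else 0) - (if s = 1 then 1 else 0)) = 0 := by decide
    rw [h2, h2, S.normalForm.parity_tgt, h4]
  have h5 : ∀ e : ZMod 2, (Module.finrank 𝕜 (T e) : ℤ) =
      ∑ c, (if ((deg c : ℕ) : ZMod 2) = e then 1 else 0) := by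
    intro e
    rw [Module.finrank_eq_card_basis (S.totalBasis e), Fintype.card_subtype, Finset.sum_boole]
  rw [h5, h5, ← Finset.sum_sub_distrib]
  simp only [← h2]
  have h6 : ∀ i : Fin (N + 1), (-1 : ℤ) ^ (i : ℕ) * Module.finrank 𝕜 (V i) =
      (-1) ^ (i : ℕ) * Fintype.card {a // tgt a = i} +
        (-1) ^ (i : ℕ) * Fintype.card {c // deg c = i} +
        (-1) ^ (i : ℕ) * Fintype.card {a // src a = i} := by
    intro i
    have h : Fintype.card ({a // tgt a = i} ⊕ₗ ({c // deg c = i} ⊕ₗ {a // src a = i})) =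
        Fintype.card {a // tgt a = i} + (Fintype.card {c // deg c = i} +
          Fintype.card {a // src a = i}) := by
      rw [Fintype.card_lex, Fintype.card_sum, Fintype.card_lex, Fintype.card_sum]
    rw [Module.finrank_eq_card_basis (S.basis i), h]
    push_cast
    ring
  have h7 := Finset.sum_eq_zero fun a (_ : a ∈ Finset.univ) => h3 a
  rw [Finset.sum_add_distrib] at h7
  rw [Finset.sum_congr rfl fun i _ => h6 i, Finset.sum_add_distrib, Finset.sum_add_distrib, h1, h1,
    h1]
  linarith

end AdaptedBasis

theorem exists_adaptedBasis (Q : P.TotalClass T) [∀ i, FiniteDimensional 𝕜 (V i)] :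
    ∃ (n m : ℕ) (src tgt : Fin n → Fin (N + 1)) (deg : Fin m → Fin (N + 1)),
      Monotone (fun a => toLex (src a, tgt a)) ∧ Monotone deg ∧
      Nonempty (AdaptedBasis Q src tgt deg) := by
  have := P.harmonicComplex.finiteDimensional inferInstance
  obtain ⟨n, m, src, tgt, deg, hp, hs, ⟨Y⟩⟩ := P.harmonicComplex.exists_normalForm
  exact ⟨n, m, src, tgt, deg, hp, hs, ⟨Q.adaptedBasis Y⟩⟩

end PerturbedComplex

namespace PerturbedComplex.AdaptedBasis

variable {𝕜 : Type*} [Field 𝕜] {N : ℕ} {M : Type u} [AddCommGroup M] [Module 𝕜 M]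
  {H : ℕ → Type*} [∀ i, AddCommGroup (H i)] [∀ i, Module 𝕜 (H i)]
  {P : PerturbedComplex 𝕜 N M fun i => H (i : ℕ)}
  {T : ZMod 2 → Type*} [∀ e, AddCommGroup (T e)] [∀ e, Module 𝕜 (T e)] {Q : P.TotalClass T}
  {n m n' m' : ℕ} {src tgt : Fin n → Fin (N + 1)} {deg : Fin m → Fin (N + 1)}
  {src' tgt' : Fin n' → Fin (N + 1)} {deg' : Fin m' → Fin (N + 1)}

/-- The generators of the determinant lines given by two adapted bases differ by the same factor. -/
theorem exists_smul (S : AdaptedBasis Q src tgt deg) (S' : AdaptedBasis Q src' tgt' deg')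
    (hp : Monotone fun a => toLex (src a, tgt a)) (hs : Monotone deg)
    (hp' : Monotone fun a => toLex (src' a, tgt' a)) (hs' : Monotone deg') :
    ∃ c : 𝕜, gradedVol (H := H) S'.basis = c • gradedVol (H := H) S.basis ∧
      mod2Vol S'.totalBasis = c • mod2Vol S.totalBasis := by
  -- The degree data of the two bases coincide, so after identifying them both bases are indexed by
  -- the same ordered sets and have transition matrices.
  obtain ⟨h1, h2⟩ := S.normalForm.degrees_eq S'.normalForm hp hp' hs hs'
  obtain ⟨rfl, h1⟩ := Sigma.mk.inj_iff.1 h1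
  obtain ⟨rfl, h2⟩ := Sigma.mk.inj_iff.1 h2
  obtain rfl := eq_of_heq h2
  have h1 := eq_of_heq h1
  obtain rfl : src = src' := funext fun a => congrArg (fun z => (ofLex z).1) (congrFun h1 a)
  obtain rfl : tgt = tgt' := funext fun a => congrArg (fun z => (ofLex z).2) (congrFun h1 a)
  refine ⟨_, gradedVol_eq_smul (H := H) S.basis S'.basis, ?_⟩
  have h := FilteredComplex.NormalForm.prod_det_leadBasis S.normalForm S'.normalForm
  simp only [← det_toMatrix_basis] at h
  rw [mod2Vol_eq_smul S.totalBasis S'.totalBasis, toMatrix_totalBasis, toMatrix_totalBasis]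
  congr 1
  convert h.symm

/-- The isomorphism of determinant lines given by adapted bases. -/
theorem exists_equiv (S : AdaptedBasis Q src tgt deg)
    (hp : Monotone fun a => toLex (src a, tgt a)) (hs : Monotone deg) :
    ∃ Φ : DetGraded 𝕜 N H ≃ₗ[𝕜] DetMod2 𝕜 T,
      (∀ Ψ : DetGraded 𝕜 N H ≃ₗ[𝕜] DetMod2 𝕜 T,
        Ψ (gradedVol (H := H) S.basis) = mod2Vol S.totalBasis → Ψ = Φ) ∧
      ∀ {n' m' : ℕ} {src' tgt' : Fin n' → Fin (N + 1)} {deg' : Fin m' → Fin (N + 1)}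
        (S' : AdaptedBasis Q src' tgt' deg'), Monotone (fun a => toLex (src' a, tgt' a)) →
        Monotone deg' → Φ (gradedVol (H := H) S'.basis) = mod2Vol S'.totalBasis := by
  obtain ⟨β, hβ⟩ := exists_gradedBasis (H := H) S.basis
  obtain ⟨β', hβ'⟩ := exists_mod2Basis S.totalBasis
  -- Both determinant spaces are lines, so an isomorphism is determined by its value on one
  -- generator.
  refine ⟨β.equiv β' (Equiv.refl _), fun Ψ hΨ => ?_, fun S' hp' hs' => ?_⟩
  · refine LinearEquiv.toLinearMap_injective (β.ext fun i => ?_)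
    change Ψ (β ()) = β.equiv β' (Equiv.refl _) (β ())
    rw [Module.Basis.equiv_apply, hβ, hΨ]
    exact hβ'.symm
  · obtain ⟨c, h1, h2⟩ := S.exists_smul S' hp hs hp' hs'
    rw [h1, h2, map_smul, ← hβ, Module.Basis.equiv_apply]
    exact congrArg (c • ·) hβ'

end PerturbedComplex.AdaptedBasis

namespace OrderedComplex

variable {V : Type*} [PartialOrder V] {K : OrderedComplex V} {v₀ : V}
variable {𝕜 E : Type*} [RCLike 𝕜] [AddCommGroup E] [Module 𝕜 E] [Module ℝ E] [IsScalarTower ℝ 𝕜 E]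

/-! ### The twisted complex as a perturbed complex -/

section Perturbed

variable (ρ : Representation 𝕜 (K.π₁ v₀) E)

theorem currents_int_le (n : ℤ) : K.currents ρ ℤ n ≤ Currents ρ := fun _ h =>
  mem_filtration_zero h.1

theorem currents_mod_two_le (e : ZMod 2) : K.currents ρ (ZMod 2) e ≤ Currents ρ := fun _ h =>
  mem_filtration_zero h.1

/-- The differential of `𝔪^•(K, E)`. -/
def currentsD : Module.End 𝕜 (Currents ρ) := compEnd ρ (Du.deck_boundary K)

/-- The product by `t` on `𝔪^•(K, E)`. -/
def currentsTwist (t : K.OddForm) : Module.End 𝕜 (Currents ρ) :=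
  compEnd ρ fun g => Du.deck_twist K g t

theorem currentsD_apply (f : Currents ρ) :
    (currentsD ρ f).1 = K.dCurrents v₀ 𝕜 E f.1 := rfl

theorem currentsD_add_currentsTwist_apply (t : K.OddForm) (f : Currents ρ) :
    ((currentsD ρ + currentsTwist ρ t) f).1 = K.dTwisted v₀ 𝕜 E t f.1 := rfl

variable [Finite V]

theorem raises_currentsD : (currentsGrading ρ).Raises {1} (currentsD ρ) :=
  raises_compEnd ρ _ (Du.shifts_boundary _) fun m n h => by
    simp only [Set.mem_singleton_iff]
    omega

theorem raises_currentsTwist (t : K.OddForm) :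
    (currentsGrading ρ).Raises {s | 3 ≤ s ∧ Odd s} (currentsTwist ρ t) :=
  raises_compEnd ρ _ (Du.shifts_twist K t) fun m n h => ⟨by have := h.1; omega, h.2⟩

omit [Finite V] in
theorem currentsD_mul_self : currentsD ρ * currentsD ρ = 0 :=
  LinearMap.ext fun f => Subtype.ext <| by
    change (f.1 ∘ₗ Du.boundary _) ∘ₗ Du.boundary _ = 0
    rw [LinearMap.comp_assoc, Du.boundary_boundary, LinearMap.comp_zero]

omit [Finite V] in
theorem currentsD_add_currentsTwist_apply' (t : K.OddForm) (f : Currents ρ) (x : (K.cover v₀).Du) :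
    ((currentsD ρ + currentsTwist ρ t) f).1 x =
      f.1 ((Du.boundary (K.cover v₀) + K.twist v₀ t) x) :=
  (map_add f.1 (Du.boundary (K.cover v₀) x) (K.twist v₀ t x)).symm

omit [Finite V] in
theorem currentsD_add_currentsTwist_sq {t : K.OddForm} (ht : K.IsClosed t) :
    (currentsD ρ + currentsTwist ρ t) * (currentsD ρ + currentsTwist ρ t) = 0 :=
  LinearMap.ext fun f => Subtype.ext <| LinearMap.ext fun x => by
    have h := LinearMap.congr_fun (boundary_add_twist_sq (v₀ := v₀) ht) x
    rw [Module.End.mul_apply, currentsD_add_currentsTwist_apply',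
      currentsD_add_currentsTwist_apply']
    exact (congrArg f.1 h).trans (map_zero f.1)

/-- The class in `H^n(K, E)` of a homogeneous cocycle of `𝔪^•(K, E)`. -/
def currentsClass (n : ℕ) :
    ↥(LinearMap.ker (1 - (currentsGrading ρ).proj n) ⊓ LinearMap.ker (currentsD ρ)) →ₗ[𝕜]
      K.H ρ n :=
  gradedClass (currentsGrading ρ) n (K.HPsi ρ n) (currentsD_apply ρ) fun _ _ => proj_eq_self_iff

/-- The twisted complex as a perturbation of `𝔪^•(K, E)`. -/
def perturbedComplex {t : K.OddForm} (ht : K.IsClosed t) :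
    PerturbedComplex 𝕜 K.dim (Currents ρ) fun i => K.H ρ (i : ℕ) where
  toFiniteGrading := currentsGrading ρ
  d := currentsD ρ
  τ := currentsTwist ρ t
  d_mul_d := currentsD_mul_self ρ
  total_mul_total := currentsD_add_currentsTwist_sq ρ ht
  raises_d := raises_currentsD ρ
  raises_τ := raises_currentsTwist ρ t
  cls i := currentsClass ρ i
  cls_surjective i := gradedClass_surjective (currentsGrading ρ) i (K.HPsi ρ (i : ℕ))
    (currentsD_apply ρ) (fun _ _ => proj_eq_self_iff) (currents_int_le ρ) (HPsi_bijective _)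
  cls_eq_zero i := gradedClass_eq_zero (currentsGrading ρ) i (K.HPsi ρ (i : ℕ)) (currentsD_apply ρ)
    (fun _ _ => proj_eq_self_iff) (currents_int_le ρ) (raises_currentsD ρ) (HPsi_bijective _)

variable {ρ} {t : K.OddForm} (ht : K.IsClosed t)

theorem total_apply (f : Currents ρ) :
    ((perturbedComplex ρ ht).total f).1 = K.dTwisted v₀ 𝕜 E t f.1 := rfl

theorem represents_iff {i : Fin (K.dim + 1)} {f : Currents ρ} {γ : K.H ρ (i : ℕ)} :
    K.Represents ρ (i : ℕ) f.1 γ ↔ ∃ z : (perturbedComplex ρ ht).cocycles i,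
      f - z.1 ∈ (perturbedComplex ρ ht).F (i + 1) ∧ (perturbedComplex ρ ht).cls i z = γ := by
  refine (represents_iff_gradedClass (currentsGrading ρ) i (K.HPsi ρ (i : ℕ)) (currentsD_apply ρ)
    (fun _ _ => proj_eq_self_iff) (currents_int_le ρ) (K.filtration ρ ((i : ℕ) + 1)) f γ).trans ?_
  refine exists_congr fun z => and_congr_left fun _ => ?_
  have h := mem_F_iff (p := (i : ℕ) + 1) (f := f - z.1)
  rw [Nat.cast_succ] at h
  exact h.symm

/-- The identification of the cohomology of the twisted differential on `𝔪^•(K, E)` with the twisted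
cohomology. -/
def twistedClass : (perturbedComplex ρ ht).TotalClass (K.HTwisted ρ t) where
  cls := parClass (currentsGrading ρ) (currentsD_add_currentsTwist_apply ρ t) fun _ _ => mem_par_iff
  cls_surjective := parClass_surjective (currentsGrading ρ) (currentsD_add_currentsTwist_apply ρ t)
    (fun _ _ => mem_par_iff) (currents_mod_two_le ρ)
  cls_eq_zero := parClass_eq_zero (currentsGrading ρ) (currentsD_add_currentsTwist_apply ρ t)
    (fun _ _ => mem_par_iff) (currents_mod_two_le ρ)

theorem eq_twistedClass_iff {e : ZMod 2} (f : Currents ρ) (γ : K.HTwisted ρ t e) :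
    (∃ hf : f.1 ∈ Cocycles (K.currents ρ (ZMod 2)) (K.dTwisted v₀ 𝕜 E t) e,
      γ = Coh.mk (K.currents ρ (ZMod 2)) (K.dTwisted v₀ 𝕜 E t) e ⟨f.1, hf⟩) ↔
      ∃ hf : f ∈ (perturbedComplex ρ ht).par e ⊓ LinearMap.ker (perturbedComplex ρ ht).total,
        γ = (twistedClass (ρ := ρ) ht).cls e ⟨f, hf⟩ :=
  eq_parClass_iff (currentsGrading ρ) (currentsD_add_currentsTwist_apply ρ t)
    (fun _ _ => mem_par_iff) f γ

end Perturbed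

end OrderedComplex

namespace OrderedComplex

variable {V : Type*} [PartialOrder V] {K : OrderedComplex V} {v₀ : V}
variable {𝕜 E : Type*} [RCLike 𝕜] [AddCommGroup E] [Module 𝕜 E] [Module ℝ E] [IsScalarTower ℝ 𝕜 E]
  [Finite V] {ρ : Representation 𝕜 (K.π₁ v₀) E} {t : K.OddForm} (ht : K.IsClosed t)

/-! ### Spectral bases as adapted bases -/

/-- A spectral basis as an adapted basis. -/
def SpectralBasis.adaptedBasis (S : K.SpectralBasis ρ t) :
    PerturbedComplex.AdaptedBasis (twistedClass (ρ := ρ) ht) S.src S.tgt S.deg where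
  x a := ⟨S.x a, currents_mod_two_le ρ _ (S.x_mem a)⟩
  h c := ⟨S.h c, currents_mod_two_le ρ _ (S.h_mem c)⟩
  x_mem a := mem_par_iff.2 (S.x_mem a)
  h_mem c := mem_par_iff.2 (S.h_mem c)
  h_closed c := Subtype.ext (S.h_closed c)
  basis := S.basis
  src_rep a := (represents_iff ht).1 (S.src_rep a)
  tgt_rep a := (represents_iff ht).1 (S.tgt_rep a)
  h_rep c := (represents_iff ht).1 (S.h_rep c)
  totalBasis := S.twistedBasis
  totalBasis_eq e c := (eq_twistedClass_iff ht _ _).1 (S.twistedBasis_eq e c)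

/-- An adapted basis as a spectral basis. -/
def spectralBasis {n m : ℕ} {src tgt : Fin n → Fin (K.dim + 1)} {deg : Fin m → Fin (K.dim + 1)}
    (hp : Monotone fun a => toLex (src a, tgt a)) (hs : Monotone deg)
    (S : PerturbedComplex.AdaptedBasis (twistedClass (ρ := ρ) ht) src tgt deg) :
    K.SpectralBasis ρ t where
  pairs := n
  survivors := m
  src := src
  tgt := tgt
  deg := deg
  mono_pairs := hp
  mono_survivors := hs
  x a := (S.x a).1
  h c := (S.h c).1
  x_mem a := mem_par_iff.1 (S.x_mem a)
  h_mem c := mem_par_iff.1 (S.h_mem c)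
  h_closed c := (total_apply ht (S.h c)).symm.trans (congrArg Subtype.val (S.h_closed c))
  basis := S.basis
  src_rep a := (represents_iff ht).2 (S.src_rep a)
  tgt_rep a := (represents_iff ht).2 (S.tgt_rep a)
  h_rep c := (represents_iff ht).2 (S.h_rep c)
  twistedBasis := S.totalBasis
  twistedBasis_eq e c := (eq_twistedClass_iff ht (S.h c.1) _).2 (S.totalBasis_eq e c)

end OrderedComplex

end

end TwistedTorsion

theorem lemma3 {V : Type*} [PartialOrder V] [Finite V] (K : TwistedTorsion.OrderedComplex V)
    (hK : K.IsConnected) (v₀ : V) {𝕜 E : Type*} [RCLike 𝕜] [AddCommGroup E] [Module 𝕜 E]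
    [Module ℝ E] [IsScalarTower ℝ 𝕜 E] [FiniteDimensional 𝕜 E]
    (ρ : Representation 𝕜 (K.π₁ v₀) E) :
    (∀ n : ℤ, Function.Bijective (K.HPsi ρ n)) ∧
    ∀ t : K.OddForm, K.IsClosed t →
      (∀ n : ℤ, FiniteDimensional 𝕜 (K.H ρ n)) ∧
      (∀ e : ZMod 2, FiniteDimensional 𝕜 (K.HTwisted ρ t e)) ∧
      ∑ i : Fin (K.dim + 1), (-1 : ℤ) ^ (i : ℕ) * Module.finrank 𝕜 (K.H ρ (i : ℕ)) =
        (Module.finrank 𝕜 (K.HTwisted ρ t 0) : ℤ) - Module.finrank 𝕜 (K.HTwisted ρ t 1) ∧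
      Nonempty (K.SpectralBasis ρ t) ∧
      ∃! Φ : K.DetH ρ ≃ₗ[𝕜] K.DetHTwisted ρ t, K.IsCanonical ρ t Φ := by
  refine ⟨fun n => TwistedTorsion.OrderedComplex.HPsi_bijective n, fun t ht => ?_⟩
  have hfin := fun n : ℤ => TwistedTorsion.OrderedComplex.finiteDimensional_H (ρ := ρ) n
  have hfin' := fun i : Fin (K.dim + 1) => hfin (i : ℕ)
  have hB := TwistedTorsion.PerturbedComplex.exists_adaptedBasis
    (TwistedTorsion.OrderedComplex.twistedClass (ρ := ρ) ht)
  refine hB.elim fun n hB => hB.elim fun m hB => hB.elim fun src hB => hB.elim fun tgt hB =>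
    hB.elim fun deg hB => hB.2.2.elim fun B => ?_
  -- The cohomology groups are passed as a family over all natural degrees, since the basis `B`
  -- involves only its restriction to degrees up to `K.dim`.
  have key := @TwistedTorsion.PerturbedComplex.AdaptedBasis.exists_equiv 𝕜 _ K.dim
    (TwistedTorsion.OrderedComplex.Currents ρ) _ _ (fun i => K.H ρ i) _ _
    (TwistedTorsion.OrderedComplex.perturbedComplex ρ ht) (K.HTwisted ρ t) _ _
    (TwistedTorsion.OrderedComplex.twistedClass ht) _ _ _ _ _ B hB.1 hB.2.1
  refine key.elim fun Φ hΦ => ?_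
  refine ⟨hfin, fun e => Module.Finite.of_basis (B.totalBasis e), B.euler,
    ⟨TwistedTorsion.OrderedComplex.spectralBasis ht hB.1 hB.2.1 B⟩, Φ, fun S => ?_,
    fun Ψ hΨ => hΦ.1 Ψ ?_⟩
  · have h := hΦ.2 (S.adaptedBasis ht) S.mono_pairs S.mono_survivors
    exact h
  · exact hΨ (TwistedTorsion.OrderedComplex.spectralBasis ht hB.1 hB.2.1 B)
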